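/- Work on the word RAM with words of $w$ bits: arithmetic on words ($+,-,\times$ modulo $2^w$ and integer division), bitwise operations, shifts, comparisons and reading a word of memory take unit time. Let $C[0..m]$ be a sequence of symbols from $\{0,\dots,\sigma-1\}$, where $\sigma\ge 3$, $\sigma^4\le 2^w$ and $m+1<2^w$, and suppose that $C$ can be read only through access queries (given $p$, return $C[p]$), each of which takes time $t\ge 1$. Put $\mathrm{rank}_a(p,C)=|\{k : 0\le k\le p,\ C[k]=a\}|$. For $0\le i\le j\le m$ and a symbol $a$, the interval rank query $\mathrm{rank}_a(i,j,C)$ asks for the pair $(\mathrm{rank}_a(i',C),\mathrm{rank}_a(j',C))$, where $i'$ and $j'$ are the leftmost and the rightmost positions of $a$ in $C[i..j]$, and for the answer null if $a$ does not occur in $C[i..j]$; it is a small interval rank query if $j-i\le 2\log_2^2\sigma$. Then small interval rank queries on $C$ can be supported in $O(t)$ time with $O(m\log_2\log_2\sigma)$ bits in addition to the access to $C$. Precisely: there are one query program and one absolute constant $K$ such that for all $w,\sigma,m,C$ as above there is a string of at most $K\,m\log_2\log_2\sigma$ bits (stored in $w$-bit words, read-only, padded with zeros) with which the program, given $a,i,j,m,\sigma,w$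 and using a constant number of registers, answers every small interval rank query on $C$ in time at most $K\,t$, for every $t\ge 1$. -/

import Mathlib

/-! ### Interval rank queries on a sequence -/

/-- `seqRank C a p` is the number of occurrences of the symbol `a` in `C[0..p]`
(position `p` included). -/
def seqRank {m σ : ℕ} (C : Fin (m + 1) → Fin σ) (a : Fin σ) (p : Fin (m + 1)) : ℕ :=
  ((Finset.Iic p).filter (fun k => C k = a)).card

/-- The positions of the symbol `a` inside `C[i..j]`. -/
def occurrences {m σ : ℕ} (C : Fin (m + 1) → Fin σ) (a : Fin σ) (i j : Fin (m + 1)) :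
    Finset (Fin (m + 1)) :=
  (Finset.Icc i j).filter (fun k => C k = a)

/-- The answer to the interval rank query for `a` on `C[i..j]`: the ranks of the leftmost and of the
rightmost occurrence of `a` in `C[i..j]`, and `none` (null) if `a` does not occur there. -/
def intervalRank {m σ : ℕ} (C : Fin (m + 1) → Fin σ) (a : Fin σ) (i j : Fin (m + 1)) :
    Option (ℕ × ℕ) :=
  if h : (occurrences C a i j).Nonempty then
    some (seqRank C a ((occurrences C a i j).min' h),
      seqRank C a ((occurrences C a i j).max' h))
  else none

/-! ### The word RAM

Registers hold words, that is, natural numbers below `2 ^ w`. A query program is a fixed finite list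
of instructions. It may read the additional bits of the data structure, one word at a time, and it
may ask for a symbol of the sequence `C` through the access operation. The data structure is static:
a query cannot change it, and its work space is the finitely many registers it names. -/

namespace WordRAM

/-- Word operations. -/
inductive BinOp
  | add | sub | mul | div | and | or | xor | shl | shr

/-- Arithmetic is modulo `2 ^ w`; `mul` gives the lower word of the product, `div` rounds down. -/
def BinOp.eval (w : ℕ) : BinOp → ℕ → ℕ → ℕ
  | .add, x, y => (x + y) % 2 ^ w
  | .sub, x, y => (x + (2 ^ w - y)) % 2 ^ w
  | .mul, x, y => (x * y) % 2 ^ w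
  | .div, x, y => x / y
  | .and, x, y => x &&& y
  | .or, x, y => x ||| y
  | .xor, x, y => x ^^^ y
  | .shl, x, y => (x <<< y) % 2 ^ w
  | .shr, x, y => x >>> y

/-- Instructions; `d`, `x`, `y` are names of registers. -/
inductive Instr
  /-- `R[d] := c` -/
  | const (d c : ℕ)
  /-- `R[d] := R[x] o R[y]` -/
  | op (o : BinOp) (d x y : ℕ)
  /-- `R[d] :=` the word of the additional bits with address `R[x]` -/
  | load (d x : ℕ)
  /-- `R[d] := C[R[x]]` -/
  | access (d x : ℕ)
  /-- if `R[x] < R[y]`, go to instruction number `l`, otherwise continue -/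
  | jumpLt (x y l : ℕ)

abbrev Program := List Instr

/-- A configuration: the number of the next instruction and the contents of the registers. -/
structure Config where
  pc : ℕ
  reg : ℕ → ℕ

/-- The `k`-th word (`w` bits) of the bit string `D`, which is read as zero past its end. -/
def memWord (w : ℕ) (D : List Bool) (k : ℕ) : ℕ :=
  ∑ b ∈ Finset.range w, if D.getD (k * w + b) false then 2 ^ b else 0

/-- The symbol `C[p]` as a number (`0` when `p` is not a position of `C`). -/
def symbolAt {m σ : ℕ} (C : Fin (m + 1) → Fin σ) (p : ℕ) : ℕ :=
  if h : p < m + 1 then (C ⟨p, h⟩ : ℕ) else 0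

/-- Write a register and move to the next instruction. -/
def Config.write (s : Config) (d v : ℕ) : Config :=
  ⟨s.pc + 1, Function.update s.reg d v⟩

/-- Effect of one instruction. -/
def Instr.exec {m σ : ℕ} (w : ℕ) (C : Fin (m + 1) → Fin σ) (D : List Bool) (s : Config) :
    Instr → Config
  | .const d c => s.write d (c % 2 ^ w)
  | .op o d x y => s.write d (o.eval w (s.reg x) (s.reg y))
  | .load d x => s.write d (memWord w D (s.reg x))
  | .access d x => s.write d (symbolAt C (s.reg x))
  | .jumpLt x y l => if s.reg x < s.reg y then ⟨l, s.reg⟩ else ⟨s.pc + 1, s.reg⟩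

/-- An access to `C` takes time `t`, every other instruction takes unit time. -/
def Instr.cost (t : ℕ) : Instr → ℕ
  | .access _ _ => t
  | _ => 1

/-- `Exec w C D t P s s' c`: started in `s`, the program `P` stops (by leaving its list of
instructions) in `s'`, after running for total time `c`. -/
inductive Exec {m σ : ℕ} (w : ℕ) (C : Fin (m + 1) → Fin σ) (D : List Bool) (t : ℕ) (P : Program) :
    Config → Config → ℕ → Prop
  | halt (s : Config) : P[s.pc]? = none → Exec w C D t P s s 0
  | step (s s' : Config) (I : Instr) (c : ℕ) : P[s.pc]? = some I →
      Exec w C D t P (I.exec w C D s) s' c → Exec w C D t P s s' (I.cost t + c)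

/-- At the start of a query for `a` on `C[i..j]` the registers `0, …, 5` hold the query `a`, `i`, `j`
and the parameters `m`, `σ`, `w`; the other registers hold `0`. -/
def initConfig (w m σ a i j : ℕ) : Config :=
  ⟨0, fun r => [a, i, j, m, σ, w].getD r 0⟩

/-- The answer in a final configuration: null if register `0` holds `0`, and otherwise
the pair of words in the registers `1` and `2`. -/
def Config.output (s : Config) : Option (ℕ × ℕ) :=
  if s.reg 0 = 0 then none else some (s.reg 1, s.reg 2)

end WordRAM

namespace WordRAM

/-! ### Loop-free expressions and their compilation -/

/-! A query is answered by evaluating three expressions built from word operations, loads, accesses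
and case distinctions (`Comp`). Compiled, an expression of fixed size becomes code with forward
jumps only, so it costs O(1) instructions and hence time O(t). What remains is to express the answer
in this way and to bound the space. If m lies below a fixed power of two, no additional bits are
needed, because an unrolled scan suffices. Otherwise m + 1 < 2^w makes w large and all the estimates
in `Bounds` hold. Write λ = `lam σ`, of order log σ, and ψ = `psi σ`, of order log λ, with 2^ψ of
order √λ. The budget is O(ψ) bits per position.

Locating the occurrences. A block has b = 2^(4ψ) > 2λ² positions, so a small interval meets at most
two adjacent blocks. A modulus of O(ψ) bits separates the symbols of a block (`exists_perfect_mod`),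
which gives every position a key of O(ψ) bits: the remainder of its symbol, followed by its offset.
The keys of a block are stored in sorted order. The first occurrence of a from a given offset on is
then a successor and the last one before an offset is a predecessor (`sortedKey_succ`,
`sortedKey_pred`). Their ranks are found by a search with four levels and fan-out 2^ψ, in which the
keys of one level fit into a word and are compared simultaneously (`comp_digit`, `comp_rank`). If a
does not occur, its remainder may coincide with that of another symbol, so each candidate is checked
by an access.

Ranking an occurrence p. The count up to the start of the chunk of p, a chunk having 2^(2λ)
positions, is a sum of counters kept per symbol: absolute ones at large distances, relative ones at
medium distances, and one per chunk. The distances grow with the widths of the counters, so these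
take O(m) bits, and the chunk counters that are needed fit into a word, where they are added by
arithmetic (`pack_spread_sum`). The rank of p inside its chunk may need 2λ bits, which is too much
per position. Only its remainder modulo s = 2^(8ψ) is stored with p; the quotient, the bucket of p,
is looked up. Distinct buckets of a symbol in a chunk follow one another, and each one meets both
halves of the smallest dyadic interval around it (unless that is a single point), so they cannot
share this interval (`bucket_eq_of_key_eq`). Therefore the symbol and this interval, which p
recovers from a stored height, form a key for the bucket. A chunk has at most 2^(2λ)/s buckets other
than the first ones (`card_chunkKeys_mul_le`), and s ≥ 128λ³, so each of them can afford O(λ³) bits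
of dictionary. The dictionary uses 2λ + 1 moduli, each of which removes more than half of the keys
still in collision (`exists_moduli`); p stores which modulus applies to it.

Both kinds of moduli come from `centralBinom_pow_dvd_prod`: if every modulus up to 2N left h
elements in collision, a power of a central binomial coefficient would divide the product of all
differences, and that product is too small. -/

/-- A query together with the sequence and the data structure it is asked on. -/
structure Query where
  w : ℕ
  σ : ℕ
  m : ℕ
  C : Fin (m + 1) → Fin σ
  D : List Bool
  a : ℕ
  i : ℕ
  j : ℕ

/-- The input registers of a query. -/
def Query.input (x : Query) (r : ℕ) : ℕ := [x.a, x.i, x.j, x.m, x.σ, x.w].getD r 0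

/-- Expressions evaluated by the word RAM without loops. -/
inductive RExpr
  | inp (r : Fin 6)
  | const (c : ℕ)
  | op (o : BinOp) (e₁ e₂ : RExpr)
  | load (e : RExpr)
  | access (e : RExpr)
  | ite (e₁ e₂ e₃ e₄ : RExpr)

/-- The value of an expression; `ite e₁ e₂ e₃ e₄` is `if e₁ < e₂ then e₃ else e₄`. -/
def RExpr.eval (x : Query) : RExpr → ℕ
  | inp r => x.input r
  | const c => c % 2 ^ x.w
  | op o e₁ e₂ => o.eval x.w (e₁.eval x) (e₂.eval x)
  | load e => memWord x.w x.D (e.eval x)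
  | access e => symbolAt x.C (e.eval x)
  | ite e₁ e₂ e₃ e₄ => if e₁.eval x < e₂.eval x then e₃.eval x else e₄.eval x

/-- The number of instructions of the compiled expression. -/
def RExpr.size : RExpr → ℕ
  | inp _ => 1
  | const _ => 1
  | op _ e₁ e₂ => e₁.size + e₂.size + 1
  | load e => e.size + 1
  | access e => e.size + 1
  | ite e₁ e₂ e₃ e₄ => e₁.size + e₂.size + e₃.size + e₄.size + 4

/-- Code placed at position `pos` that computes the expression into register `d`, using the
registers from `d` on as work space. -/
def RExpr.code : RExpr → ℕ → ℕ → List Instr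
  | inp r, d, _ => [.op .or d r r]
  | const c, d, _ => [.const d c]
  | op o e₁ e₂, d, pos =>
      e₁.code d pos ++ e₂.code (d + 1) (pos + e₁.size) ++ [.op o d d (d + 1)]
  | load e, d, pos => e.code d pos ++ [.load d d]
  | access e, d, pos => e.code d pos ++ [.access d d]
  | ite e₁ e₂ e₃ e₄, d, pos =>
      e₁.code d pos ++ e₂.code (d + 1) (pos + e₁.size) ++
      [.jumpLt d (d + 1) (pos + e₁.size + e₂.size + 1 + e₄.size + 3)] ++
      e₄.code d (pos + e₁.size + e₂.size + 1) ++
      -- The comparison 0 < 1 serves as an unconditional jump over the code of `e₃`, which is placed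
      -- last. It needs 1 to be a word different from 0, hence `1 ≤ w` in `reach_code`.
      [.const (d + 1) 0, .const (d + 2) 1,
        .jumpLt (d + 1) (d + 2) (pos + e₁.size + e₂.size + 1 + e₄.size + 3 + e₃.size)] ++
      e₃.code d (pos + e₁.size + e₂.size + 1 + e₄.size + 3)

theorem RExpr.length_code (e : RExpr) : ∀ d pos, (e.code d pos).length = e.size := by
  induction e with
  | inp r => intros; rfl
  | const c => intros; rfl
  | op o e₁ e₂ h₁ h₂ => intros; simp [code, size, h₁, h₂]; omega
  | load e h => intros; simp [code, size, h]
  | access e h => intros; simp [code, size, h]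
  | ite e₁ e₂ e₃ e₄ h₁ h₂ h₃ h₄ => intros; simp [code, size, h₁, h₂, h₃, h₄]; omega

/-- `L` occurs in the program `P` from instruction number `pos` on. -/
def CodeAt (P : Program) (pos : ℕ) (L : List Instr) : Prop :=
  ∀ k I, L[k]? = some I → P[pos + k]? = some I

theorem CodeAt.left {P : Program} {pos : ℕ} {L M : List Instr} (h : CodeAt P pos (L ++ M)) :
    CodeAt P pos L := by
  intro k I hk
  apply h
  rw [List.getElem?_append_left]
  · exact hk
  · by_contra hc
    rw [List.getElem?_eq_none (by omega)] at hk
    cases hk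

theorem CodeAt.right {P : Program} {pos : ℕ} {L M : List Instr} (h : CodeAt P pos (L ++ M)) :
    CodeAt P (pos + L.length) M := by
  intro k I hk
  rw [add_assoc]
  apply h
  rw [List.getElem?_append_right (by omega)]
  simpa using hk

theorem CodeAt.head {P : Program} {pos : ℕ} {I : Instr} {M : List Instr}
    (h : CodeAt P pos (I :: M)) : P[pos]? = some I := h 0 I rfl

theorem CodeAt.tail {P : Program} {pos : ℕ} {I : Instr} {M : List Instr}
    (h : CodeAt P pos (I :: M)) : CodeAt P (pos + 1) M :=
  CodeAt.right (L := [I]) h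

/-- From `s` the program reaches `s'` within time `b * t`. -/
def Reach (x : Query) (t : ℕ) (P : Program) (s s' : Config) (b : ℕ) : Prop :=
  ∃ c ≤ b * t, ∀ s'' c', Exec x.w x.C x.D t P s' s'' c' → Exec x.w x.C x.D t P s s'' (c + c')

theorem Reach.trans {x : Query} {t : ℕ} {P : Program} {s s' s'' : Config} {b b' : ℕ}
    (h : Reach x t P s s' b) (h' : Reach x t P s' s'' b') : Reach x t P s s'' (b + b') := by
  obtain ⟨c, hc, h⟩ := h
  obtain ⟨c', hc', h'⟩ := h'
  refine ⟨c + c', by rw [add_mul]; omega, fun u d hd => ?_⟩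
  rw [add_assoc]
  exact h _ _ (h' _ _ hd)

theorem Reach.mono {x : Query} {t : ℕ} {P : Program} {s s' : Config} {b b' : ℕ}
    (h : Reach x t P s s' b) (hb : b ≤ b') : Reach x t P s s' b' := by
  obtain ⟨c, hc, h⟩ := h
  exact ⟨c, hc.trans (Nat.mul_le_mul_right _ hb), h⟩

theorem Reach.single {x : Query} {t : ℕ} (ht : 1 ≤ t) {P : Program} {s : Config} {I : Instr}
    (h : P[s.pc]? = some I) : Reach x t P s (I.exec x.w x.C x.D s) 1 := by
  refine ⟨I.cost t, ?_, fun s'' c' h' => Exec.step _ _ _ _ h h'⟩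
  cases I <;> simp [Instr.cost] <;> omega

theorem Reach.jump {x : Query} {t : ℕ} (ht : 1 ≤ t) {P : Program} {s : Config} {r r' l : ℕ}
    (h : P[s.pc]? = some (.jumpLt r r' l)) (hr : s.reg r < s.reg r') :
    Reach x t P s ⟨l, s.reg⟩ 1 := by
  have := Reach.single (x := x) ht h
  simpa only [Instr.exec, if_pos hr] using this

/-- Correctness of compiled expressions. -/
theorem RExpr.reach_code {x : Query} {t : ℕ} (ht : 1 ≤ t) (hw : 1 ≤ x.w) {P : Program}
    (e : RExpr) : ∀ (d pos : ℕ) (ρ : ℕ → ℕ), 6 ≤ d → CodeAt P pos (e.code d pos) →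
      (∀ r, r < 6 → ρ r = x.input r) →
      ∃ ρ' : ℕ → ℕ, ρ' d = e.eval x ∧ (∀ r, r < d → ρ' r = ρ r) ∧
        Reach x t P ⟨pos, ρ⟩ ⟨pos + e.size, ρ'⟩ e.size := by
  induction e with
  | inp r =>
    intro d pos ρ hd hP hρ
    refine ⟨Function.update ρ d (ρ r), ?_, ?_, ?_⟩
    · simp [eval, hρ r r.2]
    · intro r' hr'
      rw [Function.update_of_ne (by omega)]
    · have := Reach.single (x := x) ht (s := ⟨pos, ρ⟩) (CodeAt.head hP)
      simpa [Instr.exec, Config.write, BinOp.eval, size] using this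
  | const c =>
    intro d pos ρ hd hP hρ
    refine ⟨Function.update ρ d (c % 2 ^ x.w), ?_, ?_, ?_⟩
    · simp [eval]
    · intro r' hr'
      rw [Function.update_of_ne (by omega)]
    · have := Reach.single (x := x) ht (s := ⟨pos, ρ⟩) (CodeAt.head hP)
      simpa [Instr.exec, Config.write, BinOp.eval, size] using this
  | op o e₁ e₂ h₁ h₂ =>
    intro d pos ρ hd hP hρ
    have hP₁ := hP.left.left
    have hP₂ := hP.left.right
    have hP₃ := hP.right
    rw [length_code] at hP₂
    rw [List.length_append, length_code, length_code] at hP₃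
    obtain ⟨ρ₁, v₁, k₁, r₁⟩ := h₁ d pos ρ hd hP₁ hρ
    obtain ⟨ρ₂, v₂, k₂, r₂⟩ := h₂ (d + 1) (pos + e₁.size) ρ₁ (by omega) hP₂
      (fun r hr => by rw [k₁ r (by omega), hρ r hr])
    have r₃ := Reach.single (x := x) ht (s := ⟨pos + (e₁.size + e₂.size), ρ₂⟩) (CodeAt.head hP₃)
    rw [add_assoc] at r₂
    refine ⟨_, ?_, ?_, ((r₁.trans r₂).trans r₃).mono (by simp [size])⟩
    · simp [BinOp.eval, eval, v₂, k₂ d (by omega), v₁]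
    · intro r hr
      simp only
      rw [Function.update_of_ne (by omega), k₂ r (by omega), k₁ r hr]
  | load e h =>
    intro d pos ρ hd hP hρ
    have hP₁ := hP.left
    have hP₃ := hP.right
    rw [length_code] at hP₃
    obtain ⟨ρ₁, v₁, k₁, r₁⟩ := h d pos ρ hd hP₁ hρ
    have r₃ := Reach.single (x := x) ht (s := ⟨pos + e.size, ρ₁⟩) (CodeAt.head hP₃)
    refine ⟨_, ?_, ?_, (r₁.trans r₃).mono (by simp [size])⟩
    · simp [eval, v₁]
    · intro r hr
      simp only
      rw [Function.update_of_ne (by omega), k₁ r hr]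
  | access e h =>
    intro d pos ρ hd hP hρ
    have hP₁ := hP.left
    have hP₃ := hP.right
    rw [length_code] at hP₃
    obtain ⟨ρ₁, v₁, k₁, r₁⟩ := h d pos ρ hd hP₁ hρ
    have r₃ := Reach.single (x := x) ht (s := ⟨pos + e.size, ρ₁⟩) (CodeAt.head hP₃)
    refine ⟨_, ?_, ?_, (r₁.trans r₃).mono (by simp [size])⟩
    · simp [eval, v₁]
    · intro r hr
      simp only
      rw [Function.update_of_ne (by omega), k₁ r hr]
  | ite e₁ e₂ e₃ e₄ h₁ h₂ h₃ h₄ =>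
    intro d pos ρ hd hP hρ
    have hA := hP.left.left.left.left.left
    have hB := hP.left.left.left.left.right
    have hJ := hP.left.left.left.right
    have hE := hP.left.left.right
    have hK := hP.left.right
    have hT := hP.right
    simp only [List.length_append, length_code, List.length_cons, List.length_nil, zero_add,
      ← add_assoc] at hB hJ hE hK hT
    obtain ⟨ρ₁, v₁, k₁, r₁⟩ := h₁ d pos ρ hd hA hρ
    obtain ⟨ρ₂, v₂, k₂, r₂⟩ := h₂ (d + 1) (pos + e₁.size) ρ₁ (by omega) hB
      (fun r hr => by rw [k₁ r (by omega), hρ r hr])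
    have r₃ := Reach.single (x := x) ht (s := ⟨pos + e₁.size + e₂.size, ρ₂⟩) (CodeAt.head hJ)
    have hρ₂ : ∀ r, r < 6 → ρ₂ r = x.input r := fun r hr => by
      rw [k₂ r (by omega), k₁ r (by omega), hρ r hr]
    by_cases hc : e₁.eval x < e₂.eval x
    · have hc' : ρ₂ d < ρ₂ (d + 1) := by rwa [v₂, k₂ d (by omega), v₁]
      simp only [Instr.exec, hc', if_true] at r₃
      obtain ⟨ρ₃, v₃, k₃, r₄⟩ := h₃ d _ ρ₂ hd hT hρ₂
      refine ⟨ρ₃, by rw [v₃]; simp [eval, hc], fun r hr => by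
        rw [k₃ r hr, k₂ r (by omega), k₁ r hr], ?_⟩
      have := ((r₁.trans r₂).trans r₃).trans r₄
      have e : pos + (RExpr.ite e₁ e₂ e₃ e₄).size =
        pos + e₁.size + e₂.size + 1 + e₄.size + 3 + e₃.size := by simp [size]; omega
      rw [e]
      exact this.mono (by simp [size]; omega)
    · have hc' : ¬ ρ₂ d < ρ₂ (d + 1) := by rwa [v₂, k₂ d (by omega), v₁]
      simp only [Instr.exec, hc', if_false] at r₃
      obtain ⟨ρ₃, v₃, k₃, r₄⟩ := h₄ d _ ρ₂ hd hE hρ₂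
      have r₅ := Reach.single (x := x) ht
        (s := ⟨pos + e₁.size + e₂.size + 1 + e₄.size, ρ₃⟩) (CodeAt.head hK)
      have r₆ := Reach.single (x := x) ht
        (s := Instr.exec x.w x.C x.D ⟨pos + e₁.size + e₂.size + 1 + e₄.size, ρ₃⟩
          (.const (d + 1) 0)) (CodeAt.head hK.tail)
      have h1 : 1 < 2 ^ x.w := Nat.one_lt_two_pow (by omega)
      have r₇ := Reach.jump (x := x) ht
        (s := Instr.exec x.w x.C x.D (Instr.exec x.w x.C x.D
          ⟨pos + e₁.size + e₂.size + 1 + e₄.size, ρ₃⟩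
          (.const (d + 1) 0)) (.const (d + 2) 1)) (CodeAt.head hK.tail.tail)
        (by simp [Instr.exec, Config.write, Nat.mod_eq_of_lt h1])
      simp only [Instr.exec, Config.write] at r₅ r₆ r₇
      have e : pos + (RExpr.ite e₁ e₂ e₃ e₄).size =
        pos + e₁.size + e₂.size + 1 + e₄.size + 3 + e₃.size := by simp [size]; omega
      rw [e]
      refine ⟨_, ?_, ?_, ((((((r₁.trans r₂).trans r₃).trans r₄).trans r₅).trans r₆).trans
        r₇).mono (by simp [size]; omega)⟩
      · rw [Function.update_of_ne (by omega), Function.update_of_ne (by omega), v₃]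
        simp [eval, hc]
      · intro r hr
        rw [Function.update_of_ne (by omega), Function.update_of_ne (by omega),
          k₃ r hr, k₂ r (by omega), k₁ r hr]

/-- `f` is computed by an expression on all queries that satisfy `A`. -/
def Comp (A : Query → Prop) (f : Query → ℕ) : Prop :=
  ∃ e : RExpr, ∀ x, A x → e.eval x = f x

/-- Three computable functions give a query program that runs in time `O(t)`. -/
theorem Comp.exists_program {A : Query → Prop} {f₀ f₁ f₂ : Query → ℕ} (h₀ : Comp A f₀)
    (h₁ : Comp A f₁) (h₂ : Comp A f₂) :
    ∃ (P : Program) (K : ℕ), ∀ x, A x → 1 ≤ x.w → ∀ t, 1 ≤ t →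
      ∃ (s : Config) (c : ℕ),
        Exec x.w x.C x.D t P (initConfig x.w x.m x.σ x.a x.i x.j) s c ∧ c ≤ K * t ∧
        s.output = if f₀ x = 0 then none else some (f₁ x, f₂ x) := by
  obtain ⟨e₀, h₀⟩ := h₀
  obtain ⟨e₁, h₁⟩ := h₁
  obtain ⟨e₂, h₂⟩ := h₂
  let P : Program := e₀.code 6 0 ++ e₁.code 7 e₀.size ++ e₂.code 8 (e₀.size + e₁.size) ++
    [.op .or 0 6 6, .op .or 1 7 7, .op .or 2 8 8]
  have hP : CodeAt P 0 P := fun k I h => by simpa using h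
  refine ⟨P, e₀.size + e₁.size + e₂.size + 3, fun x hA hw t ht => ?_⟩
  have hP₀ := hP.left.left.left
  have hP₁ := hP.left.left.right
  have hP₂ := hP.left.right
  have hP₃ := hP.right
  simp only [List.length_append, RExpr.length_code, zero_add] at hP₁ hP₂ hP₃
  obtain ⟨ρ₀, v₀, k₀, r₀⟩ := e₀.reach_code (x := x) ht hw 6 0
    (fun r => [x.a, x.i, x.j, x.m, x.σ, x.w].getD r 0) le_rfl hP₀ (fun r _ => rfl)
  obtain ⟨ρ₁, v₁, k₁, r₁⟩ := e₁.reach_code (x := x) ht hw 7 e₀.size ρ₀ (by omega) hP₁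
    (fun r hr => by rw [k₀ r hr]; rfl)
  obtain ⟨ρ₂, v₂, k₂, r₂⟩ := e₂.reach_code (x := x) ht hw 8 _ ρ₁ (by omega) hP₂
    (fun r hr => by rw [k₁ r (by omega), k₀ r hr]; rfl)
  have r₃ := Reach.single (x := x) ht (s := ⟨_, ρ₂⟩) (CodeAt.head hP₃)
  have r₄ := Reach.single (x := x) ht (s := Instr.exec x.w x.C x.D
    ⟨e₀.size + e₁.size + e₂.size, ρ₂⟩ (.op .or 0 6 6)) (CodeAt.head hP₃.tail)
  have r₅ := Reach.single (x := x) ht (s := Instr.exec x.w x.C x.D (Instr.exec x.w x.C x.D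
    ⟨e₀.size + e₁.size + e₂.size, ρ₂⟩ (.op .or 0 6 6)) (.op .or 1 7 7))
    (CodeAt.head hP₃.tail.tail)
  rw [zero_add] at r₀
  obtain ⟨c, hc, hE⟩ := ((((r₀.trans r₁).trans r₂).trans r₃).trans r₄).trans r₅
  refine ⟨_, c + 0, hE _ _ (Exec.halt _ ?_), by simpa [add_assoc] using hc, ?_⟩
  · apply List.getElem?_eq_none
    simp [P, RExpr.length_code, Instr.exec, Config.write]
    omega
  · have e0 : ρ₂ 6 = f₀ x := by rw [k₂ 6 (by omega), k₁ 6 (by omega), v₀, h₀ x hA]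
    have e1 : ρ₂ 7 = f₁ x := by rw [k₂ 7 (by omega), v₁, h₁ x hA]
    have e2 : ρ₂ 8 = f₂ x := by rw [v₂, h₂ x hA]
    simp [Config.output, Instr.exec, Config.write, BinOp.eval, Function.update, e0, e1, e2]

/-! ### Closure properties of computable functions -/

section closure

variable {A : Query → Prop} {f g u v : Query → ℕ}

theorem Comp.congr (h : Comp A f) (e : ∀ x, A x → f x = g x) : Comp A g := by
  obtain ⟨r, hr⟩ := h
  exact ⟨r, fun x hx => by rw [hr x hx, e x hx]⟩

theorem Comp.mono {B : Query → Prop} (h : Comp B f) (e : ∀ x, A x → B x) : Comp A f := by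
  obtain ⟨r, hr⟩ := h
  exact ⟨r, fun x hx => hr x (e x hx)⟩

theorem Comp.input_a (A : Query → Prop) : Comp A (fun x => x.a) := ⟨.inp 0, fun _ _ => rfl⟩
theorem Comp.input_i (A : Query → Prop) : Comp A (fun x => x.i) := ⟨.inp 1, fun _ _ => rfl⟩
theorem Comp.input_j (A : Query → Prop) : Comp A (fun x => x.j) := ⟨.inp 2, fun _ _ => rfl⟩
theorem Comp.input_m (A : Query → Prop) : Comp A (fun x => x.m) := ⟨.inp 3, fun _ _ => rfl⟩
theorem Comp.input_w (A : Query → Prop) : Comp A (fun x => x.w) := ⟨.inp 5, fun _ _ => rfl⟩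

theorem Comp.const (c : ℕ) (h : ∀ x, A x → c < 2 ^ x.w) : Comp A (fun _ => c) :=
  ⟨.const c, fun x hx => Nat.mod_eq_of_lt (h x hx)⟩

theorem Comp.op (o : BinOp) (hf : Comp A f) (hg : Comp A g) :
    Comp A (fun x => o.eval x.w (f x) (g x)) := by
  obtain ⟨e, he⟩ := hf
  obtain ⟨e', he'⟩ := hg
  exact ⟨.op o e e', fun x hx => by simp only [RExpr.eval, he x hx, he' x hx]⟩

theorem Comp.load (hf : Comp A f) : Comp A (fun x => memWord x.w x.D (f x)) := by
  obtain ⟨e, he⟩ := hf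
  exact ⟨.load e, fun x hx => by simp only [RExpr.eval, he x hx]⟩

theorem Comp.access (hf : Comp A f) : Comp A (fun x => symbolAt x.C (f x)) := by
  obtain ⟨e, he⟩ := hf
  exact ⟨.access e, fun x hx => by simp only [RExpr.eval, he x hx]⟩

theorem Comp.add (hf : Comp A f) (hg : Comp A g) (h : ∀ x, A x → f x + g x < 2 ^ x.w) :
    Comp A (fun x => f x + g x) :=
  (hf.op .add hg).congr fun x hx => Nat.mod_eq_of_lt (h x hx)

theorem Comp.mul (hf : Comp A f) (hg : Comp A g) (h : ∀ x, A x → f x * g x < 2 ^ x.w) :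
    Comp A (fun x => f x * g x) :=
  (hf.op .mul hg).congr fun x hx => Nat.mod_eq_of_lt (h x hx)

theorem Comp.sub (hf : Comp A f) (hg : Comp A g) (h : ∀ x, A x → f x < 2 ^ x.w)
    (h' : ∀ x, A x → g x ≤ f x) : Comp A (fun x => f x - g x) := by
  refine (hf.op .sub hg).congr fun x hx => ?_
  have h₁ := h x hx
  have h₂ := h' x hx
  simp only [BinOp.eval]
  rw [show f x + (2 ^ x.w - g x) = (f x - g x) + 2 ^ x.w by omega, Nat.add_mod_right,
    Nat.mod_eq_of_lt (by omega)]

theorem Comp.div (hf : Comp A f) (hg : Comp A g) : Comp A (fun x => f x / g x) :=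
  hf.op .div hg

theorem Comp.land (hf : Comp A f) (hg : Comp A g) : Comp A (fun x => f x &&& g x) :=
  hf.op .and hg

theorem Comp.lor (hf : Comp A f) (hg : Comp A g) : Comp A (fun x => f x ||| g x) :=
  hf.op .or hg

theorem Comp.xor (hf : Comp A f) (hg : Comp A g) : Comp A (fun x => f x ^^^ g x) :=
  hf.op .xor hg

theorem Comp.shl (hf : Comp A f) (hg : Comp A g) :
    Comp A (fun x => (f x <<< g x) % 2 ^ x.w) :=
  hf.op .shl hg

theorem Comp.shr (hf : Comp A f) (hg : Comp A g) : Comp A (fun x => f x >>> g x) :=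
  hf.op .shr hg

theorem Comp.mod (hf : Comp A f) (hg : Comp A g) (h : ∀ x, A x → f x < 2 ^ x.w) :
    Comp A (fun x => f x % g x) := by
  refine (hf.sub ((hf.div hg).mul hg fun x hx => ?_) h fun x hx => ?_).congr fun x hx => ?_
  · exact (Nat.div_mul_le_self _ _).trans_lt (h x hx)
  · exact Nat.div_mul_le_self _ _
  · have := Nat.div_add_mod' (f x) (g x)
    omega

theorem Comp.div_two_pow (hf : Comp A f) (hg : Comp A g) : Comp A (fun x => f x / 2 ^ g x) :=
  (hf.shr hg).congr fun _ _ => Nat.shiftRight_eq_div_pow _ _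

theorem Comp.mul_two_pow (hf : Comp A f) (hg : Comp A g)
    (h : ∀ x, A x → f x * 2 ^ g x < 2 ^ x.w) : Comp A (fun x => f x * 2 ^ g x) :=
  (hf.shl hg).congr fun x hx => by rw [Nat.shiftLeft_eq, Nat.mod_eq_of_lt (h x hx)]

theorem Comp.two_pow (hg : Comp A g) (h : ∀ x, A x → g x < x.w) : Comp A (fun x => 2 ^ g x) := by
  have h1 : Comp A (fun _ => 1) := Comp.const 1 fun x hx => Nat.one_lt_two_pow (by
    have := h x hx; omega)
  refine (h1.mul_two_pow hg fun x hx => ?_).congr fun x _ => one_mul _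
  rw [one_mul]
  exact Nat.pow_lt_pow_right (by omega) (h x hx)

theorem Comp.mod_two_pow (hf : Comp A f) (hg : Comp A g) (h : ∀ x, A x → f x < 2 ^ x.w)
    (h' : ∀ x, A x → g x < x.w) : Comp A (fun x => f x % 2 ^ g x) :=
  hf.mod (hg.two_pow h') h

/-- Each branch has to be correct only under its own guard. This is how range and overflow
conditions that hold in one case alone are discharged. -/
theorem Comp.ite_lt (hf : Comp A f) (hg : Comp A g) (hu : Comp (fun x => A x ∧ f x < g x) u)
    (hv : Comp (fun x => A x ∧ ¬ f x < g x) v) :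
    Comp A (fun x => if f x < g x then u x else v x) := by
  obtain ⟨e₁, h₁⟩ := hf
  obtain ⟨e₂, h₂⟩ := hg
  obtain ⟨e₃, h₃⟩ := hu
  obtain ⟨e₄, h₄⟩ := hv
  refine ⟨.ite e₁ e₂ e₃ e₄, fun x hx => ?_⟩
  simp only [RExpr.eval, h₁ x hx, h₂ x hx]
  split_ifs with h
  · exact h₃ x ⟨hx, h⟩
  · exact h₄ x ⟨hx, h⟩

theorem Comp.ite_le (hf : Comp A f) (hg : Comp A g) (hu : Comp (fun x => A x ∧ f x ≤ g x) u)
    (hv : Comp (fun x => A x ∧ ¬ f x ≤ g x) v) :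
    Comp A (fun x => if f x ≤ g x then u x else v x) := by
  refine (Comp.ite_lt hg hf (hv.mono fun x hx => ⟨hx.1, by omega⟩)
    (hu.mono fun x hx => ⟨hx.1, by omega⟩)).congr fun x _ => ?_
  split_ifs <;> first | rfl | omega

theorem Comp.ite_eq (hf : Comp A f) (hg : Comp A g) (hu : Comp (fun x => A x ∧ f x = g x) u)
    (hv : Comp (fun x => A x ∧ ¬ f x = g x) v) :
    Comp A (fun x => if f x = g x then u x else v x) := by
  refine (Comp.ite_lt hf hg (hv.mono fun x hx => ⟨hx.1, by omega⟩)
    (Comp.ite_lt (hg.mono fun x hx => hx.1) (hf.mono fun x hx => hx.1)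
      (hv.mono fun x hx => ⟨hx.1.1, by omega⟩)
      (hu.mono fun x hx => ⟨hx.1.1, by omega⟩))).congr fun x _ => ?_
  split_ifs <;> first | rfl | omega

theorem Comp.min (hf : Comp A f) (hg : Comp A g) : Comp A (fun x => min (f x) (g x)) := by
  refine (hf.ite_lt hg (hf.mono fun x hx => hx.1) (hg.mono fun x hx => hx.1)).congr fun x _ => ?_
  split_ifs <;> omega

end closure

/-! ### Numbers with digits in a power of two -/

/-- The number with the `v` digits `d 0, …, d (v - 1)` of `B` bits each. -/
def pack (B v : ℕ) (d : ℕ → ℕ) : ℕ := ∑ i ∈ Finset.range v, d i * 2 ^ (B * i)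

theorem pack_succ (B v : ℕ) (d : ℕ → ℕ) :
    pack B (v + 1) d = pack B v d + d v * 2 ^ (B * v) := Finset.sum_range_succ _ _

theorem pack_lt {B v : ℕ} {d : ℕ → ℕ} (h : ∀ i < v, d i < 2 ^ B) : pack B v d < 2 ^ (B * v) := by
  induction v with
  | zero => simp [pack]
  | succ v ih =>
    rw [pack_succ]
    have h1 := ih fun i hi => h i (by omega)
    have h2 := h v (by omega)
    have : (d v + 1) * 2 ^ (B * v) ≤ 2 ^ B * 2 ^ (B * v) := Nat.mul_le_mul_right _ h2
    rw [Nat.mul_succ, pow_add]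
    nlinarith

theorem testBit_pack {B v : ℕ} {d : ℕ → ℕ} (h : ∀ i < v, d i < 2 ^ B) (e : ℕ) :
    (pack B v d).testBit e = (decide (e < B * v) && (d (e / B)).testBit (e % B)) := by
  induction v with
  | zero => simp [pack]
  | succ v ih =>
    have hlt := pack_lt (fun i (hi : i < v) => h i (by omega))
    rw [pack_succ, add_comm, mul_comm (d v), Nat.testBit_two_pow_mul_add _ hlt,
      ih fun i hi => h i (by omega)]
    rcases Nat.eq_zero_or_pos B with rfl | hB
    · have := h v (by omega)
      have h0 : d v = 0 := by simpa using this
      simp [h0]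
    split_ifs with hc
    · simp [hc, show e < B * (v + 1) by rw [Nat.mul_succ]; omega]
    · push Not at hc
      by_cases he : e < B * (v + 1)
      · have hq : e / B = v := by
          rw [Nat.div_eq_iff hB]
          rw [Nat.mul_succ] at he
          have : v * B = B * v := mul_comm _ _
          omega
        have hr : e % B = e - B * v := by
          have := Nat.div_add_mod e B
          rw [hq] at this
          omega
        simp [he, hq, hr]
      · simp only [he, decide_false, Bool.false_and]
        apply Nat.testBit_lt_two_pow
        refine (h v (by omega)).trans_le (Nat.pow_le_pow_right (by omega) ?_)
        rw [Nat.mul_succ] at he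
        omega

theorem pack_land {B v : ℕ} {d d' : ℕ → ℕ} (h : ∀ i < v, d i < 2 ^ B)
    (h' : ∀ i < v, d' i < 2 ^ B) :
    pack B v d &&& pack B v d' = pack B v (fun i => d i &&& d' i) := by
  apply Nat.eq_of_testBit_eq
  intro e
  rw [Nat.testBit_and, testBit_pack h, testBit_pack h',
    testBit_pack fun i hi => Nat.and_lt_two_pow _ (h' i hi), Nat.testBit_and]
  cases decide (e < B * v) <;> simp

/-- Modulo 2^B - 1 every weight 2^(B i) is 1, so a single remainder adds all the digits; the bound
keeps the sum from being reduced. -/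
theorem pack_mod (B v : ℕ) (d : ℕ → ℕ) (hB : ∑ i ∈ Finset.range v, d i < 2 ^ B - 1) :
    pack B v d % (2 ^ B - 1) = ∑ i ∈ Finset.range v, d i := by
  rw [← Nat.mod_eq_of_lt hB]
  refine Nat.ModEq.sum fun i _ => ?_
  have h1 : 2 ^ (B * i) ≡ 1 [MOD 2 ^ B - 1] := by
    rw [pow_mul]
    have : 2 ^ B ≡ 1 [MOD 2 ^ B - 1] := by
      have h2 : 2 ^ B = 1 + (2 ^ B - 1) := by have := Nat.one_le_two_pow (n := B); omega
      conv_lhs => rw [h2]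
      simp [Nat.ModEq]
    simpa using this.pow i
  simpa using (Nat.ModEq.refl (d i)).mul h1

/-- A geometric series. The number of digits varies with the query, so masks and replicators are
produced by this quotient and not as program constants. -/
theorem pack_one (B v : ℕ) (hB : 0 < B) :
    pack B v (fun _ => 1) = (2 ^ (B * v) - 1) / (2 ^ B - 1) := by
  have h2 : 1 < 2 ^ B := Nat.one_lt_two_pow (by omega)
  rw [pow_mul, ← Nat.geomSum_eq (by omega), pack]
  exact Finset.sum_congr rfl fun i _ => by rw [one_mul, pow_mul]

theorem pack_mul_const (B v c : ℕ) (d : ℕ → ℕ) : pack B v d * c = pack B v (fun i => d i * c) := by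
  simp only [pack, Finset.sum_mul]
  exact Finset.sum_congr rfl fun i _ => by ring

theorem pack_add (B v : ℕ) (d d' : ℕ → ℕ) :
    pack B v d + pack B v d' = pack B v (fun i => d i + d' i) := by
  simp only [pack, ← Finset.sum_add_distrib]
  exact Finset.sum_congr rfl fun i _ => by ring

theorem pack_congr {B v : ℕ} {d d' : ℕ → ℕ} (h : ∀ i < v, d i = d' i) :
    pack B v d = pack B v d' :=
  Finset.sum_congr rfl fun i hi => by rw [h i (Finset.mem_range.1 hi)]

/-- Parallel comparison: the number of digits that are at least `y`. -/
theorem pack_count_ge {B v y : ℕ} {d : ℕ → ℕ} (hd : ∀ i < v, d i < 2 ^ B) (hy : y < 2 ^ B)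
    (hv : v < 2 ^ (B + 1) - 1) :
    ((pack (B + 1) v d + pack (B + 1) v (fun _ => 1) * 2 ^ B - pack (B + 1) v (fun _ => 1) * y &&&
      pack (B + 1) v (fun _ => 1) * 2 ^ B) / 2 ^ B) % (2 ^ (B + 1) - 1) =
      ((Finset.range v).filter (fun i => y ≤ d i)).card := by
  have e1 : pack (B + 1) v d + pack (B + 1) v (fun _ => 1) * 2 ^ B -
      pack (B + 1) v (fun _ => 1) * y = pack (B + 1) v (fun i => 2 ^ B + d i - y) := by
    rw [pack_mul_const, pack_mul_const, pack_add, Nat.sub_eq_iff_eq_add, pack_add]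
    · exact pack_congr fun i hi => by omega
    · exact Finset.sum_le_sum fun i _ => Nat.mul_le_mul_right _ (by dsimp only; omega)
  have hpow : 2 ^ (B + 1) = 2 * 2 ^ B := by rw [pow_succ]; ring
  rw [e1, pack_mul_const, pack_land (fun i hi => by have := hd i hi; omega) (fun i hi => by omega)]
  -- The spare top bit of each field prevents borrows between fields, and after the subtraction it
  -- survives exactly where `y ≤ d i`.
  have e2 : pack (B + 1) v (fun i => (2 ^ B + d i - y) &&& (1 * 2 ^ B)) =
      pack (B + 1) v (fun i => if y ≤ d i then 1 else 0) * 2 ^ B := by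
    rw [pack_mul_const]
    refine pack_congr fun i hi => ?_
    rw [one_mul, Nat.and_two_pow]
    have := hd i hi
    split_ifs with h
    · rw [Nat.testBit_eq_decide_div_mod_eq,
        show (2 ^ B + d i - y) / 2 ^ B = 1 by rw [Nat.div_eq_iff (by positivity)]; omega]
      simp
    · rw [Nat.testBit_lt_two_pow (by omega)]
      simp
  rw [e2, Nat.mul_div_cancel _ (by positivity), pack_mod, Finset.card_filter]
  rw [← Finset.card_filter]
  exact (Finset.card_filter_le _ _).trans_lt (by simpa using hv)

/-- The sum of the digits of `x`, computed by replicating `x` and selecting one digit of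
each copy. -/
theorem pack_spread_sum {B v : ℕ} {d : ℕ → ℕ} (hd : ∀ i < v, d i < 2 ^ B) (hB : 0 < B)
    (hs : ∑ i ∈ Finset.range v, d i < 2 ^ (B * v + B) - 1) :
    ((pack B v d * pack (B * v) v (fun _ => 1)) &&&
      (pack (B * v + B) v (fun _ => 1) * (2 ^ B - 1))) % (2 ^ (B * v + B) - 1) =
      ∑ i ∈ Finset.range v, d i := by
  have hlt := pack_lt hd
  have hle : ∀ i < v, d i < 2 ^ (B * v + B) := fun i hi =>
    (hd i hi).trans_le (Nat.pow_le_pow_right (by omega) (by omega))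
  have hm : ∀ i < v, 1 * (2 ^ B - 1) < 2 ^ (B * v + B) := fun i hi => by
    have : 2 ^ B ≤ 2 ^ (B * v + B) := Nat.pow_le_pow_right (by omega) (by omega)
    have := Nat.one_le_two_pow (n := B)
    omega
  -- Copy number q starts at bit B v q, and its digit number q lies B q bits further, at (B v + B)
  -- q. The mask keeps just these digits, now in fields wide enough for `pack_mod` to add them.
  have e1 : (pack B v d * pack (B * v) v (fun _ => 1)) &&&
      (pack (B * v + B) v (fun _ => 1) * (2 ^ B - 1)) = pack (B * v + B) v d := by
    apply Nat.eq_of_testBit_eq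
    intro e
    rw [Nat.testBit_and, mul_comm (pack B v d), pack_mul_const, pack_mul_const,
      testBit_pack (by simpa using fun i hi => hlt), testBit_pack hm, testBit_pack hle]
    simp only [one_mul, Nat.testBit_two_pow_sub_one]
    rw [testBit_pack hd]
    by_cases h1 : e < (B * v + B) * v
    swap
    · simp [h1]
    have hv : 0 < v := by rcases Nat.eq_zero_or_pos v with rfl | h <;> simp_all
    set q := e / (B * v + B) with hq
    set r := e % (B * v + B) with hr
    have he : (B * v + B) * q + r = e := Nat.div_add_mod _ _
    have hqv : q < v := by rw [hq]; exact Nat.div_lt_of_lt_mul h1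
    by_cases h2 : r < B
    · have hBq : B * q + B ≤ B * v := by
        have := Nat.mul_le_mul_left B hqv
        rwa [Nat.mul_succ] at this
      have he' : e = B * v * q + (B * q + r) := by rw [← he]; ring
      have h3 : e % (B * v) = B * q + r := by
        rw [he', Nat.mul_add_mod, Nat.mod_eq_of_lt (by omega)]
      have h4 : (B * q + r) / B = q := by
        rw [Nat.mul_add_div hB, Nat.div_eq_of_lt h2, add_zero]
      have h5 : (B * q + r) % B = r := by rw [Nat.mul_add_mod, Nat.mod_eq_of_lt h2]
      have h6 : e < B * v * v := by
        have : B * v * q + B * v ≤ B * v * v := by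
          have := Nat.mul_le_mul_left (B * v) hqv
          rwa [Nat.mul_succ] at this
        omega
      simp [h1, h2, h3, h4, h5, h6, show B * q + r < B * v by omega]
    · have : (d q).testBit r = false :=
        Nat.testBit_lt_two_pow ((hd q hqv).trans_le (Nat.pow_le_pow_right (by omega) (by omega)))
      simp [h2, this]
  rw [e1, pack_mod _ _ _ hs]

/-- A number whose binary expansion ends in exactly `k` ones. -/
theorem xor_succ_of_low_ones (k y : ℕ) :
    (2 ^ (k + 1) * y + (2 ^ k - 1)) ^^^ (2 ^ (k + 1) * y + (2 ^ k - 1) + 1) = 2 ^ (k + 1) - 1 := by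
  have h1 := Nat.one_le_two_pow (n := k)
  have h2 : 2 ^ (k + 1) = 2 * 2 ^ k := by rw [pow_succ]; ring
  rw [show 2 ^ (k + 1) * y + (2 ^ k - 1) + 1 = 2 ^ (k + 1) * y + 2 ^ k by omega]
  apply Nat.eq_of_testBit_eq
  intro e
  rw [Nat.testBit_xor, Nat.testBit_two_pow_mul_add _ (by omega),
    Nat.testBit_two_pow_mul_add _ (by omega), Nat.testBit_two_pow_sub_one,
    Nat.testBit_two_pow_sub_one, Nat.testBit_two_pow]
  by_cases h : e < k + 1
  · by_cases h' : e < k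
    · simp [h, h', show k ≠ e by omega]
    · simp [show k = e by omega]
  · simp [h]

/-! ### Hashing by remainders -/

/-- The elements of `S` that share their remainder modulo `q` with another element of `S`. -/
def collisions (S : Finset ℕ) (q : ℕ) : Finset ℕ :=
  S.filter (fun x => ∃ y ∈ S, y ≠ x ∧ x % q = y % q)

theorem two_pow_le_centralBinom (N : ℕ) : 2 ^ N ≤ N.centralBinom := by
  by_cases h : 4 ≤ N
  · have h1 := Nat.four_pow_lt_mul_centralBinom N h
    have h2 : N < 2 ^ N := Nat.lt_two_pow_self
    have h3 : 4 ^ N = 2 ^ N * 2 ^ N := by rw [← mul_pow]; norm_num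
    by_contra hc
    push Not at hc
    have : N * N.centralBinom ≤ 2 ^ N * 2 ^ N := Nat.mul_le_mul h2.le hc.le
    omega
  · interval_cases N <;> decide

/-- Compare exponents prime by prime. For each power p^e with e at most the exponent of p in the
central binomial coefficient, at least h elements collide modulo p^e. They are first components of
ordered pairs whose difference is divisible by p^e, so each such e contributes at least h to the
exponent of p in the product. -/
theorem centralBinom_pow_dvd_prod {S : Finset ℕ} {N h : ℕ}
    (hc : ∀ q, 1 ≤ q → q ≤ 2 * N → h ≤ (collisions S q).card) :
    N.centralBinom ^ h ∣ ∏ z ∈ S.offDiag, (z.1 - z.2 + (z.2 - z.1)) := by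
  have hne : ∀ z ∈ S.offDiag, (z.1 - z.2 + (z.2 - z.1)) ≠ 0 := by
    intro z hz
    have := (Finset.mem_offDiag.1 hz).2.2
    omega
  rw [← Nat.factorization_le_iff_dvd (pow_ne_zero _ N.centralBinom_ne_zero)
    (Finset.prod_ne_zero_iff.2 hne)]
  intro p
  rw [Nat.factorization_pow, Nat.factorization_prod hne]
  simp only [Finsupp.smul_apply, smul_eq_mul, Finsupp.finsetSum_apply]
  by_cases hp : p.Prime
  swap
  · rw [Nat.factorization_eq_zero_of_not_prime _ hp]
    simp
  set E := N.centralBinom.factorization p with hE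
  -- A prime power dividing the coefficient is at most 2N, so it is one of the moduli to which `hc`
  -- applies.
  have hpE : ∀ e ∈ Finset.Icc 1 E, p ^ e ≤ 2 * N := by
    intro e he
    have he := Finset.mem_Icc.1 he
    have hN : 2 * N ≠ 0 := by
      rintro h0
      have : N = 0 := by omega
      subst this
      simp at hE
      omega
    have : E ≤ Nat.log p (2 * N) := Nat.factorization_choose_le_log
    exact (Nat.pow_le_pow_right hp.pos (he.2.trans this)).trans (Nat.pow_log_le_self _ hN)
  calc h * E = ∑ e ∈ Finset.Icc 1 E, h := by simp [mul_comm]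
    _ ≤ ∑ e ∈ Finset.Icc 1 E,
          (S.offDiag.filter (fun z => p ^ e ∣ (z.1 - z.2 + (z.2 - z.1)))).card := by
        refine Finset.sum_le_sum fun e he => ?_
        refine (hc (p ^ e) (Nat.one_le_pow _ _ hp.pos) (hpE e he)).trans ?_
        refine Finset.card_le_card_of_surjOn Prod.fst ?_
        intro x hx
        simp only [collisions, Finset.coe_filter, Set.mem_ofPred_eq] at hx
        obtain ⟨hx, y, hy, hxy, hm⟩ := hx
        refine ⟨(x, y), ?_, rfl⟩
        simp only [Finset.coe_filter, Finset.mem_offDiag, Set.mem_ofPred_eq]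
        refine ⟨⟨hx, hy, hxy.symm⟩, ?_⟩
        rcases le_total x y with hle | hle
        · rw [Nat.sub_eq_zero_of_le hle, zero_add]
          exact (Nat.modEq_iff_dvd' hle).1 hm
        · rw [Nat.sub_eq_zero_of_le hle, add_zero]
          exact (Nat.modEq_iff_dvd' hle).1 hm.symm
    _ = ∑ z ∈ S.offDiag,
          ((Finset.Icc 1 E).filter (fun e => p ^ e ∣ (z.1 - z.2 + (z.2 - z.1)))).card := by
        simp only [Finset.card_filter]
        exact Finset.sum_comm
    _ ≤ ∑ z ∈ S.offDiag, (z.1 - z.2 + (z.2 - z.1)).factorization p := by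
        refine Finset.sum_le_sum fun z hz => ?_
        refine (Finset.card_le_card (t := Finset.Icc 1
          ((z.1 - z.2 + (z.2 - z.1)).factorization p)) ?_).trans (by simp)
        intro e he
        rw [Finset.mem_filter, Finset.mem_Icc] at he
        rw [Finset.mem_Icc]
        exact ⟨he.1.1, (hp.pow_dvd_iff_le_factorization (hne z hz)).1 he.2⟩

/-- Otherwise the divisibility above gives 2^(N h) at most the product of the differences. There are
at most |S|² of them, each below 2^u, against the hypothesis `hN`. -/
theorem exists_mod_few_collisions {S : Finset ℕ} {u N h : ℕ} (hS : ∀ x ∈ S, x < 2 ^ u)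
    (hN : u * (S.card * S.card) < N * h) :
    ∃ q, 1 ≤ q ∧ q ≤ 2 * N ∧ (collisions S q).card < h := by
  by_contra hcon
  push Not at hcon
  have hdvd := centralBinom_pow_dvd_prod hcon
  have hpos : 0 < ∏ z ∈ S.offDiag, (z.1 - z.2 + (z.2 - z.1)) := by
    refine Finset.prod_pos fun z hz => ?_
    have := (Finset.mem_offDiag.1 hz).2.2
    omega
  have h1 := Nat.le_of_dvd hpos hdvd
  have h2 : ∏ z ∈ S.offDiag, (z.1 - z.2 + (z.2 - z.1)) ≤ (2 ^ u) ^ S.offDiag.card := by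
    refine Finset.prod_le_pow_card _ _ _ fun z hz => ?_
    have hz := Finset.mem_offDiag.1 hz
    have := hS _ hz.1
    have := hS _ hz.2.1
    omega
  have h3 : (2 ^ u) ^ S.offDiag.card ≤ 2 ^ (u * (S.card * S.card)) := by
    rw [← pow_mul, Finset.offDiag_card]
    exact Nat.pow_le_pow_right (by omega) (Nat.mul_le_mul_left _ (Nat.sub_le _ _))
  have h4 : 2 ^ (N * h) ≤ N.centralBinom ^ h := by
    rw [pow_mul]
    exact Nat.pow_le_pow_left (two_pow_le_centralBinom N) _
  have h5 : 2 ^ (u * (S.card * S.card)) < 2 ^ (N * h) := Nat.pow_lt_pow_right (by omega) hN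
  omega

/-- A small modulus that separates the elements of a small set. -/
theorem exists_perfect_mod {S : Finset ℕ} {u N : ℕ} (hS : ∀ x ∈ S, x < 2 ^ u)
    (hN : u * (S.card * S.card) < N) :
    ∃ q, 1 ≤ q ∧ q ≤ 2 * N ∧ ∀ x ∈ S, ∀ y ∈ S, x % q = y % q → x = y := by
  obtain ⟨q, h1, h2, h3⟩ := exists_mod_few_collisions hS (h := 1) (by simpa using hN)
  refine ⟨q, h1, h2, fun x hx y hy hxy => ?_⟩
  by_contra hne
  rw [Nat.lt_one_iff, Finset.card_eq_zero, collisions, Finset.filter_eq_empty_iff] at h3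
  exact h3 hx ⟨y, hy, Ne.symm hne, hxy⟩

/-- `J` moduli such that each element of `S` has one (given by `f`) under which it does not collide
with the other elements that use the same modulus. -/
theorem exists_moduli {u n : ℕ} (J : ℕ) : ∀ S : Finset ℕ, (∀ x ∈ S, x < 2 ^ u) → S.card ≤ n →
    S.card < 2 ^ J →
    ∃ q f : ℕ → ℕ, (∀ j, 1 ≤ q j ∧ q j ≤ 4 * u * n + 2) ∧ (∀ x ∈ S, f x < J) ∧
      ∀ x ∈ S, ∀ y ∈ S, f x = f y → x % q (f x) = y % q (f x) → x = y := by
  induction J with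
  | zero =>
    intro S _ _ h
    have : S = ∅ := by simpa using h
    subst this
    exact ⟨fun _ => 1, fun _ => 0, fun _ => ⟨le_rfl, by dsimp only; omega⟩, by simp, by simp⟩
  | succ J ih =>
    intro S hu hn hJ
    rcases Nat.eq_zero_or_pos S.card with h0 | hpos
    · have : S = ∅ := by simpa using h0
      subst this
      exact ⟨fun _ => 1, fun _ => 0, fun _ => ⟨le_rfl, by dsimp only; omega⟩, by simp, by simp⟩
    -- With this h fewer than half of the elements collide, so the remaining set satisfies the bound
    -- for J. The choice of N works because |S| ≤ n and |S| ≤ 2h, and 2N is the bound on the moduli.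
    obtain ⟨q, h1, h2, h3⟩ := exists_mod_few_collisions hu (N := 2 * u * n + 1)
      (h := (S.card + 1) / 2) (by
        have e : S.card ≤ 2 * ((S.card + 1) / 2) := by omega
        have e2 : u * (S.card * S.card) ≤ u * (n * (2 * ((S.card + 1) / 2))) :=
          Nat.mul_le_mul_left _ (Nat.mul_le_mul hn e)
        have e3 : (2 * u * n + 1) * ((S.card + 1) / 2) =
          u * (n * (2 * ((S.card + 1) / 2))) + (S.card + 1) / 2 := by ring
        omega)
    have hsub : collisions S q ⊆ S := Finset.filter_subset _ _
    obtain ⟨q', f, g1, g2, g3⟩ := ih (collisions S q) (fun x hx => hu x (hsub hx))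
      ((Finset.card_le_card hsub).trans hn) (by rw [pow_succ] at hJ; omega)
    classical
    -- Number 0 goes to the elements that collide with nothing in S; the moduli obtained for the
    -- colliding ones are shifted by one.
    refine ⟨fun j => if j = 0 then q else q' (j - 1),
      fun x => if x ∈ collisions S q then f x + 1 else 0, fun j => ?_, fun x hx => ?_, ?_⟩
    · dsimp only
      split_ifs
      · exact ⟨h1, by linarith⟩
      · exact g1 _
    · dsimp only
      split_ifs with h
      · have := g2 x h
        omega
      · omega
    · intro x hx y hy hf hm
      dsimp only at hf hm
      by_cases hxc : x ∈ collisions S q <;> by_cases hyc : y ∈ collisions S q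
      · simp only [hxc, hyc, if_true] at hf hm
        simp only [Nat.add_eq_zero_iff, one_ne_zero, and_false, if_false, Nat.add_sub_cancel] at hm
        exact g3 x hxc y hyc (by omega) hm
      · simp [hxc, hyc] at hf
      · simp [hxc, hyc] at hf
      · simp only [hxc, if_false, if_true] at hm
        by_contra hne
        exact hxc (Finset.mem_filter.2 ⟨hx, y, hy, Ne.symm hne, hm⟩)

/-! ### Ranks inside a chunk -/

/-- The number of `k < p` with `c k = a`. -/
def cnt (c : ℕ → ℕ) (a p : ℕ) : ℕ := Nat.count (fun k => c k = a) p

theorem cnt_mono (c : ℕ → ℕ) (a : ℕ) {p q : ℕ} (h : p ≤ q) : cnt c a p ≤ cnt c a q :=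
  Nat.count_monotone _ h

theorem cnt_succ_self (c : ℕ → ℕ) (p : ℕ) : cnt c (c p) (p + 1) = cnt c (c p) p + 1 := by
  simp [cnt, Nat.count_succ]

theorem cnt_add_le (c : ℕ → ℕ) (a p q : ℕ) : cnt c a (p + q) ≤ cnt c a p + q := by
  unfold cnt
  rw [Nat.count_add]
  exact Nat.add_le_add_left (Nat.count_le _) _

theorem exists_cnt_eq {c : ℕ → ℕ} {a v p : ℕ} (h : v < cnt c a p) :
    ∃ p' < p, c p' = a ∧ cnt c a p' = v := by
  have hcard : ∀ hf : (Set.ofPred (fun k => c k = a)).Finite, v < hf.toFinset.card :=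
    fun hf => h.trans_le (Nat.count_le_card hf _)
  exact ⟨Nat.nth (fun k => c k = a) v, Nat.nth_lt_of_lt_count h, Nat.nth_mem v hcard,
    Nat.count_nth hcard⟩

/-- The number of occurrences of `c p` in the chunk of `p` that precede `p`; the chunks have
`2 ^ L` positions. -/
def localRank (c : ℕ → ℕ) (L p : ℕ) : ℕ := cnt c (c p) p - cnt c (c p) (p / 2 ^ L * 2 ^ L)

theorem cnt_eq_localRank (c : ℕ → ℕ) (L p : ℕ) :
    cnt c (c p) p = cnt c (c p) (p / 2 ^ L * 2 ^ L) + localRank c L p := by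
  have := cnt_mono c (c p) (Nat.div_mul_le_self p (2 ^ L))
  unfold localRank
  omega

theorem localRank_lt (c : ℕ → ℕ) (L p : ℕ) : localRank c L p < 2 ^ L := by
  have h1 := Nat.div_add_mod' p (2 ^ L)
  have h2 := Nat.mod_lt p (Nat.two_pow_pos L)
  have h3 := cnt_add_le c (c p) (p / 2 ^ L * 2 ^ L) (p % 2 ^ L)
  rw [h1] at h3
  unfold localRank
  omega

theorem localRank_lt_localRank {c : ℕ → ℕ} {L p p' : ℕ} (hc : p / 2 ^ L = p' / 2 ^ L)
    (ha : c p = c p') (h : localRank c L p < localRank c L p') : p < p' := by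
  have h1 := cnt_eq_localRank c L p
  have h2 := cnt_eq_localRank c L p'
  rw [ha, hc] at h1
  by_contra hle
  have := cnt_mono c (c p') (not_lt.1 hle)
  omega

/-- The occurrences of a symbol in a chunk are divided into buckets of `s` consecutive ones. -/
def bucket (c : ℕ → ℕ) (L s p : ℕ) : ℕ := localRank c L p / s

def SameBucket (c : ℕ → ℕ) (L s p p' : ℕ) : Prop :=
  p' / 2 ^ L = p / 2 ^ L ∧ c p' = c p ∧ bucket c L s p' = bucket c L s p

theorem SameBucket.symm {c : ℕ → ℕ} {L s p p' : ℕ} (h : SameBucket c L s p p') :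
    SameBucket c L s p' p := ⟨h.1.symm, h.2.1.symm, h.2.2.symm⟩

theorem SameBucket.trans {c : ℕ → ℕ} {L s p p' p'' : ℕ} (h : SameBucket c L s p p')
    (h' : SameBucket c L s p' p'') : SameBucket c L s p p'' :=
  ⟨h'.1.trans h.1, h'.2.1.trans h.2.1, h'.2.2.trans h.2.2⟩

theorem exists_level (c : ℕ → ℕ) (L s p : ℕ) :
    ∃ l, ∀ p', SameBucket c L s p p' → p' % 2 ^ L / 2 ^ l = p % 2 ^ L / 2 ^ l :=
  ⟨L, fun p' _ => by
    rw [Nat.div_eq_of_lt (Nat.mod_lt _ (Nat.two_pow_pos L)),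
      Nat.div_eq_of_lt (Nat.mod_lt _ (Nat.two_pow_pos L))]⟩

open Classical in
/-- The height of the smallest dyadic interval that contains the bucket of `p`. -/
noncomputable def level (c : ℕ → ℕ) (L s p : ℕ) : ℕ := Nat.find (exists_level c L s p)

theorem level_spec {c : ℕ → ℕ} {L s p p' : ℕ} (h : SameBucket c L s p p') :
    p' % 2 ^ L / 2 ^ level c L s p = p % 2 ^ L / 2 ^ level c L s p := by
  classical
  exact Nat.find_spec (exists_level c L s p) p' h

theorem level_min {c : ℕ → ℕ} {L s p l : ℕ} (h : l < level c L s p) :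
    ∃ p', SameBucket c L s p p' ∧ p' % 2 ^ L / 2 ^ l ≠ p % 2 ^ L / 2 ^ l := by
  classical
  have := Nat.find_min (exists_level c L s p) h
  push Not at this
  exact this

theorem level_le (c : ℕ → ℕ) (L s p : ℕ) : level c L s p ≤ L := by
  classical
  refine Nat.find_le fun p' _ => ?_
  rw [Nat.div_eq_of_lt (Nat.mod_lt _ (Nat.two_pow_pos L)),
    Nat.div_eq_of_lt (Nat.mod_lt _ (Nat.two_pow_pos L))]

theorem SameBucket.level_le_level {c : ℕ → ℕ} {L s p p' : ℕ} (h : SameBucket c L s p p') :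
    level c L s p' ≤ level c L s p := by
  classical
  refine Nat.find_le fun p'' h'' => ?_
  rw [level_spec (h.trans h''), level_spec h]

theorem SameBucket.level_eq {c : ℕ → ℕ} {L s p p' : ℕ} (h : SameBucket c L s p p') :
    level c L s p' = level c L s p :=
  le_antisymm h.level_le_level h.symm.level_le_level

/-- The symbol `c p` and the smallest dyadic interval of the bucket of `p`, as a number. -/
noncomputable def bucketKey (c : ℕ → ℕ) (L s p : ℕ) : ℕ :=
  c p * 2 ^ (L + 1) + (2 ^ L + p % 2 ^ L) / 2 ^ level c L s p

/-- Heap numbering of dyadic intervals: 2^L + y is the leaf y, and division by 2^l climbs to its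
ancestor of height l, number y / 2^l among the 2^(L - l) nodes of that height. -/
theorem two_pow_add_div {L y l : ℕ} (hl : l ≤ L) :
    (2 ^ L + y) / 2 ^ l = 2 ^ (L - l) + y / 2 ^ l := by
  have : 2 ^ L = 2 ^ l * 2 ^ (L - l) := by rw [← pow_add]; congr 1; omega
  rw [this, Nat.mul_add_div (Nat.two_pow_pos l)]

theorem div_two_pow_lt {L y l : ℕ} (hl : l ≤ L) (hy : y < 2 ^ L) : y / 2 ^ l < 2 ^ (L - l) := by
  apply Nat.div_lt_of_lt_mul
  rw [← pow_add]
  convert hy using 2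
  omega

theorem node_lt {L y : ℕ} (l : ℕ) (hy : y < 2 ^ L) : (2 ^ L + y) / 2 ^ l < 2 ^ (L + 1) := by
  refine (Nat.div_le_self _ _).trans_lt ?_
  rw [pow_succ]
  omega

theorem bucketKey_lt {c : ℕ → ℕ} {L s p B : ℕ} (h : c p < 2 ^ B) :
    bucketKey c L s p < 2 ^ (B + (L + 1)) := by
  have h1 := node_lt (level c L s p) (Nat.mod_lt p (Nat.two_pow_pos L))
  have h2 : (c p + 1) * 2 ^ (L + 1) ≤ 2 ^ B * 2 ^ (L + 1) := Nat.mul_le_mul_right _ h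
  rw [pow_add]
  unfold bucketKey
  linarith

theorem SameBucket.key_eq {c : ℕ → ℕ} {L s p p' : ℕ} (h : SameBucket c L s p p') :
    bucketKey c L s p' = bucketKey c L s p := by
  unfold bucketKey
  rw [h.level_eq, h.2.1, two_pow_add_div (level_le _ _ _ _), two_pow_add_div (level_le _ _ _ _),
    level_spec h]

/-- Every element of the earlier bucket precedes every element of the later one. At height 0 both
buckets would sit on the same position. At a greater height minimality puts elements of each bucket
into both halves of the common interval, so an element of the earlier bucket in the right half would
precede one of the later bucket in the left half. -/
theorem bucket_lt_false {c : ℕ → ℕ} {L s p p' : ℕ} (hc : p / 2 ^ L = p' / 2 ^ L)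
    (ha : c p = c p') (hl : level c L s p = level c L s p')
    (hd : p % 2 ^ L / 2 ^ level c L s p = p' % 2 ^ L / 2 ^ level c L s p)
    (ht : bucket c L s p < bucket c L s p') : False := by
  have key : ∀ e e', SameBucket c L s p e → SameBucket c L s p' e' → e % 2 ^ L < e' % 2 ^ L := by
    intro e e' he he'
    have h1 : e < e' := by
      apply localRank_lt_localRank (c := c) (L := L) (by rw [he.1, he'.1, hc]) (by rw [he.2.1, he'.2.1, ha])
      by_contra hle
      have := Nat.div_le_div_right (c := s) (not_lt.1 hle)
      have h2 := he.2.2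
      have h3 := he'.2.2
      unfold bucket at h2 h3 ht
      omega
    have h2 := Nat.div_add_mod' e (2 ^ L)
    have h3 := Nat.div_add_mod' e' (2 ^ L)
    rw [he.1] at h2
    rw [he'.1, ← hc] at h3
    omega
  rcases hl0 : level c L s p with _ | l
  · rw [hl0] at hd
    simp only [pow_zero, Nat.div_one] at hd
    have := key p p' ⟨rfl, rfl, rfl⟩ ⟨rfl, rfl, rfl⟩
    omega
  · obtain ⟨e, he, hne⟩ := level_min (c := c) (L := L) (s := s) (p := p) (l := l) (by omega)
    obtain ⟨e', he', hne'⟩ := level_min (c := c) (L := L) (s := s) (p := p') (l := l) (by omega)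
    have s1 := level_spec he
    have s2 := level_spec he'
    rw [← hl] at s2
    rw [hl0, pow_succ] at s1 s2 hd
    simp only [← Nat.div_div_eq_div_mul] at s1 s2 hd
    have m1 := Nat.div_le_div_right (c := 2 ^ l) (key e e' he he').le
    have m2 := Nat.div_le_div_right (c := 2 ^ l) (key p e' ⟨rfl, rfl, rfl⟩ he').le
    have m3 := Nat.div_le_div_right (c := 2 ^ l) (key e p' he ⟨rfl, rfl, rfl⟩).le
    have m4 := Nat.div_le_div_right (c := 2 ^ l)
      (key p p' ⟨rfl, rfl, rfl⟩ ⟨rfl, rfl, rfl⟩).le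
    omega

/-- Inside a chunk the key of a position determines its bucket. -/
theorem bucket_eq_of_key_eq {c : ℕ → ℕ} {L s p p' : ℕ} (hc : p / 2 ^ L = p' / 2 ^ L)
    (hk : bucketKey c L s p = bucketKey c L s p') :
    c p = c p' ∧ bucket c L s p = bucket c L s p' := by
  have hy := Nat.mod_lt p (Nat.two_pow_pos L)
  have hy' := Nat.mod_lt p' (Nat.two_pow_pos L)
  have hl := level_le c L s p
  have hl' := level_le c L s p'
  have h1 := node_lt (level c L s p) hy
  have h2 := node_lt (level c L s p') hy'
  unfold bucketKey at hk
  have ha : c p = c p' := by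
    have := congrArg (· / 2 ^ (L + 1)) hk
    simp only [mul_comm (c _)] at this
    rwa [Nat.mul_add_div (Nat.two_pow_pos _), Nat.mul_add_div (Nat.two_pow_pos _),
      Nat.div_eq_of_lt h1, Nat.div_eq_of_lt h2] at this
  rw [ha, Nat.add_left_cancel_iff, two_pow_add_div hl, two_pow_add_div hl'] at hk
  have d1 := div_two_pow_lt hl hy
  have d2 := div_two_pow_lt hl' hy'
  -- A number 2^(L - l) + d with d < 2^(L - l) has its leading bit at L - l, so the heap number
  -- determines the height l, and then d.
  have hlev : level c L s p = level c L s p' := by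
    clear h1 h2
    generalize p % 2 ^ L / 2 ^ level c L s p = d at hk d1
    generalize p' % 2 ^ L / 2 ^ level c L s p' = d' at hk d2
    by_contra hne
    rcases lt_or_gt_of_ne hne with hlt | hlt
    · have : 2 ^ (L - level c L s p' + 1) ≤ 2 ^ (L - level c L s p) :=
        Nat.pow_le_pow_right (by omega) (by omega)
      rw [pow_succ] at this
      omega
    · have : 2 ^ (L - level c L s p + 1) ≤ 2 ^ (L - level c L s p') :=
        Nat.pow_le_pow_right (by omega) (by omega)
      rw [pow_succ] at this
      omega
  refine ⟨ha, ?_⟩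
  rw [← hlev, Nat.add_left_cancel_iff] at hk
  by_contra hne
  rcases lt_or_gt_of_ne hne with hlt | hlt
  · exact bucket_lt_false hc ha hlev hk hlt
  · exact bucket_lt_false hc.symm ha.symm hlev.symm (by rw [← hlev]; exact hk.symm) hlt

/-- The keys of the buckets of a chunk other than the first buckets of the symbols. -/
noncomputable def chunkKeys (c : ℕ → ℕ) (L s m k : ℕ) : Finset ℕ :=
  ((Finset.range (m + 1)).filter (fun p => p / 2 ^ L = k ∧ 1 ≤ bucket c L s p)).image
    (bucketKey c L s)

theorem mem_chunkKeys {c : ℕ → ℕ} {L s m k x : ℕ} : x ∈ chunkKeys c L s m k ↔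
    ∃ p ≤ m, p / 2 ^ L = k ∧ 1 ≤ bucket c L s p ∧ bucketKey c L s p = x := by
  simp only [chunkKeys, Finset.mem_image, Finset.mem_filter, Finset.mem_range, Nat.lt_succ_iff,
    and_assoc]

/-- A bucket that is not the first one of its symbol is entered only after the previous bucket has
received all of its s occurrences, so every remainder r is realised there. -/
theorem exists_in_previous_bucket {c : ℕ → ℕ} {L s p r : ℕ} (hr : r < s)
    (hb : 1 ≤ bucket c L s p) :
    ∃ p' < p, p' / 2 ^ L = p / 2 ^ L ∧ c p' = c p ∧
      localRank c L p' = s * (bucket c L s p - 1) + r := by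
  have h0 := cnt_eq_localRank c L p
  have h1 : s * (bucket c L s p - 1) + r < localRank c L p := by
    have : s * bucket c L s p ≤ localRank c L p := Nat.mul_div_le _ _
    obtain ⟨k, hk⟩ : ∃ k, bucket c L s p = k + 1 := ⟨bucket c L s p - 1, by omega⟩
    rw [hk] at this ⊢
    rw [Nat.mul_succ] at this
    simp only [Nat.add_sub_cancel]
    omega
  obtain ⟨p', hlt, hc, hcnt⟩ := exists_cnt_eq (c := c) (a := c p) (p := p)
    (v := cnt c (c p) (p / 2 ^ L * 2 ^ L) + (s * (bucket c L s p - 1) + r)) (by omega)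
  have hge : p / 2 ^ L * 2 ^ L ≤ p' := by
    by_contra hlt'
    have h2 := cnt_mono c (c p) (show p' + 1 ≤ p / 2 ^ L * 2 ^ L by omega)
    have h3 := cnt_succ_self c p'
    rw [hc] at h3
    omega
  have hdiv : p' / 2 ^ L = p / 2 ^ L :=
    le_antisymm (Nat.div_le_div_right hlt.le) ((Nat.le_div_iff_mul_le (Nat.two_pow_pos L)).2 hge)
  refine ⟨p', hlt, hdiv, hc, ?_⟩
  unfold localRank
  rw [hc, hcnt, hdiv]
  omega

/-- Each key is charged to the s positions of the full bucket before its own. Different keys come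
from different buckets, so no position of the chunk is charged twice. -/
theorem card_chunkKeys_mul_le (c : ℕ → ℕ) (L s m k : ℕ) :
    (chunkKeys c L s m k).card * s ≤ min (2 ^ L) (m + 1) := by
  have hex : ∀ x ∈ chunkKeys c L s m k, ∃ p ≤ m, p / 2 ^ L = k ∧ 1 ≤ bucket c L s p ∧
      bucketKey c L s p = x := fun x hx => mem_chunkKeys.1 hx
  choose! P hPm hPk hPb hPx using hex
  have hex2 : ∀ z ∈ chunkKeys c L s m k ×ˢ Finset.range s, ∃ p' < P z.1, p' / 2 ^ L = k ∧
      c p' = c (P z.1) ∧ localRank c L p' = s * (bucket c L s (P z.1) - 1) + z.2 := by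
    intro z hz
    rw [Finset.mem_product, Finset.mem_range] at hz
    have := exists_in_previous_bucket (c := c) (L := L) hz.2 (hPb _ hz.1)
    rwa [hPk _ hz.1] at this
  choose! R hRlt hRk hRc hRr using hex2
  have hcard : (chunkKeys c L s m k ×ˢ Finset.range s).card ≤
      ((Finset.range (m + 1)).filter (fun p => p / 2 ^ L = k)).card := by
    refine Finset.card_le_card_of_injOn R ?_ ?_
    · intro z hz
      have hz1 := (Finset.mem_product.1 hz).1
      have := hRlt z hz
      have := hPm z.1 hz1
      simp only [Finset.coe_filter, Finset.mem_range, Set.mem_ofPred_eq]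
      exact ⟨by omega, hRk z hz⟩
    · intro z hz z' hz' he
      have hz1 := Finset.mem_product.1 hz
      have hz1' := Finset.mem_product.1 hz'
      have r1 := hRr z hz
      have r2 := hRr z' hz'
      have hlt := Finset.mem_range.1 hz1.2
      have hlt' := Finset.mem_range.1 hz1'.2
      rw [he, r2] at r1
      have d1 := congrArg (· / s) r1
      have d2 := congrArg (· % s) r1
      have hs : 0 < s := by omega
      simp only [Nat.mul_add_div hs, Nat.mul_add_mod, Nat.div_eq_of_lt hlt, Nat.div_eq_of_lt hlt',
        Nat.mod_eq_of_lt hlt, Nat.mod_eq_of_lt hlt', add_zero] at d1 d2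
      have hb : bucket c L s (P z.1) = bucket c L s (P z'.1) := by
        have := hPb _ hz1.1
        have := hPb _ hz1'.1
        omega
      have hsame : SameBucket c L s (P z'.1) (P z.1) :=
        ⟨by rw [hPk _ hz1.1, hPk _ hz1'.1], by rw [← hRc z hz, ← hRc z' hz', he], hb⟩
      have := hsame.key_eq
      rw [hPx _ hz1.1, hPx _ hz1'.1] at this
      exact Prod.ext this d2.symm
  rw [Finset.card_product, Finset.card_range] at hcard
  refine hcard.trans (le_min ?_ ?_)
  · have : ((Finset.range (m + 1)).filter (fun p => p / 2 ^ L = k)) ⊆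
        Finset.Ico (k * 2 ^ L) (k * 2 ^ L + 2 ^ L) := by
      intro p hp
      have hp := (Finset.mem_filter.1 hp).2
      have h1 := Nat.div_add_mod' p (2 ^ L)
      have h2 := Nat.mod_lt p (Nat.two_pow_pos L)
      rw [hp] at h1
      rw [Finset.mem_Ico]
      omega
    simpa using Finset.card_le_card this
  · simpa using Finset.card_filter_le (Finset.range (m + 1)) (fun p => p / 2 ^ L = k)

/-- The moduli of a chunk: `f` tells which modulus a key has to use. -/
theorem exists_chunk_moduli {c : ℕ → ℕ} {B : ℕ} (hc : ∀ p, c p < 2 ^ B) (L m k : ℕ) {s : ℕ}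
    (hs : 0 < s) :
    ∃ q f : ℕ → ℕ,
      (∀ j, 1 ≤ q j ∧ q j ≤ 4 * (B + (L + 1)) * (min (2 ^ L) (m + 1) / s) + 2) ∧
      (∀ x ∈ chunkKeys c L s m k, f x < L + 1) ∧
      ∀ x ∈ chunkKeys c L s m k, ∀ y ∈ chunkKeys c L s m k, f x = f y →
        x % q (f x) = y % q (f x) → x = y := by
  have h1 := card_chunkKeys_mul_le c L s m k
  have h2 : (chunkKeys c L s m k).card ≤ min (2 ^ L) (m + 1) / s :=
    (Nat.le_div_iff_mul_le hs).2 h1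
  refine exists_moduli (L + 1) _ ?_ h2 ?_
  · intro x hx
    obtain ⟨p, _, _, _, rfl⟩ := mem_chunkKeys.1 hx
    exact bucketKey_lt (hc p)
  · have h3 : (chunkKeys c L s m k).card ≤ (chunkKeys c L s m k).card * s :=
      Nat.le_mul_of_pos_right _ hs
    have : 2 ^ L < 2 ^ (L + 1) := Nat.pow_lt_pow_right (by omega) (by omega)
    omega

/-! ### Reading bit fields -/

/-- The number whose binary digits are the `len` bits of `D` from `off` on. -/
def field (D : List Bool) (off len : ℕ) : ℕ :=
  ∑ b ∈ Finset.range len, if D.getD (off + b) false then 2 ^ b else 0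

theorem testBit_field (D : List Bool) (off len e : ℕ) :
    (field D off len).testBit e = (decide (e < len) && D.getD (off + e) false) := by
  have : field D off len = pack 1 len (fun b => if D.getD (off + b) false then 1 else 0) := by
    unfold field pack
    refine Finset.sum_congr rfl fun b _ => ?_
    by_cases h : D.getD (off + b) false = true
    · simp only [h, if_true, one_mul]
    · simp only [h, if_false, zero_mul, Bool.false_eq_true]
  rw [this, testBit_pack fun i _ => by split_ifs <;> simp]
  simp only [one_mul, Nat.div_one, Nat.mod_one]
  cases h : D.getD (off + e) false <;> simp

theorem field_lt (D : List Bool) (off len : ℕ) : field D off len < 2 ^ len := by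
  apply Nat.lt_pow_two_of_testBit
  intro i hi
  rw [testBit_field]
  simp [show ¬ i < len by omega]

theorem memWord_eq_field (w : ℕ) (D : List Bool) (k : ℕ) : memWord w D k = field D (k * w) w := rfl

/-- The field may straddle two words, which are joined at offset o. Shifting left and then right by
w - len clears the high bits and also works for len = w, where 2^len is no longer a word. -/
theorem field_eq_of_words {w W o len : ℕ} (D : List Bool) (ho : o < w) (hl : len ≤ w) :
    ((((memWord w D W >>> o) ||| ((memWord w D (W + 1) <<< (w - o)) % 2 ^ w)) <<< (w - len)) %
      2 ^ w) >>> (w - len) = field D (W * w + o) len := by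
  apply Nat.eq_of_testBit_eq
  intro e
  simp only [Nat.testBit_shiftRight, Nat.testBit_mod_two_pow, Nat.testBit_shiftLeft,
    Nat.testBit_or, memWord_eq_field, testBit_field]
  by_cases he : e < len
  · simp only [he, show w - len + e < w by omega, show w - len ≤ w - len + e by omega,
      show w - len + e - (w - len) = e by omega, decide_true, Bool.true_and]
    by_cases h : o + e < w
    · simp [h, show ¬ (w - o ≤ e) by omega, add_assoc]
    · have h1 : (W + 1) * w + (e - (w - o)) = W * w + o + e := by
        rw [Nat.succ_mul]; omega
      simp [h, show w - o ≤ e by omega, show e < w by omega, show e - (w - o) < w by omega, h1]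
  · simp [he, show ¬ (w - len + e < w) by omega]

theorem Comp.field {A : Query → Prop} {W o len : Query → ℕ} (hW : Comp A W) (ho : Comp A o)
    (hlen : Comp A len) (h₁ : ∀ x, A x → o x < x.w) (h₂ : ∀ x, A x → len x ≤ x.w)
    (h₃ : ∀ x, A x → W x + 1 < 2 ^ x.w) :
    Comp A (fun x => WordRAM.field x.D (W x * x.w + o x) (len x)) := by
  have hw : ∀ x, A x → x.w < 2 ^ x.w := fun x _ => Nat.lt_two_pow_self
  have h1 : Comp A (fun _ => 1) := Comp.const 1 fun x hx => by
    have := h₃ x hx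
    omega
  have hs := (Comp.input_w A).sub ho hw fun x hx => (h₁ x hx).le
  have hs' := (Comp.input_w A).sub hlen hw h₂
  have hw1 := (hW.add h1 h₃).load
  refine (((((hW.load).shr ho).lor (hw1.shl hs)).shl hs').shr hs').congr fun x hx => ?_
  exact field_eq_of_words x.D (h₁ x hx) (h₂ x hx)

/-- The bit address itself may exceed a word. Dividing m + 1 and h by w beforehand yields the word
number and the offset from quantities that all stay below 2^w. -/
theorem Comp.slot_field {A : Query → Prop} {G h f len : Query → ℕ} (hG : Comp A G) (hh : Comp A h)
    (hf : Comp A f) (hlen : Comp A len)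
    (hw : ∀ x, A x → 2 * (x.w * x.w) < 2 ^ x.w) (hm : ∀ x, A x → x.m + 1 < 2 ^ x.w)
    (hGw : ∀ x, A x → G x ≤ x.w) (hfw : ∀ x, A x → f x ≤ x.w) (hlw : ∀ x, A x → len x ≤ x.w)
    (hlt : ∀ x, A x → (x.m + 1) * G x + h x * f x < x.w * (2 ^ x.w - 1))
    (hh2 : ∀ x, A x → h x < 2 ^ x.w) :
    Comp A (fun x => WordRAM.field x.D ((x.m + 1) * G x + h x * f x) (len x)) := by
  have hw0 : ∀ x, A x → 0 < x.w := fun x hx => by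
    have := hlt x hx
    rcases Nat.eq_zero_or_pos x.w with h | h
    · rw [h] at this; omega
    · exact h
  have h1 : Comp A (fun _ => 1) := Comp.const 1 fun x hx => Nat.one_lt_two_pow (hw0 x hx).ne'
  have cw := Comp.input_w A
  have cm := (Comp.input_m A).add h1 hm
  have key : ∀ x : Query, ((x.m + 1) / x.w * G x + h x / x.w * f x +
      ((x.m + 1) % x.w * G x + h x % x.w * f x) / x.w) * x.w +
      ((x.m + 1) % x.w * G x + h x % x.w * f x) % x.w = (x.m + 1) * G x + h x * f x := by
    intro x
    have e1 := Nat.div_add_mod' ((x.m + 1) % x.w * G x + h x % x.w * f x) x.w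
    have e2 := Nat.div_add_mod' (x.m + 1) x.w
    have e3 := Nat.div_add_mod' (h x) x.w
    rw [add_mul, add_assoc, e1]
    conv_rhs => rw [← e2, ← e3]
    ring
  have hW : ∀ x, A x → (x.m + 1) / x.w * G x + h x / x.w * f x +
      ((x.m + 1) % x.w * G x + h x % x.w * f x) / x.w + 1 < 2 ^ x.w := by
    intro x hx
    have h1 := key x
    have h2 := hlt x hx
    generalize (x.m + 1) / x.w * G x + h x / x.w * f x +
      ((x.m + 1) % x.w * G x + h x % x.w * f x) / x.w = W at h1 ⊢
    have : x.w * W < x.w * (2 ^ x.w - 1) := by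
      rw [mul_comm]
      exact (Nat.le_add_right _ _).trans_lt (h1.trans_lt h2)
    have := Nat.lt_of_mul_lt_mul_left this
    omega
  have hr : ∀ x, A x → (x.m + 1) % x.w * G x ≤ x.w * x.w ∧ h x % x.w * f x ≤ x.w * x.w := by
    intro x hx
    have h0 := hw0 x hx
    exact ⟨Nat.mul_le_mul (Nat.mod_lt _ h0).le (hGw x hx),
      Nat.mul_le_mul (Nat.mod_lt _ h0).le (hfw x hx)⟩
  have c1 : Comp A (fun x => (x.m + 1) % x.w * G x + h x % x.w * f x) := by
    refine Comp.add (Comp.mul (cm.mod cw hm) hG fun x hx => ?_)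
      (Comp.mul (hh.mod cw hh2) hf fun x hx => ?_) fun x hx => ?_ <;>
    · have := hr x hx
      have := hw x hx
      omega
  have c2 : Comp A (fun x => (x.m + 1) / x.w * G x + h x / x.w * f x +
      ((x.m + 1) % x.w * G x + h x % x.w * f x) / x.w) := by
    refine Comp.add (Comp.add (Comp.mul (cm.div cw) hG fun x hx => ?_)
      (Comp.mul (hh.div cw) hf fun x hx => ?_) fun x hx => ?_) (c1.div cw) fun x hx => ?_ <;>
    · have := hW x hx
      generalize (x.m + 1) / x.w * G x = q₁ at *
      generalize h x / x.w * f x = q₂ at *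
      generalize ((x.m + 1) % x.w * G x + h x % x.w * f x) / x.w = q₃ at *
      omega
  refine (Comp.field c2 (c1.mod cw fun x hx => ?_) hlen (fun x hx => Nat.mod_lt _ (hw0 x hx)) hlw
    hW).congr fun x _ => ?_
  · have := hr x hx
    have := hw x hx
    omega
  · rw [key x]

/-! ### Arrays -/

/-- `T` slots of `M` bits each; slot `t` holds an array of entries `v t 0, v t 1, …` of `f t`
bits. -/
def layout (T M : ℕ) (f : ℕ → ℕ) (v : ℕ → ℕ → ℕ) : List Bool :=
  (List.range (T * M)).map
    (fun n => (v (n / M) (n % M / f (n / M))).testBit (n % M % f (n / M)))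

theorem length_layout (T M : ℕ) (f : ℕ → ℕ) (v : ℕ → ℕ → ℕ) :
    (layout T M f v).length = T * M := by simp [layout]

theorem layout_getD {T M t e : ℕ} (f : ℕ → ℕ) (v : ℕ → ℕ → ℕ) (ht : t < T) (he : e < M) :
    (layout T M f v).getD (M * t + e) false = (v t (e / f t)).testBit (e % f t) := by
  have hlt : M * t + e < T * M := by
    have := Nat.mul_le_mul_left M ht
    rw [Nat.mul_succ] at this
    rw [mul_comm T]
    omega
  have h1 : (M * t + e) / M = t := by
    rw [Nat.mul_add_div (by omega), Nat.div_eq_of_lt he, add_zero]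
  have h2 : (M * t + e) % M = e := by rw [Nat.mul_add_mod, Nat.mod_eq_of_lt he]
  rw [List.getD_eq_getElem _ _ (by rw [length_layout]; exact hlt)]
  simp [layout, h1, h2]

theorem field_layout {T M t h k : ℕ} {f : ℕ → ℕ} {v : ℕ → ℕ → ℕ} (ht : t < T) (hf : 0 < f t)
    (hv : ∀ i < k, v t (h + i) < 2 ^ f t) (hM : (h + k) * f t ≤ M) :
    field (layout T M f v) (M * t + h * f t) (f t * k) = pack (f t) k (fun i => v t (h + i)) := by
  apply Nat.eq_of_testBit_eq
  intro e
  rw [testBit_field, testBit_pack hv]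
  by_cases he : e < f t * k
  swap
  · simp [he]
  have hlt : h * f t + e < M := by
    rw [add_mul, mul_comm k] at hM
    omega
  rw [add_assoc, layout_getD f v ht hlt]
  have h1 : (h * f t + e) / f t = h + e / f t := by
    rw [mul_comm, Nat.mul_add_div hf]
  have h2 : (h * f t + e) % f t = e % f t := by rw [mul_comm, Nat.mul_add_mod]
  rw [h1, h2]

theorem field_layout_single {T M t h : ℕ} {f : ℕ → ℕ} {v : ℕ → ℕ → ℕ} (ht : t < T) (hf : 0 < f t)
    (hv : v t h < 2 ^ f t) (hM : (h + 1) * f t ≤ M) :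
    field (layout T M f v) (M * t + h * f t) (f t) = v t h := by
  have := field_layout (k := 1) (v := v) (h := h) ht hf (fun i hi => by
    obtain rfl : i = 0 := by omega
    exact hv) hM
  simpa [pack] using this

/-! ### Parameters of the data structure -/

/-- The number of bits of a symbol. -/
def lam (σ : ℕ) : ℕ := Nat.clog 2 σ

/-- A quantity of order `log log σ`. -/
def psi (σ : ℕ) : ℕ := (lam σ).size / 2 + 1

/-- There are `2 ^ kap σ m` chunks in a superblock. -/
def kap (σ m : ℕ) : ℕ := m.size.size.size - lam σ

/-- The number of bits of a position in a region with its own absolute counters. -/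
def zet (σ m : ℕ) : ℕ := 2 * lam σ + kap σ m + m.size.size

/-- The number of bits of an entry of the header. -/
def theta (σ m : ℕ) : ℕ := (lam σ).size + m.size.size + 3

/-- A bound for the number of keys in the dictionary of a chunk. -/
def keyCap (σ m : ℕ) : ℕ := min (2 ^ (2 * lam σ)) (m + 1) / 2 ^ (8 * psi σ)

/-- The number of entries of a hash table. -/
def tableLen (σ m : ℕ) : ℕ := 16 * lam σ * keyCap σ m

/-- The number of bits of a slot of the layout. -/
def slotLen (σ m : ℕ) : ℕ := (m + 1) * (100 * psi σ)

theorem size_le_self (n : ℕ) : n.size ≤ n := by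
  rw [Nat.size_le]
  exact Nat.lt_two_pow_self

theorem two_pow_size_le {n : ℕ} (h : 0 < n) : 2 ^ n.size ≤ 2 * n := by
  have h1 : 0 < n.size := Nat.size_pos.2 h
  have h2 : 2 ^ (n.size - 1) ≤ n := Nat.lt_size.1 (by omega)
  have h3 : n.size = (n.size - 1) + 1 := by omega
  rw [h3, pow_succ]
  omega

theorem le_two_pow_lam (σ : ℕ) : σ ≤ 2 ^ lam σ := Nat.le_pow_clog (by omega) σ

theorem two_le_lam {σ : ℕ} (h : 3 ≤ σ) : 2 ≤ lam σ := by
  by_contra hc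
  have h1 := le_two_pow_lam σ
  have : 2 ^ lam σ ≤ 2 ^ 1 := Nat.pow_le_pow_right (by omega) (by omega)
  omega

theorem two_pow_pred_lam_lt {σ : ℕ} (h : 3 ≤ σ) : 2 ^ (lam σ - 1) < σ :=
  Nat.pow_pred_clog_lt_self (by omega) (by omega)

theorem lam_lt (σ : ℕ) : lam σ < 2 ^ (2 * psi σ - 1) := by
  refine (Nat.lt_size_self _).trans_le (Nat.pow_le_pow_right (by omega) ?_)
  unfold psi
  omega

theorem one_le_psi (σ : ℕ) : 1 ≤ psi σ := by unfold psi; omega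

theorem two_pow_psi_le {σ : ℕ} (h : 3 ≤ σ) : 2 ^ (2 * psi σ - 2) ≤ 2 * lam σ := by
  refine (Nat.pow_le_pow_right (by omega) ?_).trans (two_pow_size_le (n := lam σ) ?_)
  · unfold psi; omega
  · have := two_le_lam h; omega

theorem two_mul_lam_lt (σ : ℕ) : 2 * lam σ < 2 ^ (2 * psi σ) := by
  have h1 := lam_lt σ
  have h2 := one_le_psi σ
  rw [show 2 * psi σ = 2 * psi σ - 1 + 1 by omega, pow_succ]
  omega

/-- The reason for the block length 2^(4ψ): it exceeds the length of every small interval. -/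
theorem two_mul_lam_sq_lt (σ : ℕ) : 2 * (lam σ * lam σ) < 2 ^ (4 * psi σ) := by
  have h1 := two_mul_lam_lt σ
  rw [show 4 * psi σ = 2 * psi σ + 2 * psi σ by omega, pow_add]
  nlinarith

theorem two_le_psi {σ : ℕ} (hσ : 3 ≤ σ) : 2 ≤ psi σ := by
  have : 2 ≤ (lam σ).size := Nat.lt_size.2 (by have := two_le_lam hσ; omega)
  unfold psi
  omega

/-- The reason for the bucket size 2^(8ψ): it pays for about λ tables with about λ entries per key,
each entry of about λ bits. -/
theorem lam_cube_le {σ : ℕ} (hσ : 3 ≤ σ) :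
    128 * (lam σ * lam σ * lam σ) ≤ 2 ^ (8 * psi σ) := by
  have h1 := two_mul_lam_lt σ
  have h2 : 2 ^ 4 ≤ 2 ^ (2 * psi σ) :=
    Nat.pow_le_pow_right (by omega) (by have := two_le_psi hσ; omega)
  rw [show 8 * psi σ = 2 * psi σ * 3 + 2 * psi σ by omega, pow_add, pow_mul]
  calc 128 * (lam σ * lam σ * lam σ) = (2 * lam σ) ^ 3 * 2 ^ 4 := by ring
    _ ≤ _ := Nat.mul_le_mul (Nat.pow_le_pow_left h1.le 3) h2

theorem two_mul_sq_lt {w : ℕ} (h : 7 ≤ w) : 2 * (w * w) < 2 ^ w := by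
  induction w, h using Nat.le_induction with
  | base => norm_num
  | succ n hn ih => rw [pow_succ]; nlinarith

/-- The numerical facts about the parameters that make the query algorithm work. -/
structure Bounds (w σ m : ℕ) : Prop where
  hσ : 3 ≤ σ
  hm : m + 1 < 2 ^ w
  hw : 1000000 ≤ w
  lam_le : 4 * lam σ ≤ w + 3
  psi_lt : 1300 * psi σ < w
  psi_pow_lt : 20 * psi σ * 2 ^ psi σ < w
  spread₁ : (2 * lam σ + 1) * 2 ^ kap σ m < w
  spread₂ : (2 * lam σ + 1) * 2 ^ kap σ m * (2 ^ kap σ m - 1) < w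
  theta_lt : 2 * theta σ m + 1 < w
  zet_lt : zet σ m + 1 < w

/-- The hypothesis bounds 2^p by a multiple of √w, so p 2^p is below w once w is large. The value 20
· 12 · 2^12 = 983040 is just below the threshold for w. -/
theorem psi_bounds {w p : ℕ} (hw : 1000000 ≤ w) (h : 2 ^ (2 * p - 2) * 2 ≤ w + 3) :
    1300 * p < w ∧ 20 * p * 2 ^ p < w := by
  by_cases hp : p ≤ 12
  · have h1 : 2 ^ p ≤ 2 ^ 12 := Nat.pow_le_pow_right (by omega) hp
    constructor
    · omega
    · calc 20 * p * 2 ^ p ≤ 20 * 12 * 2 ^ 12 := Nat.mul_le_mul (by omega) h1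
        _ < w := by norm_num; omega
  · have key : ∀ n, 13 ≤ n → 1300 * n + 40 < 2 ^ n * 4 := by
      intro n hn
      induction n, hn using Nat.le_induction with
      | base => norm_num
      | succ k hk ih => rw [pow_succ]; omega
    have k1 := key p (by omega)
    have k2 : 2 ^ 13 ≤ 2 ^ p := Nat.pow_le_pow_right (by omega) (by omega)
    have e : 2 ^ (2 * p - 2) * 2 * 2 = 2 ^ p * 2 ^ p := by
      rw [← pow_add, mul_assoc, show (2 * 2 : ℕ) = 2 ^ 2 by norm_num, ← pow_add]
      congr 1
      omega
    norm_num at k2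
    constructor <;> nlinarith

/-- Used with y = `m.size.size`, where the product bounds the room needed for adding up the chunk
counters of a superblock inside one word. -/
theorem cube_lt_two_pow {y w : ℕ} (hw : 1000000 ≤ w) (h : 2 ^ y ≤ 2 * w) :
    (2 * y + 1) * (2 * y) * (2 * y) < w := by
  by_cases hy : y ≤ 30
  · calc (2 * y + 1) * (2 * y) * (2 * y) ≤ (2 * 30 + 1) * (2 * 30) * (2 * 30) := by gcongr
      _ < w := by omega
  · have key : ∀ n, 31 ≤ n → 2 * ((2 * n + 1) * (2 * n) * (2 * n)) < 2 ^ n := by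
      intro n hn
      induction n, hn using Nat.le_induction with
      | base => norm_num
      | succ k hk ih =>
        rw [pow_succ]
        have h2 : 31 * k ≤ k * k := Nat.mul_le_mul_right _ hk
        have h3 : 31 * (k * k) ≤ k * (k * k) := Nat.mul_le_mul_right _ hk
        calc 2 * ((2 * (k + 1) + 1) * (2 * (k + 1)) * (2 * (k + 1)))
            = 16 * (k * (k * k)) + 56 * (k * k) + 64 * k + 24 := by ring
          _ < 32 * (k * (k * k)) + 16 * (k * k) := by omega
          _ = 2 * ((2 * k + 1) * (2 * k) * (2 * k)) * 2 := by ring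
          _ ≤ 2 ^ k * 2 := by omega
    have := key y (by omega)
    omega

/-- The assumption on σ^4 enters through 4 (λ - 1) < w, which makes the bucket keys, of 3λ + 1 bits,
fit into a word. -/
theorem Bounds.mk' {w σ m : ℕ} (hσ : 3 ≤ σ) (hσw : σ ^ 4 ≤ 2 ^ w) (hm : m + 1 < 2 ^ w)
    (hw : 1000000 ≤ w) : Bounds w σ m := by
  have hl2 := two_le_lam hσ
  have hlam : 4 * lam σ ≤ w + 3 := by
    have h1 := two_pow_pred_lam_lt hσ
    have h2 : (2 ^ (lam σ - 1)) ^ 4 < 2 ^ w :=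
      (Nat.pow_lt_pow_left h1 (by omega)).trans_le hσw
    rw [← pow_mul] at h2
    have := (Nat.pow_lt_pow_iff_right (by omega)).1 h2
    omega
  have hpsi := psi_bounds (p := psi σ) hw (by have := two_pow_psi_le hσ; omega)
  have hmu : m.size ≤ w := Nat.size_le.2 (by omega)
  have hy : 2 ^ m.size.size ≤ 2 * w := by
    rcases Nat.eq_zero_or_pos m.size with h | h
    · rw [h]; simp; omega
    · exact (two_pow_size_le h).trans (by omega)
  have hcube := cube_lt_two_pow hw hy
  set y := m.size.size with hy'
  -- Several chunks per superblock occur only if σ is tiny compared with m; then λ is below the size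
  -- of y, so the chunk counters are narrow and few.
  have hkk : kap σ m = 0 ∨ (2 ^ kap σ m ≤ 2 * y ∧ lam σ ≤ y) := by
    unfold kap
    rw [← hy']
    by_cases h : y.size ≤ lam σ
    · left; omega
    · right
      have hypos : 0 < y := by
        rcases Nat.eq_zero_or_pos y with h0 | h0
        · rw [h0] at h; simp at h
        · exact h0
      have := size_le_self y
      exact ⟨(Nat.pow_le_pow_right (by omega) (Nat.sub_le _ _)).trans (two_pow_size_le hypos),
        by omega⟩
  have hyw : 100 * y + 1000 < w := by
    by_cases hy30 : y ≤ 30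
    · omega
    · have : 61 * 62 * (2 * y) ≤ (2 * y + 1) * (2 * y) * (2 * y) := by gcongr <;> omega
      omega
  have hkap : kap σ m ≤ y := by
    unfold kap
    rw [← hy']
    have := size_le_self y
    omega
  refine ⟨hσ, hm, hw, hlam, hpsi.1, hpsi.2, ?_, ?_, ?_, ?_⟩
  · rcases hkk with h | ⟨h, h'⟩
    · rw [h]; omega
    · have h1 : (2 * lam σ + 1) * 2 ^ kap σ m ≤ (2 * y + 1) * (2 * y) :=
        Nat.mul_le_mul (by omega) h
      have : 0 < 2 * y := by omega
      exact h1.trans_lt ((Nat.le_mul_of_pos_right _ this).trans_lt hcube)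
  · rcases hkk with h | ⟨h, h'⟩
    · rw [h]; simp; omega
    · exact (Nat.mul_le_mul (Nat.mul_le_mul (by omega) h) (by omega)).trans_lt hcube
  · have h1 : (lam σ).size ≤ 2 * psi σ - 1 := by unfold psi; omega
    have h2 : theta σ m = (lam σ).size + y + 3 := rfl
    have := hpsi.1
    omega
  · have h2 : zet σ m = 2 * lam σ + kap σ m + y := rfl
    omega

/-! ### Space -/

/-- The σ counters of g bits at a boundary are charged to the 2^e positions before it. Rounding m /
2^e down is essential: counters at position 0 would cost σ g bits even for short sequences, and they
are all zero. -/
theorem counter_space {σ m B e g k : ℕ} (hσ : σ ≤ 2 ^ B) (hg : 2 ^ B * g ≤ k * 2 ^ e) :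
    σ * (m / 2 ^ e) * g ≤ k * m := by
  calc σ * (m / 2 ^ e) * g ≤ 2 ^ B * (m / 2 ^ e) * g := by gcongr
    _ = 2 ^ B * g * (m / 2 ^ e) := by ring
    _ ≤ k * 2 ^ e * (m / 2 ^ e) := by gcongr
    _ = k * (2 ^ e * (m / 2 ^ e)) := by ring
    _ ≤ k * m := by gcongr; exact Nat.mul_div_le _ _

theorem chunkCounter_space (σ m : ℕ) :
    σ * (m / 2 ^ (2 * lam σ)) * (2 * lam σ + 1) ≤ slotLen σ m := by
  have h := counter_space (m := m) (e := 2 * lam σ) (g := 2 * lam σ + 1) (k := 2)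
    (le_two_pow_lam σ) (by
      have h1 : lam σ < 2 ^ lam σ := Nat.lt_two_pow_self
      rw [two_mul (lam σ), pow_add]
      nlinarith)
  have := one_le_psi σ
  unfold slotLen
  nlinarith

/-- By the choice of `kap`, 2^(λ + κ) exceeds λ + κ as well as `m.size.size`, so the spacing
outweighs both the alphabet and the width of the counters. -/
theorem blockCounter_space (σ m : ℕ) :
    σ * (m / 2 ^ (2 * lam σ + kap σ m)) * (zet σ m + 1) ≤ slotLen σ m := by
  have h := counter_space (m := m) (e := 2 * lam σ + kap σ m) (g := zet σ m + 1) (k := 4)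
    (le_two_pow_lam σ) (by
      have h1 : lam σ + kap σ m < 2 ^ (lam σ + kap σ m) := Nat.lt_two_pow_self
      have h2 : m.size.size < 2 ^ (lam σ + kap σ m) := by
        refine (Nat.lt_size_self _).trans_le (Nat.pow_le_pow_right (by omega) ?_)
        unfold kap
        omega
      have h3 : 2 ^ (2 * lam σ + kap σ m) = 2 ^ lam σ * 2 ^ (lam σ + kap σ m) := by
        rw [← pow_add]; congr 1; omega
      rw [h3]
      have : zet σ m + 1 ≤ 4 * 2 ^ (lam σ + kap σ m) := by unfold zet; omega
      calc _ ≤ 2 ^ lam σ * (4 * 2 ^ (lam σ + kap σ m)) := Nat.mul_le_mul_left _ this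
        _ = _ := by ring)
  have := one_le_psi σ
  unfold slotLen
  nlinarith

/-- The summand `m.size.size` of `zet` multiplies the spacing by more than `m.size`, the width of an
absolute counter. -/
theorem absoluteCounter_space (σ m : ℕ) :
    σ * (m / 2 ^ zet σ m) * m.size ≤ slotLen σ m := by
  have h := counter_space (m := m) (e := zet σ m) (g := m.size) (k := 1)
    (le_two_pow_lam σ) (by
      have h2 : m.size < 2 ^ m.size.size := Nat.lt_size_self _
      have h3 : 2 ^ zet σ m = 2 ^ lam σ * (2 ^ m.size.size * 2 ^ (lam σ + kap σ m)) := by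
        rw [← pow_add, ← pow_add]; congr 1; unfold zet; omega
      rw [h3, one_mul]
      refine Nat.mul_le_mul_left _ (h2.le.trans (Nat.le_mul_of_pos_right _ (by positivity))))
  have := one_le_psi σ
  unfold slotLen
  nlinarith

theorem header_space (σ m : ℕ) : 8 * theta σ m ≤ slotLen σ m := by
  have h1 : (lam σ).size ≤ 2 * psi σ - 1 := by unfold psi; omega
  have h2 := (size_le_self m.size).trans (size_le_self m)
  have h3 := one_le_psi σ
  have h4 : m * 1 ≤ m * psi σ := Nat.mul_le_mul_left _ h3
  have h5 : (m + 1) * (100 * psi σ) = 100 * (m * psi σ) + 100 * psi σ := by ring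
  unfold slotLen theta
  omega

/-- The tables of one chunk take at most 96 λ³ `keyCap` bits, which is within min(2^(2λ), m + 1) by
the choice of the bucket size. The minimum with m + 1 pays for the last, incomplete chunk. -/
theorem table_bits {σ : ℕ} (hσ : 3 ≤ σ) (m : ℕ) :
    (m / 2 ^ (2 * lam σ) + 1) * (2 * lam σ + 1) * tableLen σ m * (2 * lam σ) ≤ 2 * (m + 1) := by
  have hl := two_le_lam hσ
  set l := lam σ with hl'
  set X := 2 ^ (2 * l) with hX
  have h1 : keyCap σ m * 2 ^ (8 * psi σ) ≤ min X (m + 1) := Nat.div_mul_le_self _ _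
  have h2 := lam_cube_le hσ
  rw [← hl'] at h2
  have h3 : (2 * l + 1) * tableLen σ m * (2 * l) ≤ min X (m + 1) := by
    calc (2 * l + 1) * tableLen σ m * (2 * l) ≤ (3 * l) * tableLen σ m * (2 * l) := by
          gcongr; omega
      _ = keyCap σ m * (96 * (l * l * l)) := by unfold tableLen; rw [← hl']; ring
      _ ≤ keyCap σ m * 2 ^ (8 * psi σ) := by gcongr; omega
      _ ≤ _ := h1
  have h4 : (m / X + 1) * min X (m + 1) ≤ 2 * (m + 1) := by
    have e1 : m / X * min X (m + 1) ≤ m / X * X := Nat.mul_le_mul_left _ (min_le_left _ _)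
    have e2 := Nat.div_mul_le_self m X
    have e3 : min X (m + 1) ≤ m + 1 := min_le_right _ _
    rw [add_mul, one_mul]
    omega
  calc (m / X + 1) * (2 * l + 1) * tableLen σ m * (2 * l)
      = (m / X + 1) * ((2 * l + 1) * tableLen σ m * (2 * l)) := by ring
    _ ≤ (m / X + 1) * min X (m + 1) := by gcongr
    _ ≤ 2 * (m + 1) := h4

theorem table_space {σ : ℕ} (hσ : 3 ≤ σ) (m : ℕ) :
    (m / 2 ^ (2 * lam σ) + 1) * (2 * lam σ + 1) * tableLen σ m * (2 * lam σ) ≤ slotLen σ m := by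
  refine (table_bits hσ m).trans ?_
  rw [mul_comm 2]
  exact Nat.mul_le_mul_left _ (by have := one_le_psi σ; omega)

theorem table_entries_le {σ : ℕ} (hσ : 3 ≤ σ) (m : ℕ) :
    (m / 2 ^ (2 * lam σ) + 1) * (2 * lam σ + 1) * tableLen σ m ≤ m + 1 := by
  have h1 := table_bits hσ m
  have h2 := two_le_lam hσ
  have h3 := Nat.mul_le_mul_left
    ((m / 2 ^ (2 * lam σ) + 1) * (2 * lam σ + 1) * tableLen σ m) (show 2 ≤ 2 * lam σ by omega)
  omega

theorem counter_entries_le (σ m e : ℕ) : σ * (m / 2 ^ (2 * lam σ + e)) ≤ m := by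
  have := counter_space (m := m) (e := 2 * lam σ + e) (g := 1) (k := 1) (le_two_pow_lam σ) (by
    rw [mul_one, one_mul]
    exact Nat.pow_le_pow_right (by omega) (by omega))
  omega

/-- From σ ≥ 3 one gets log log σ ≥ 1/2, so the additive constants hidden in ψ are absorbed by the
factor 10. -/
theorem psi_le_logb {σ : ℕ} (hσ : 3 ≤ σ) :
    (psi σ : ℝ) ≤ 10 * Real.logb 2 (Real.logb 2 (σ : ℝ)) := by
  set x := Real.logb 2 (σ : ℝ) with hx
  have h3 : (3 : ℝ) ≤ σ := by exact_mod_cast hσ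
  have hx1 : (3 / 2 : ℝ) ≤ x := by
    rw [hx, Real.le_logb_iff_rpow_le (by norm_num) (by linarith)]
    have : (2 : ℝ) ^ (3 / 2 : ℝ) ≤ 3 := by
      rw [show (3 / 2 : ℝ) = (3 : ℕ) * (1 / 2 : ℝ) by norm_num, Real.rpow_mul (by norm_num),
        Real.rpow_natCast, ← Real.sqrt_eq_rpow, Real.sqrt_le_left (by norm_num)]
      norm_num
    linarith
  have hlam : ((lam σ : ℕ) : ℝ) - 1 ≤ x := by
    have h1 := two_pow_pred_lam_lt hσ
    have h2 := two_le_lam hσ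
    rw [hx, Real.le_logb_iff_rpow_le (by norm_num) (by linarith)]
    have : ((2 : ℝ)) ^ (lam σ - 1 : ℕ) ≤ σ := by exact_mod_cast h1.le
    rw [← Real.rpow_natCast, Nat.cast_sub (by omega)] at this
    simpa using this
  have hpsi : (psi σ : ℝ) ≤ (lam σ).size := by
    have h2 := two_le_lam hσ
    have : 2 ≤ (lam σ).size := Nat.lt_size.2 (by omega)
    exact_mod_cast (show psi σ ≤ (lam σ).size by unfold psi; omega)
  have hsize : ((lam σ).size : ℝ) ≤ 3 + Real.logb 2 x := by
    have h2 := two_le_lam hσ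
    have h4 : ((2 : ℝ)) ^ ((lam σ).size : ℕ) ≤ 2 * lam σ := by
      exact_mod_cast two_pow_size_le (n := lam σ) (by omega)
    have h5 : (2 : ℝ) * lam σ ≤ 2 ^ 3 * x := by nlinarith
    have : ((lam σ).size : ℝ) ≤ Real.logb 2 (2 ^ 3 * x) := by
      rw [Real.le_logb_iff_rpow_le (by norm_num) (by linarith), Real.rpow_natCast]
      exact h4.trans h5
    rwa [Real.logb_mul (by norm_num) (by linarith), Real.logb_pow, Real.logb_self_eq_one
      (by norm_num), mul_one] at this
  have hll : (1 / 2 : ℝ) ≤ Real.logb 2 x := by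
    rw [Real.le_logb_iff_rpow_le (by norm_num) (by linarith), ← Real.sqrt_eq_rpow]
    refine le_trans ?_ hx1
    rw [Real.sqrt_le_left (by norm_num)]
    norm_num
  linarith

/-! ### The dictionaries of the chunks -/

/-- Hint 0 marks a first bucket, and hint j + 1 refers to table j of the chunk. Slot 0 of a table
contains its modulus q, and the key x is sent to slot 1 + x % q. Only the keys assigned to modulus j
are entered into table j. -/
theorem exists_dictionary {σ : ℕ} (hσ : 3 ≤ σ) (m : ℕ) {c : ℕ → ℕ} (hc : ∀ p, c p < 2 ^ lam σ) :
    ∃ hint tab : ℕ → ℕ, (∀ p, hint p ≤ 2 * lam σ + 1) ∧ (∀ g, tab g < 2 ^ (2 * lam σ)) ∧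
      ∀ p ≤ m,
        (bucket c (2 * lam σ) (2 ^ (8 * psi σ)) p = 0 ∧ hint p = 0) ∨
        ∃ j q, j < 2 * lam σ + 1 ∧ hint p = j + 1 ∧
          tab ((p / 2 ^ (2 * lam σ) * (2 * lam σ + 1) + j) * tableLen σ m) = q ∧ 1 ≤ q ∧
          1 + bucketKey c (2 * lam σ) (2 ^ (8 * psi σ)) p % q < tableLen σ m ∧
          tab ((p / 2 ^ (2 * lam σ) * (2 * lam σ + 1) + j) * tableLen σ m +
            (1 + bucketKey c (2 * lam σ) (2 ^ (8 * psi σ)) p % q)) =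
              bucket c (2 * lam σ) (2 ^ (8 * psi σ)) p := by
  classical
  have hl := two_le_lam hσ
  have hpsi := one_le_psi σ
  set l := lam σ with hlam
  set s := 2 ^ (8 * psi σ) with hs
  set J := 2 * l + 1 with hJ
  set R := tableLen σ m with hR
  have hspos : 0 < s := by positivity
  choose q f hq hf hinj using fun k => exists_chunk_moduli hc (2 * l) m k hspos
  have hn : min (2 ^ (2 * l)) (m + 1) / s = keyCap σ m := rfl
  have hRn : R = 16 * l * keyCap σ m := rfl
  clear_value R J s l
  have hns : keyCap σ m * s ≤ 2 ^ (2 * l) := by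
    rw [← hn]
    exact (Nat.div_mul_le_self _ _).trans (min_le_left _ _)
  let hint : ℕ → ℕ := fun p =>
    if p ≤ m ∧ 1 ≤ bucket c (2 * l) s p then
      f (p / 2 ^ (2 * l)) (bucketKey c (2 * l) s p) + 1 else 0
  -- An index g is read as chunk `g / R / J`, table `g / R % J` and slot `g % R`; the relation says
  -- that the key of p belongs to this slot.
  let Q : ℕ → ℕ → Prop := fun g p => p ≤ m ∧ p / 2 ^ (2 * l) = g / R / J ∧
    1 ≤ bucket c (2 * l) s p ∧
    f (g / R / J) (bucketKey c (2 * l) s p) = g / R % J ∧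
    1 + bucketKey c (2 * l) s p % q (g / R / J) (g / R % J) = g % R
  -- In an occupied slot the choice of the position is immaterial, as all candidates share their key
  -- and thus their bucket. The last reduction only makes unused slots fit their width.
  let tab : ℕ → ℕ := fun g =>
    (if g % R = 0 then q (g / R / J) (g / R % J)
      else bucket c (2 * l) s (Classical.epsilon (Q g))) % 2 ^ (2 * l)
  refine ⟨hint, tab, fun p => ?_, fun g => Nat.mod_lt _ (by positivity), fun p hp => ?_⟩
  · simp only [hint]
    split_ifs with h
    · have := hf _ _ (mem_chunkKeys.2 ⟨p, h.1, rfl, h.2, rfl⟩)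
      omega
    · omega
  rcases Nat.eq_zero_or_pos (bucket c (2 * l) s p) with hb | hb
  · left
    refine ⟨hb, ?_⟩
    simp only [hint]
    rw [if_neg (by omega)]
  right
  set k := p / 2 ^ (2 * l) with hk
  set x := bucketKey c (2 * l) s p with hx
  have hmem : x ∈ chunkKeys c (2 * l) s m k := mem_chunkKeys.2 ⟨p, hp, rfl, hb, rfl⟩
  have hn1 : 1 ≤ keyCap σ m := by
    rw [← hn]
    refine (Nat.le_div_iff_mul_le hspos).2 (le_trans ?_ (card_chunkKeys_mul_le c (2 * l) s m k))
    exact Nat.mul_le_mul_right _ (Finset.card_pos.2 ⟨x, hmem⟩)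
  have hjJ := hf k x hmem
  rw [← hJ] at hjJ
  set j := f k x with hj
  clear_value j x k
  have hqq := hq k j
  rw [hn] at hqq
  -- Keys have u = 3λ + 1 bits, and 4 u n + 2 < 16 λ n for λ ≥ 2 and n ≥ 1; here n ≥ 1 because the
  -- key of p itself exists.
  have hqR : q k j < R := by
    rw [hRn]
    nlinarith
  have hqX : q k j < 2 ^ (2 * l) := by
    have h1 : 16 * l ≤ s := by
      have := lam_cube_le hσ
      rw [← hlam, ← hs] at this
      nlinarith
    calc q k j < R := hqR
      _ ≤ s * keyCap σ m := by rw [hRn]; exact Nat.mul_le_mul_right _ h1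
      _ ≤ _ := by rw [mul_comm]; exact hns
  have hmod : x % q k j < q k j := Nat.mod_lt _ (by omega)
  have hdec : ∀ r, r < R → ((k * J + j) * R + r) / R / J = k ∧ ((k * J + j) * R + r) / R % J = j ∧
      ((k * J + j) * R + r) % R = r := by
    intro r hr
    have e1 : ((k * J + j) * R + r) / R = k * J + j := by
      rw [mul_comm, Nat.mul_add_div (by omega), Nat.div_eq_of_lt hr, add_zero]
    rw [e1]
    refine ⟨?_, ?_, ?_⟩
    · rw [mul_comm, Nat.mul_add_div (by omega), Nat.div_eq_of_lt hjJ, add_zero]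
    · rw [mul_comm, Nat.mul_add_mod, Nat.mod_eq_of_lt hjJ]
    · rw [mul_comm, Nat.mul_add_mod, Nat.mod_eq_of_lt hr]
  refine ⟨j, q k j, hjJ, ?_, ?_, hqq.1, by omega, ?_⟩
  · simp only [hint]
    rw [if_pos ⟨hp, hb⟩, ← hk, ← hx, ← hj]
  · obtain ⟨h01, h02, h03⟩ := hdec 0 (by omega)
    rw [add_zero] at h01 h02 h03
    simp only [tab]
    rw [h01, h02, h03, if_pos rfl, Nat.mod_eq_of_lt hqX]
  · obtain ⟨h01, h02, h03⟩ := hdec (1 + x % q k j) (by omega)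
    have hQp : Q ((k * J + j) * R + (1 + x % q k j)) p := by
      refine ⟨hp, ?_, hb, ?_, ?_⟩
      · rw [h01, hk]
      · rw [h01, h02, ← hx, hj]
      · rw [h01, h02, h03, ← hx]
    have hspec := Classical.epsilon_spec ⟨p, hQp⟩
    simp only [tab]
    rw [h03, if_neg (by omega)]
    generalize Classical.epsilon (Q ((k * J + j) * R + (1 + x % q k j))) = p₀ at hspec ⊢
    obtain ⟨g1, g2, g3, g4, g5⟩ := hspec
    rw [h01] at g2
    rw [h01, h02] at g4
    rw [h01, h02, h03] at g5
    have hsame := hinj k _ (mem_chunkKeys.2 ⟨_, g1, g2, g3, rfl⟩) x hmem (by rw [g4, hj])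
      (by rw [g4]; omega)
    have := (bucket_eq_of_key_eq (by rw [g2, hk]) (hsame.trans hx)).2
    rw [this, Nat.mod_eq_of_lt]
    exact (Nat.div_le_self _ _).trans_lt (localRank_lt _ _ _)

/-! ### The sorted keys of a block -/

/-- A modulus for each block of `b` positions that separates the symbols of the block. -/
theorem exists_block_moduli {c : ℕ → ℕ} {B : ℕ} (hc : ∀ p, c p < 2 ^ B) {b : ℕ} (hb : 0 < b) :
    ∃ q : ℕ → ℕ, ∀ k, 1 ≤ q k ∧ q k ≤ 2 * (B * (b * b) + 1) ∧
      ∀ p p', p / b = k → p' / b = k → c p % q k = c p' % q k → c p = c p' := by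
  have : ∀ k, ∃ q, 1 ≤ q ∧ q ≤ 2 * (B * (b * b) + 1) ∧
      ∀ p p', p / b = k → p' / b = k → c p % q = c p' % q → c p = c p' := by
    intro k
    have hcard : ((Finset.Ico (k * b) (k * b + b)).image c).card ≤ b :=
      Finset.card_image_le.trans (by simp)
    have hmem : ∀ p, p / b = k → c p ∈ (Finset.Ico (k * b) (k * b + b)).image c := by
      intro p hp
      refine Finset.mem_image_of_mem _ (Finset.mem_Ico.2 ?_)
      have h1 := Nat.div_add_mod' p b
      have h2 := Nat.mod_lt p hb
      rw [hp] at h1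
      omega
    obtain ⟨q, h1, h2, h3⟩ := exists_perfect_mod
      (S := (Finset.Ico (k * b) (k * b + b)).image c) (u := B) (N := B * (b * b) + 1)
      (fun x hx => by
        obtain ⟨p, _, rfl⟩ := Finset.mem_image.1 hx
        exact hc p)
      (Nat.lt_succ_of_le (Nat.mul_le_mul_left _ (Nat.mul_le_mul hcard hcard)))
    exact ⟨q, h1, h2, fun p p' hp hp' => h3 _ (hmem p hp) _ (hmem p' hp')⟩
  choose q hq using this
  exact ⟨q, hq⟩

/-- The key of position `p` in its block: the remainder of its symbol and its offset. -/
def posKey (c q : ℕ → ℕ) (b p : ℕ) : ℕ := c p % q (p / b) * b + p % b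

/-- `y` is the key of a position of block `k`. -/
def IsKey (c q : ℕ → ℕ) (b m k y : ℕ) : Prop := ∃ p ≤ m, p / b = k ∧ posKey c q b p = y

open Classical in
/-- The number of keys of block `k` that are smaller than `y`. -/
noncomputable def keyRank (c q : ℕ → ℕ) (b m k y : ℕ) : ℕ := Nat.count (IsKey c q b m k) y

/-- The sorted keys of all blocks; block `k` starts at index `k * b`. -/
noncomputable def sortedKey (c q : ℕ → ℕ) (b m g : ℕ) : ℕ := Nat.nth (IsKey c q b m (g / b)) (g % b)

section keys

variable {c q : ℕ → ℕ} {b m k : ℕ}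

theorem posKey_div (hb : 0 < b) (p : ℕ) : posKey c q b p / b = c p % q (p / b) := by
  unfold posKey
  rw [mul_comm, Nat.mul_add_div hb, Nat.div_eq_of_lt (Nat.mod_lt _ hb), add_zero]

theorem posKey_mod (p : ℕ) : posKey c q b p % b = p % b := by
  unfold posKey
  rw [mul_comm, Nat.mul_add_mod, Nat.mod_mod]

theorem posKey_inj {p p' : ℕ} (h : p / b = p' / b) (hk : posKey c q b p = posKey c q b p') :
    p = p' := by
  have h1 := posKey_mod (c := c) (q := q) (b := b) p
  have h2 := posKey_mod (c := c) (q := q) (b := b) p'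
  rw [hk, h2] at h1
  rw [← Nat.div_add_mod p b, ← Nat.div_add_mod p' b, h, h1]

theorem setOf_isKey_eq (hb : 0 < b) : Set.ofPred (IsKey c q b m k) =
    ((Finset.Ico (k * b) (min (k * b + b) (m + 1))).image (posKey c q b) : Finset ℕ) := by
  ext y
  simp only [Set.mem_ofPred_eq, Finset.coe_image, Finset.coe_Ico, Set.mem_image, Set.mem_Ico,
    IsKey]
  constructor
  · rintro ⟨p, hp, hk, rfl⟩
    have h1 := Nat.div_add_mod' p b
    have h2 := Nat.mod_lt p hb
    rw [hk] at h1
    exact ⟨p, by omega, rfl⟩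
  · rintro ⟨p, ⟨h1, h2⟩, rfl⟩
    refine ⟨p, by omega, ?_, rfl⟩
    rw [Nat.div_eq_iff hb]
    omega

theorem finite_isKey (hb : 0 < b) : (Set.ofPred (IsKey c q b m k)).Finite := by
  rw [setOf_isKey_eq hb]
  exact Finset.finite_toSet _

theorem card_isKey (hb : 0 < b) (hf : (Set.ofPred (IsKey c q b m k)).Finite) :
    hf.toFinset.card = min b (m + 1 - k * b) := by
  have : hf.toFinset = (Finset.Ico (k * b) (min (k * b + b) (m + 1))).image (posKey c q b) := by
    rw [← Finset.coe_inj, Set.Finite.coe_toFinset, setOf_isKey_eq hb]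
  rw [this, Finset.card_image_of_injOn, Nat.card_Ico]
  · omega
  · intro p hp p' hp' h
    have hp := Finset.mem_Ico.1 (Finset.mem_coe.1 hp)
    have hp' := Finset.mem_Ico.1 (Finset.mem_coe.1 hp')
    refine posKey_inj ?_ h
    have e₁ : p / b = k := (Nat.div_eq_iff hb).2 (by omega)
    have e₂ : p' / b = k := (Nat.div_eq_iff hb).2 (by omega)
    rw [e₁, e₂]

theorem keyRank_le (hb : 0 < b) (y : ℕ) : keyRank c q b m k y ≤ min b (m + 1 - k * b) := by
  classical
  rw [← card_isKey hb (finite_isKey (c := c) (q := q) hb)]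
  exact Nat.count_le_card _ _

theorem sortedKey_add {r : ℕ} (hr : r < b) :
    sortedKey c q b m (k * b + r) = Nat.nth (IsKey c q b m k) r := by
  unfold sortedKey
  rw [mul_comm, Nat.mul_add_div (by omega), Nat.div_eq_of_lt hr, add_zero, Nat.mul_add_mod,
    Nat.mod_eq_of_lt hr]

/-- Comparing a sampled key with y decides on which side of its index the unknown rank lies; the
search rests on this. -/
theorem sortedKey_lt_iff {r y : ℕ} (hr : r < min b (m + 1 - k * b)) :
    sortedKey c q b m (k * b + r) < y ↔ r < keyRank c q b m k y := by
  classical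
  have hb : 0 < b := by omega
  have hcard : ∀ hf : (Set.ofPred (IsKey c q b m k)).Finite, r < hf.toFinset.card :=
    fun hf => by rw [card_isKey hb]; exact hr
  rw [sortedKey_add (by omega)]
  constructor
  · intro h
    have h1 := Nat.count_strict_mono (Nat.nth_mem r hcard) h
    rwa [Nat.count_nth hcard] at h1
  · exact Nat.nth_lt_of_lt_count

theorem sortedKey_isKey {r : ℕ} (hr : r < min b (m + 1 - k * b)) :
    IsKey c q b m k (sortedKey c q b m (k * b + r)) := by
  have hb : 0 < b := by omega
  rw [sortedKey_add (by omega)]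
  exact Nat.nth_mem r fun hf => by rw [card_isKey hb]; exact hr

theorem sortedKey_keyRank {p : ℕ} (hp : p ≤ m) (hk : p / b = k) (hb : 0 < b) :
    keyRank c q b m k (posKey c q b p) < min b (m + 1 - k * b) ∧
    sortedKey c q b m (k * b + keyRank c q b m k (posKey c q b p)) = posKey c q b p := by
  classical
  have hkey : IsKey c q b m k (posKey c q b p) := ⟨p, hp, hk, rfl⟩
  have h1 : keyRank c q b m k (posKey c q b p) < min b (m + 1 - k * b) := by
    rw [← card_isKey hb (finite_isKey (c := c) (q := q) hb)]
    exact Nat.count_lt_card _ hkey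
  refine ⟨h1, ?_⟩
  rw [sortedKey_add (by omega)]
  exact Nat.nth_count hkey

/-- The successor of `(a, y)` in a block is the first occurrence of `a` at offset at least `y`. -/
theorem sortedKey_succ (hb : 0 < b)
    (hq : ∀ p p', p / b = k → p' / b = k → c p % q k = c p' % q k → c p = c p')
    {p y : ℕ} (hp : p ≤ m) (hk : p / b = k) (hy : y ≤ p % b)
    (hmin : ∀ p' < p, p' / b = k → c p' = c p → p' % b < y) :
    keyRank c q b m k (c p % q k * b + y) < min b (m + 1 - k * b) ∧
    sortedKey c q b m (k * b + keyRank c q b m k (c p % q k * b + y)) % b = p % b := by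
  classical
  have h0 : posKey c q b p = c p % q k * b + p % b := by unfold posKey; rw [hk]
  have h1 : keyRank c q b m k (c p % q k * b + y) = keyRank c q b m k (posKey c q b p) := by
    -- A key counted in between would have the remainder of the symbol of p, hence the same symbol,
    -- and an offset from y up to that of p. This contradicts `hmin`.
    refine le_antisymm (Nat.count_monotone _ (by omega)) (not_lt.1 fun hlt => ?_)
    obtain ⟨x, hx, p', hp', hk', rfl⟩ := Nat.exists_of_count_lt_count hlt
    rw [h0, Set.mem_Ico] at hx
    have e0 : posKey c q b p' = c p' % q k * b + p' % b := by unfold posKey; rw [hk']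
    have l1 := Nat.mod_lt p hb
    have l2 := Nat.mod_lt p' hb
    have e1 : c p' % q k = c p % q k := by
      have d1 := Nat.div_le_div_right (c := b) hx.1
      have d2 := Nat.div_le_div_right (c := b) hx.2.le
      rw [posKey_div hb, hk', mul_comm, Nat.mul_add_div hb] at d1
      rw [posKey_div hb, hk', mul_comm, Nat.mul_add_div hb, Nat.div_eq_of_lt l1] at d2
      exact le_antisymm d2 ((Nat.le_add_right _ _).trans d1)
    have e2 := hq p' p hk' hk e1
    rw [e0, e1] at hx
    have := hmin p' (by
      rw [← Nat.div_add_mod p b, ← Nat.div_add_mod p' b, hk, hk']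
      omega) hk' e2
    omega
  rw [h1]
  obtain ⟨g1, g2⟩ := sortedKey_keyRank (c := c) (q := q) hp hk hb
  exact ⟨g1, by rw [g2, posKey_mod]⟩

/-- The predecessor of `(a, y)` in a block is the last occurrence of `a` at offset less
than `y`. -/
theorem sortedKey_pred (hb : 0 < b)
    (hq : ∀ p p', p / b = k → p' / b = k → c p % q k = c p' % q k → c p = c p')
    {p y : ℕ} (hp : p ≤ m) (hk : p / b = k) (hy : p % b < y) (hyb : y ≤ b)
    (hmax : ∀ p', p < p' → p' ≤ m → p' / b = k → c p' = c p → y ≤ p' % b) :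
    1 ≤ keyRank c q b m k (c p % q k * b + y) ∧
    sortedKey c q b m (k * b + (keyRank c q b m k (c p % q k * b + y) - 1)) % b = p % b := by
  classical
  have h0 : posKey c q b p = c p % q k * b + p % b := by unfold posKey; rw [hk]
  have hkey : IsKey c q b m k (posKey c q b p) := ⟨p, hp, hk, rfl⟩
  have h2 : keyRank c q b m k (posKey c q b p + 1) = keyRank c q b m k (posKey c q b p) + 1 := by
    unfold keyRank
    rw [Nat.count_succ, if_pos hkey]
  have h1 : keyRank c q b m k (c p % q k * b + y) = keyRank c q b m k (posKey c q b p + 1) := by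
    refine le_antisymm (not_lt.1 fun hlt => ?_) (Nat.count_monotone _ (by omega))
    obtain ⟨x, hx, p', hp', hk', rfl⟩ := Nat.exists_of_count_lt_count hlt
    rw [h0, Set.mem_Ico] at hx
    have e0 : posKey c q b p' = c p' % q k * b + p' % b := by unfold posKey; rw [hk']
    have l1 := Nat.mod_lt p hb
    have l2 := Nat.mod_lt p' hb
    have e1 : c p' % q k = c p % q k := by
      have d1 := Nat.div_le_div_right (c := b) hx.1
      have d2 : posKey c q b p' / b < c p % q k + 1 := by
        rw [Nat.div_lt_iff_lt_mul hb, add_mul]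
        omega
      rw [posKey_div hb, hk', mul_comm, add_assoc, Nat.mul_add_div hb] at d1
      rw [posKey_div hb, hk'] at d2
      exact le_antisymm (Nat.le_of_lt_succ d2) ((Nat.le_add_right _ _).trans d1)
    have e2 := hq p' p hk' hk e1
    rw [e0, e1] at hx
    have := hmax p' (by
      rw [← Nat.div_add_mod p b, ← Nat.div_add_mod p' b, hk, hk']
      omega) hp' hk' e2
    omega
  rw [h1, h2]
  obtain ⟨g1, g2⟩ := sortedKey_keyRank (c := c) (q := q) hp hk hb
  exact ⟨by omega, by rw [Nat.add_sub_cancel, g2, posKey_mod]⟩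

theorem sortedKey_lt (hq : ∀ k, 1 ≤ q k) {r Q : ℕ} (hQ : q k ≤ Q)
    (hr : r < min b (m + 1 - k * b)) : sortedKey c q b m (k * b + r) < Q * b := by
  obtain ⟨p, hp, hk, he⟩ := sortedKey_isKey (c := c) (q := q) hr
  rw [← he]
  unfold posKey
  rw [hk]
  have h1 := Nat.mod_lt (c p) (hq k)
  have h2 := Nat.mod_lt p (show 0 < b by omega)
  calc c p % q k * b + p % b < (c p % q k + 1) * b := by rw [add_mul]; omega
    _ ≤ Q * b := Nat.mul_le_mul_right _ (by omega)

end keys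

/-! ### The data structure -/

/-- The width of the entries of the arrays. -/
def width (σ m t : ℕ) : ℕ :=
  [theta σ m, 8 * psi σ, 8 * psi σ, 8 * psi σ, 20 * psi σ, 20 * psi σ, 20 * psi σ, 20 * psi σ,
    20 * psi σ, 2 * lam σ, m.size, zet σ m + 1, 2 * lam σ + 1].getD t 0

/-- The parameters that are stored in the header. -/
def header (σ m k : ℕ) : ℕ :=
  [2 ^ theta σ m - 1, 2 * theta σ m, lam σ, psi σ, m.size, kap σ m, zet σ m].getD k 0

/-- The field of `n` consecutive entries of array `t`, starting with entry `h`. -/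
def entries (σ m : ℕ) (D : List Bool) (t h n : ℕ) : ℕ :=
  field D (slotLen σ m * t + h * width σ m t) (width σ m t * n)

/-- The entry `h` of array `t`. -/
def entry (σ m : ℕ) (D : List Bool) (t h : ℕ) : ℕ :=
  field D (slotLen σ m * t + h * width σ m t) (width σ m t)

/-- The contents of the data structure for the sequence `c`. -/
structure Stored (σ m : ℕ) (c q : ℕ → ℕ) (D : List Bool) : Prop where
  hdr : ∀ k < 7, entry σ m D 0 k = header σ m k
  lev : ∀ p ≤ m, entry σ m D 1 p = level c (2 * lam σ) (2 ^ (8 * psi σ)) p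
  inb : ∀ p ≤ m, entry σ m D 3 p = localRank c (2 * lam σ) p % 2 ^ (8 * psi σ)
  dict : ∀ p ≤ m,
    (bucket c (2 * lam σ) (2 ^ (8 * psi σ)) p = 0 ∧ entry σ m D 2 p = 0) ∨
    ∃ j q, j < 2 * lam σ + 1 ∧ entry σ m D 2 p = j + 1 ∧
      entry σ m D 9 ((p / 2 ^ (2 * lam σ) * (2 * lam σ + 1) + j) * tableLen σ m) = q ∧ 1 ≤ q ∧
      1 + bucketKey c (2 * lam σ) (2 ^ (8 * psi σ)) p % q < tableLen σ m ∧
      entry σ m D 9 ((p / 2 ^ (2 * lam σ) * (2 * lam σ + 1) + j) * tableLen σ m +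
        (1 + bucketKey c (2 * lam σ) (2 ^ (8 * psi σ)) p % q)) =
          bucket c (2 * lam σ) (2 ^ (8 * psi σ)) p
  sig : ∀ k ≤ m, entry σ m D 4 k = q k
  keys : ∀ l < 4, ∀ h n, (∀ i < n, (h + i) * (2 ^ psi σ) ^ l ≤ m) →
    entries σ m D (5 + l) h n = pack (20 * psi σ) n
      (fun i => sortedKey c q (2 ^ (4 * psi σ)) m ((h + i) * (2 ^ psi σ) ^ l))
  absolute : ∀ a < σ, ∀ k < m / 2 ^ zet σ m,
    entry σ m D 10 (a * (m / 2 ^ zet σ m) + k) = cnt c a ((k + 1) * 2 ^ zet σ m)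
  block : ∀ a < σ, ∀ k < m / 2 ^ (2 * lam σ + kap σ m),
    entry σ m D 11 (a * (m / 2 ^ (2 * lam σ + kap σ m)) + k) =
      cnt c a ((k + 1) * 2 ^ (2 * lam σ + kap σ m)) -
        cnt c a ((k + 1) * 2 ^ (2 * lam σ + kap σ m) / 2 ^ zet σ m * 2 ^ zet σ m)
  chunk : ∀ a < σ, ∀ k n, k + n ≤ m / 2 ^ (2 * lam σ) →
    entries σ m D 12 (a * (m / 2 ^ (2 * lam σ)) + k) n = pack (2 * lam σ + 1) n
      (fun i => cnt c a ((k + i + 1) * 2 ^ (2 * lam σ)) - cnt c a ((k + i) * 2 ^ (2 * lam σ)))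
  q_pos : ∀ k, 1 ≤ q k
  q_le : ∀ k, q k * 2 ^ (4 * psi σ) < 2 ^ (20 * psi σ - 1)
  q_inj : ∀ k p p', p / 2 ^ (4 * psi σ) = k → p' / 2 ^ (4 * psi σ) = k →
    c p % q k = c p' % q k → c p = c p'

theorem cnt_sub_le (c : ℕ → ℕ) (a : ℕ) {p q : ℕ} (h : p ≤ q) :
    cnt c a q - cnt c a p ≤ q - p := by
  have := cnt_add_le c a p (q - p)
  rw [Nat.add_sub_cancel' h] at this
  omega

theorem header_lt {w σ m k : ℕ} (h : Bounds w σ m) : header σ m k < 2 ^ theta σ m := by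
  have h1 : (lam σ).size + 3 ≤ theta σ m := by unfold theta; omega
  have h2 : m.size.size + 3 ≤ theta σ m := by unfold theta; omega
  have e1 : 8 * 2 ^ (lam σ).size ≤ 2 ^ theta σ m := by
    rw [show 8 * 2 ^ (lam σ).size = 2 ^ ((lam σ).size + 3) by rw [pow_add]; ring]
    exact Nat.pow_le_pow_right (by omega) h1
  have e2 : 8 * 2 ^ m.size.size ≤ 2 ^ theta σ m := by
    rw [show 8 * 2 ^ m.size.size = 2 ^ (m.size.size + 3) by rw [pow_add]; ring]
    exact Nat.pow_le_pow_right (by omega) h2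
  have l1 : lam σ < 2 ^ (lam σ).size := Nat.lt_size_self _
  have l2 : m.size < 2 ^ m.size.size := Nat.lt_size_self _
  have l3 := size_le_self (lam σ)
  have l4 := size_le_self m.size
  have l5 := size_le_self m.size.size
  have hz : zet σ m = 2 * lam σ + kap σ m + m.size.size := rfl
  have hk : kap σ m ≤ m.size.size.size := Nat.sub_le _ _
  have hp : psi σ = (lam σ).size / 2 + 1 := rfl
  have ht : theta σ m = (lam σ).size + m.size.size + 3 := rfl
  have hpos := Nat.one_le_two_pow (n := theta σ m)
  have hll := two_le_lam h.hσ
  rcases k with _ | _ | _ | _ | _ | _ | _ | k <;> simp [header] <;> omega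

/-- All 13 arrays get slots of the same length, although some are much shorter. The slot addresses
are thus multiples of (m + 1) ψ and need no table of their own. -/
theorem exists_stored {w σ m : ℕ} (hB : Bounds w σ m) {c : ℕ → ℕ} (hc : ∀ p, c p < 2 ^ lam σ) :
    ∃ q D, D.length = 13 * slotLen σ m ∧ Stored σ m c q D := by
  obtain ⟨hint, tab, hhint, htab, hdict⟩ := exists_dictionary hB.hσ m hc
  have hb : 0 < 2 ^ (4 * psi σ) := by positivity
  obtain ⟨q, hq⟩ := exists_block_moduli hc hb
  have hpsi := one_le_psi σ
  have hl2 := two_le_lam hB.hσ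
  have hlam := two_mul_lam_lt σ
  -- The block moduli have at most 10ψ + 2 bits and the offsets 4ψ bits, so a key leaves the top bit
  -- of its 20ψ-bit field free, as parallel comparison requires.
  have hq_le : ∀ k, q k * 2 ^ (4 * psi σ) < 2 ^ (20 * psi σ - 1) := by
    intro k
    have h1 : q k ≤ 2 ^ (10 * psi σ + 1) := by
      refine (hq k).2.1.trans ?_
      rw [show 10 * psi σ + 1 = 2 * psi σ + (4 * psi σ + 4 * psi σ) + 1 by omega, pow_add _ _ 1,
        pow_add _ (2 * psi σ), pow_add]
      have : 0 < 2 ^ (4 * psi σ) * 2 ^ (4 * psi σ) := by positivity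
      nlinarith
    calc q k * 2 ^ (4 * psi σ) ≤ 2 ^ (10 * psi σ + 1) * 2 ^ (4 * psi σ) :=
          Nat.mul_le_mul_right _ h1
      _ = 2 ^ (14 * psi σ + 1) := by rw [← pow_add]; congr 1; omega
      _ < _ := Nat.pow_lt_pow_right (by omega) (by omega)
  let s := 2 ^ (8 * psi σ)
  let L := 2 * lam σ
  let n₁ := m / 2 ^ zet σ m
  let n₂ := m / 2 ^ (2 * lam σ + kap σ m)
  let n₃ := m / 2 ^ (2 * lam σ)
  let Y := sortedKey c q (2 ^ (4 * psi σ)) m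
  -- Entry g of a counter array belongs to the symbol g / n. In the first two counter arrays it
  -- describes boundary number g % n + 1, the boundary 0 being omitted; in the last one it describes
  -- the chunk g % n.
  let v : ℕ → ℕ → ℕ := fun t => [header σ m, level c L s, hint, fun p => localRank c L p % s, q,
    fun h => Y (h * (2 ^ psi σ) ^ 0), fun h => Y (h * (2 ^ psi σ) ^ 1),
    fun h => Y (h * (2 ^ psi σ) ^ 2), fun h => Y (h * (2 ^ psi σ) ^ 3), tab,
    fun g => cnt c (g / n₁) ((g % n₁ + 1) * 2 ^ zet σ m),
    fun g => cnt c (g / n₂) ((g % n₂ + 1) * 2 ^ (2 * lam σ + kap σ m)) -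
      cnt c (g / n₂) ((g % n₂ + 1) * 2 ^ (2 * lam σ + kap σ m) / 2 ^ zet σ m * 2 ^ zet σ m),
    fun g => cnt c (g / n₃) ((g % n₃ + 1) * 2 ^ (2 * lam σ)) -
      cnt c (g / n₃) ((g % n₃) * 2 ^ (2 * lam σ))].getD t (fun _ => 0)
  have hread : ∀ t h, t < 13 → 0 < width σ m t → v t h < 2 ^ width σ m t →
      (h + 1) * width σ m t ≤ slotLen σ m →
      entry σ m (layout 13 (slotLen σ m) (width σ m) v) t h = v t h :=
    fun t h h1 h2 h3 h4 => field_layout_single h1 h2 h3 h4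
  have hpos : ∀ {p g : ℕ}, p ≤ m → g ≤ 100 * psi σ → (p + 1) * g ≤ slotLen σ m := by
    intro p g hp hg
    exact Nat.mul_le_mul (by omega) hg
  have hdec : ∀ {n a k : ℕ}, k < n → (a * n + k) / n = a ∧ (a * n + k) % n = k := by
    intro n a k hk
    constructor
    · rw [mul_comm, Nat.mul_add_div (by omega), Nat.div_eq_of_lt hk, add_zero]
    · rw [mul_comm, Nat.mul_add_mod, Nat.mod_eq_of_lt hk]
  have hidx : ∀ {n a k l : ℕ}, a < σ → k + l ≤ n → a * n + k + l ≤ σ * n := by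
    intro n a k l ha hk
    have : (a + 1) * n ≤ σ * n := Nat.mul_le_mul_right _ ha
    rw [add_mul] at this
    omega
  have hYlt : ∀ g ≤ m, Y g < 2 ^ (20 * psi σ - 1) := by
    intro g hg
    have h1 := Nat.div_add_mod' g (2 ^ (4 * psi σ))
    have h2 := Nat.mod_lt g hb
    have := sortedKey_lt (c := c) (q := q) (b := 2 ^ (4 * psi σ)) (m := m)
      (k := g / 2 ^ (4 * psi σ)) (r := g % 2 ^ (4 * psi σ)) (fun k => (hq k).1) le_rfl (by omega)
    rw [h1] at this
    exact this.trans (hq_le _)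
  have htabR : ∀ k j r, k ≤ m / 2 ^ (2 * lam σ) → j < 2 * lam σ + 1 → r < tableLen σ m →
      entry σ m (layout 13 (slotLen σ m) (width σ m) v) 9
        ((k * (2 * lam σ + 1) + j) * tableLen σ m + r) =
          tab ((k * (2 * lam σ + 1) + j) * tableLen σ m + r) := by
    intro k j r hk hj hr
    refine hread 9 _ (by omega) (show 0 < 2 * lam σ by omega) (htab _) ?_
    refine le_trans (Nat.mul_le_mul_right _ ?_) (table_space hB.hσ m)
    have e1 : k * (2 * lam σ + 1) + j + 1 ≤ (m / 2 ^ (2 * lam σ) + 1) * (2 * lam σ + 1) := by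
      have := Nat.mul_le_mul_right (2 * lam σ + 1) hk
      rw [add_mul (m / 2 ^ (2 * lam σ))]
      omega
    have := Nat.mul_le_mul_right (tableLen σ m) e1
    rw [add_mul (k * (2 * lam σ + 1) + j)] at this
    omega
  refine ⟨q, layout 13 (slotLen σ m) (width σ m) v, length_layout _ _ _ _, ?_⟩
  have hent2 : ∀ p ≤ m, entry σ m (layout 13 (slotLen σ m) (width σ m) v) 2 p = hint p := by
    intro p hp
    refine hread 2 p (by omega) (show 0 < 8 * psi σ by omega) ?_ (hpos hp
      (show 8 * psi σ ≤ _ by omega))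
    refine (hhint p).trans_lt ((Nat.succ_le_of_lt hlam).trans_lt ?_)
    exact Nat.pow_lt_pow_right (by omega) (show 2 * psi σ < 8 * psi σ by omega)
  refine ⟨?_, ?_, ?_, ?_, ?_, ?_, ?_, ?_, ?_, fun k => (hq k).1, hq_le, fun k => (hq k).2.2⟩
  · intro k hk
    refine hread 0 k (by omega) (show 0 < theta σ m by unfold theta; omega) (header_lt hB) ?_
    exact (Nat.mul_le_mul_right _ (by omega)).trans (header_space σ m)
  · intro p hp
    refine hread 1 p (by omega) (show 0 < 8 * psi σ by omega) ?_ (hpos hp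
      (show 8 * psi σ ≤ _ by omega))
    refine (level_le _ _ _ p).trans_lt (hlam.trans ?_)
    exact Nat.pow_lt_pow_right (by omega) (show 2 * psi σ < 8 * psi σ by omega)
  · intro p hp
    exact hread 3 p (by omega) (show 0 < 8 * psi σ by omega) (Nat.mod_lt _ (by positivity))
      (hpos hp (show 8 * psi σ ≤ _ by omega))
  · intro p hp
    have hk : p / 2 ^ (2 * lam σ) ≤ m / 2 ^ (2 * lam σ) := Nat.div_le_div_right hp
    rcases hdict p hp with ⟨h1, h2⟩ | ⟨j, qq, h1, h2, h3, h4, h5, h6⟩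
    · exact Or.inl ⟨h1, by rw [hent2 p hp, h2]⟩
    · refine Or.inr ⟨j, qq, h1, by rw [hent2 p hp, h2], ?_, h4, h5, ?_⟩
      · have := htabR _ j 0 hk h1 (by omega)
        rw [add_zero] at this
        rw [this, h3]
      · rw [htabR _ j _ hk h1 h5, h6]
  · intro k hk
    refine hread 4 k (by omega) (show 0 < 20 * psi σ by omega) ?_ (hpos hk
      (show 20 * psi σ ≤ _ by omega))
    calc q k ≤ q k * 2 ^ (4 * psi σ) := Nat.le_mul_of_pos_right _ hb
      _ < 2 ^ (20 * psi σ - 1) := hq_le k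
      _ ≤ 2 ^ (20 * psi σ) := Nat.pow_le_pow_right (by omega) (by omega)
  · intro l hl h n hn
    have hw : width σ m (5 + l) = 20 * psi σ := by interval_cases l <;> rfl
    have hv : ∀ h, v (5 + l) h = Y (h * (2 ^ psi σ) ^ l) := by
      intro h; interval_cases l <;> rfl
    rcases Nat.eq_zero_or_pos n with rfl | hn0
    · simp [entries, field, pack]
    have := field_layout (T := 13) (M := slotLen σ m) (t := 5 + l) (h := h) (k := n)
      (f := width σ m) (v := v) (by omega) (by omega) (fun i hi => by
        rw [hv, hw]
        exact (hYlt _ (hn i hi)).trans_le (Nat.pow_le_pow_right (by omega) (by omega))) (by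
        rw [hw]
        refine (Nat.mul_le_mul_right _ (?_ : h + n ≤ (h + (n - 1)) + 1)).trans (hpos ?_ (by omega))
        · omega
        · exact (Nat.le_mul_of_pos_right _ (by positivity)).trans (hn (n - 1) (by omega)))
    rw [entries, this, hw]
    exact pack_congr fun i _ => hv _
  · intro a ha k hk
    have hm0 : 0 < m := by
      rcases Nat.eq_zero_or_pos m with rfl | h
      · simp at hk
      · exact h
    have hd := hdec (a := a) hk
    have hval : v 10 (a * (m / 2 ^ zet σ m) + k) = cnt c a ((k + 1) * 2 ^ zet σ m) := by
      change cnt c ((a * (m / 2 ^ zet σ m) + k) / (m / 2 ^ zet σ m))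
        (((a * (m / 2 ^ zet σ m) + k) % (m / 2 ^ zet σ m) + 1) * 2 ^ zet σ m) = _
      rw [hd.1, hd.2]
    rw [← hval]
    refine hread 10 _ (by omega) (show 0 < m.size from Nat.size_pos.2 hm0) ?_ ?_
    · rw [hval]
      have h1 : cnt c a ((k + 1) * 2 ^ zet σ m) ≤ (k + 1) * 2 ^ zet σ m := Nat.count_le _
      have h2 : (k + 1) * 2 ^ zet σ m ≤ m / 2 ^ zet σ m * 2 ^ zet σ m :=
        Nat.mul_le_mul_right _ hk
      have h3 := Nat.div_mul_le_self m (2 ^ zet σ m)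
      exact (h1.trans (h2.trans h3)).trans_lt (Nat.lt_size_self m)
    · exact (Nat.mul_le_mul_right _ (hidx ha hk)).trans (absoluteCounter_space σ m)
  · intro a ha k hk
    have hd := hdec (a := a) hk
    have hval : v 11 (a * (m / 2 ^ (2 * lam σ + kap σ m)) + k) =
        cnt c a ((k + 1) * 2 ^ (2 * lam σ + kap σ m)) -
          cnt c a ((k + 1) * 2 ^ (2 * lam σ + kap σ m) / 2 ^ zet σ m * 2 ^ zet σ m) := by
      change cnt c ((a * n₂ + k) / n₂) (((a * n₂ + k) % n₂ + 1) * 2 ^ (2 * lam σ + kap σ m)) -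
        cnt c ((a * n₂ + k) / n₂) (((a * n₂ + k) % n₂ + 1) * 2 ^ (2 * lam σ + kap σ m) /
          2 ^ zet σ m * 2 ^ zet σ m) = _
      rw [hd.1, hd.2]
    rw [← hval]
    refine hread 11 _ (by omega) (show 0 < zet σ m + 1 by omega) ?_ ?_
    · rw [hval]
      refine (cnt_sub_le c a (Nat.div_mul_le_self _ _)).trans_lt ?_
      have h1 := Nat.div_add_mod' ((k + 1) * 2 ^ (2 * lam σ + kap σ m)) (2 ^ zet σ m)
      have h2 := Nat.mod_lt ((k + 1) * 2 ^ (2 * lam σ + kap σ m)) (Nat.two_pow_pos (zet σ m))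
      have h3 : 2 ^ zet σ m ≤ 2 ^ width σ m 11 :=
        Nat.pow_le_pow_right (by omega) (show zet σ m ≤ zet σ m + 1 by omega)
      omega
    · exact (Nat.mul_le_mul_right _ (hidx ha hk)).trans (blockCounter_space σ m)
  · intro a ha k n hn
    have hval : ∀ i < n, v 12 (a * (m / 2 ^ (2 * lam σ)) + k + i) =
        cnt c a ((k + i + 1) * 2 ^ (2 * lam σ)) - cnt c a ((k + i) * 2 ^ (2 * lam σ)) := by
      intro i hi
      have hd := hdec (a := a) (show k + i < m / 2 ^ (2 * lam σ) by omega)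
      rw [← add_assoc] at hd
      change cnt c ((a * n₃ + k + i) / n₃) (((a * n₃ + k + i) % n₃ + 1) * 2 ^ (2 * lam σ)) -
        cnt c ((a * n₃ + k + i) / n₃) (((a * n₃ + k + i) % n₃) * 2 ^ (2 * lam σ)) = _
      rw [hd.1, hd.2]
    have := field_layout (T := 13) (M := slotLen σ m) (t := 12)
      (h := a * (m / 2 ^ (2 * lam σ)) + k) (k := n)
      (f := width σ m) (v := v) (by omega) (show 0 < 2 * lam σ + 1 by omega) (fun i hi => by
        rw [hval i hi]
        refine (cnt_sub_le c a (Nat.mul_le_mul_right _ (by omega))).trans_lt ?_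
        rw [← Nat.sub_mul, Nat.add_sub_cancel_left, one_mul]
        exact Nat.pow_lt_pow_right (by omega) (show 2 * lam σ < 2 * lam σ + 1 by omega)) (by
        exact (Nat.mul_le_mul_right _ (hidx ha hn)).trans (chunkCounter_space σ m))
    rw [entries, this]
    exact pack_congr hval

/-! ### Reading the data structure -/

/-- A small interval query on a sequence with its data structure. -/
structure Valid (x : Query) : Prop where
  bounds : Bounds x.w x.σ x.m
  stored : ∃ q, Stored x.σ x.m (symbolAt x.C) q x.D
  a_lt : x.a < x.σ
  i_le : x.i ≤ x.j
  j_le : x.j ≤ x.m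
  gap : x.j - x.i ≤ 2 * (lam x.σ * lam x.σ)

theorem field_div_mod {D : List Bool} {o len w : ℕ} (h : o + len ≤ w) :
    field D 0 w / 2 ^ o % 2 ^ len = field D o len := by
  apply Nat.eq_of_testBit_eq
  intro e
  rw [Nat.testBit_mod_two_pow, Nat.testBit_div_two_pow, testBit_field, testBit_field, zero_add,
    add_comm e o]
  by_cases he : e < len
  · simp [he, show o + e < w by omega]
  · simp [he]

theorem width_le {w σ m : ℕ} (h : Bounds w σ m) (t : ℕ) : width σ m t ≤ w := by
  have h1 := h.psi_lt
  have h2 := h.lam_le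
  have h3 := h.hw
  have h4 : m.size ≤ w := Nat.size_le.2 (by have := h.hm; omega)
  have h5 := h.theta_lt
  have h6 := h.zet_lt
  rcases t with _ | _ | _ | _ | _ | _ | _ | _ | _ | _ | _ | _ | _ | t <;> simp [width] <;> omega

/-! ### Recovering the parameters from the header and addressing entries -/

section params

variable {A : Query → Prop}

theorem Comp.num (hA : ∀ x, A x → Valid x) {n : ℕ} (hn : n < 1000000) : Comp A (fun _ => n) :=
  Comp.const n fun x hx => by
    have h1 := (hA x hx).bounds.hw
    have h2 := Nat.lt_two_pow_self (n := x.w)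
    omega

/-- The entry width θ of the header must be found before anything else can be read. The first word
begins with θ ones followed by the even number 2θ, so the run of ones has length exactly θ. The
exclusive or of the word with its successor is 2^(θ + 1) - 1, which yields 2^θ; dividing by 2^θ
exposes the second entry. -/
theorem Comp.theta (hA : ∀ x, A x → Valid x) : Comp A (fun x => theta x.σ x.m) := by
  have hlt : ∀ x, A x → 2 * WordRAM.theta x.σ x.m + 1 < x.w := fun x hx =>
    (hA x hx).bounds.theta_lt
  have h0 : Comp A (fun x => WordRAM.field x.D 0 x.w) :=
    (Comp.num hA (n := 0) (by norm_num)).load.congr fun x _ => by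
      rw [memWord_eq_field, zero_mul]
  have hfirst : ∀ x, A x → WordRAM.field x.D 0 x.w % 2 ^ WordRAM.theta x.σ x.m =
      2 ^ WordRAM.theta x.σ x.m - 1 := by
    intro x hx
    obtain ⟨q, hq⟩ := (hA x hx).stored
    have h1 := hq.hdr 0 (by omega)
    have h2 := hlt x hx
    have h3 := field_div_mod (D := x.D) (o := 0) (len := WordRAM.theta x.σ x.m) (w := x.w)
      (by omega)
    rw [pow_zero, Nat.div_one] at h3
    rw [h3]
    simpa [entry, width, header] using h1
  have hsecond : ∀ x, A x → WordRAM.field x.D 0 x.w / 2 ^ WordRAM.theta x.σ x.m %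
      2 ^ WordRAM.theta x.σ x.m = 2 * WordRAM.theta x.σ x.m := by
    intro x hx
    obtain ⟨q, hq⟩ := (hA x hx).stored
    have h1 := hq.hdr 1 (by omega)
    have h2 := hlt x hx
    rw [field_div_mod (by omega)]
    simpa [entry, width, header] using h1
  have hform : ∀ x, A x → ∃ y, WordRAM.field x.D 0 x.w =
      2 ^ (WordRAM.theta x.σ x.m + 1) * y + (2 ^ WordRAM.theta x.σ x.m - 1) := by
    intro x hx
    have h1 := Nat.div_add_mod (WordRAM.field x.D 0 x.w) (2 ^ WordRAM.theta x.σ x.m)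
    have h2 := Nat.div_add_mod (WordRAM.field x.D 0 x.w / 2 ^ WordRAM.theta x.σ x.m)
      (2 ^ WordRAM.theta x.σ x.m)
    rw [hsecond x hx] at h2
    rw [hfirst x hx] at h1
    have hpos : WordRAM.theta x.σ x.m = WordRAM.theta x.σ x.m - 1 + 1 := by
      have : 3 ≤ WordRAM.theta x.σ x.m := by unfold WordRAM.theta; omega
      omega
    have h3 : 2 ^ WordRAM.theta x.σ x.m = 2 * 2 ^ (WordRAM.theta x.σ x.m - 1) := by
      conv_lhs => rw [hpos, pow_succ, mul_comm]
    refine ⟨2 ^ (WordRAM.theta x.σ x.m - 1) * (WordRAM.field x.D 0 x.w /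
      2 ^ WordRAM.theta x.σ x.m / 2 ^ WordRAM.theta x.σ x.m) + WordRAM.theta x.σ x.m, ?_⟩
    have h4 : WordRAM.field x.D 0 x.w / 2 ^ WordRAM.theta x.σ x.m =
        2 * (2 ^ (WordRAM.theta x.σ x.m - 1) * (WordRAM.field x.D 0 x.w /
      2 ^ WordRAM.theta x.σ x.m / 2 ^ WordRAM.theta x.σ x.m) + WordRAM.theta x.σ x.m) := by
      rw [mul_add, ← mul_assoc, ← h3]
      exact h2.symm
    rw [pow_succ, mul_assoc, ← h4]
    exact h1.symm
  -- The successor does not overflow, since the zero bit after the run of ones shows that the word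
  -- is not all ones.
  have hbound : ∀ x, A x → WordRAM.field x.D 0 x.w + 1 < 2 ^ x.w := by
    intro x hx
    obtain ⟨y, hy⟩ := hform x hx
    have h1 := field_lt x.D 0 x.w
    have h2 := hlt x hx
    have h3 := Nat.one_lt_two_pow (n := WordRAM.theta x.σ x.m) (by unfold WordRAM.theta; omega)
    rw [show x.w = WordRAM.theta x.σ x.m + 1 + (x.w - WordRAM.theta x.σ x.m - 1) by omega,
      pow_add] at h1 ⊢
    rw [← show x.w = WordRAM.theta x.σ x.m + 1 + (x.w - WordRAM.theta x.σ x.m - 1) by omega,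
      hy] at h1 ⊢
    have h4 : y < 2 ^ (x.w - WordRAM.theta x.σ x.m - 1) := by
      by_contra h
      push Not at h
      have := Nat.mul_le_mul_left (2 ^ (WordRAM.theta x.σ x.m + 1)) h
      omega
    have h5 := Nat.mul_le_mul_left (2 ^ (WordRAM.theta x.σ x.m + 1)) (Nat.succ_le_of_lt h4)
    rw [Nat.mul_succ] at h5
    rw [pow_succ] at h5 ⊢
    omega
  have h1 : Comp A (fun _ => 1) := Comp.num hA (by norm_num)
  have hxor : Comp A (fun x => 2 ^ (WordRAM.theta x.σ x.m + 1) - 1) :=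
    (h0.xor (h0.add h1 hbound)).congr fun x hx => by
      obtain ⟨y, hy⟩ := hform x hx
      simp only [hy]
      exact xor_succ_of_low_ones _ _
  have hpow : Comp A (fun x => 2 ^ WordRAM.theta x.σ x.m) := by
    refine ((hxor.add h1 fun x hx => ?_).div (Comp.num hA (n := 2) (by norm_num))).congr
      fun x hx => ?_
    · have := hlt x hx
      rw [Nat.sub_add_cancel Nat.one_le_two_pow]
      exact Nat.pow_lt_pow_right (by omega) (by omega)
    · rw [Nat.sub_add_cancel Nat.one_le_two_pow, pow_succ, Nat.mul_div_cancel _ (by omega)]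
  refine (((h0.div hpow).mod hpow fun x hx => ?_).div (Comp.num hA (n := 2) (by norm_num))).congr
    fun x hx => ?_
  · exact (Nat.div_le_self _ _).trans_lt (field_lt _ _ _)
  · rw [hsecond x hx, Nat.mul_div_cancel_left _ (by omega)]

theorem Comp.header (hA : ∀ x, A x → Valid x) {k : ℕ} (hk : k < 7) :
    Comp A (fun x => header x.σ x.m k) := by
  have h : Comp A (fun x =>
      WordRAM.field x.D ((x.m + 1) * 0 + k * WordRAM.theta x.σ x.m) (WordRAM.theta x.σ x.m)) := by
    refine Comp.slot_field (Comp.num hA (n := 0) (by norm_num)) (Comp.num hA (n := k) (by omega))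
      (Comp.theta hA) (Comp.theta hA) ?_ ?_ ?_ ?_ ?_ ?_ ?_
    all_goals
      intro x hx
      have hB := (hA x hx).bounds
      have h1 := hB.hw
      have h2 := hB.theta_lt
      have h3 := Nat.lt_two_pow_self (n := x.w)
    · exact two_mul_sq_lt (by omega)
    · exact hB.hm
    · omega
    · omega
    · omega
    · have e1 : k * WordRAM.theta x.σ x.m ≤ 7 * x.w := Nat.mul_le_mul (by omega) (by omega)
      have e2 : x.w * 8 ≤ x.w * (2 ^ x.w - 1) := Nat.mul_le_mul_left _ (by omega)
      omega
    · omega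
  refine h.congr fun x hx => ?_
  obtain ⟨q, hq⟩ := (hA x hx).stored
  have := hq.hdr k hk
  simpa [entry, width] using this

theorem Comp.lam (hA : ∀ x, A x → Valid x) : Comp A (fun x => lam x.σ) :=
  Comp.header hA (k := 2) (by norm_num)

theorem Comp.psi (hA : ∀ x, A x → Valid x) : Comp A (fun x => psi x.σ) :=
  Comp.header hA (k := 3) (by norm_num)

theorem Comp.kap (hA : ∀ x, A x → Valid x) : Comp A (fun x => kap x.σ x.m) :=
  Comp.header hA (k := 5) (by norm_num)

theorem Comp.zet (hA : ∀ x, A x → Valid x) : Comp A (fun x => zet x.σ x.m) :=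
  Comp.header hA (k := 6) (by norm_num)

/-- A fixed multiple of a small number. -/
theorem Comp.smul (hA : ∀ x, A x → Valid x) {f : Query → ℕ} (hf : Comp A f) {n : ℕ}
    (hn : n < 1000000) (h : ∀ x, A x → f x ≤ x.w) : Comp A (fun x => n * f x) :=
  (Comp.num hA hn).mul hf fun x hx => by
    have h1 := (hA x hx).bounds.hw
    have h2 := two_mul_sq_lt (w := x.w) (by omega)
    have h3 := Nat.mul_le_mul (show n ≤ x.w by omega) (h x hx)
    omega

theorem Comp.width (hA : ∀ x, A x → Valid x) (t : ℕ) : Comp A (fun x => width x.σ x.m t) := by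
  have hpsi : ∀ x, A x → WordRAM.psi x.σ ≤ x.w := fun x hx => by
    have := (hA x hx).bounds.psi_lt
    omega
  have hlam : ∀ x, A x → WordRAM.lam x.σ ≤ x.w := fun x hx => by
    have := (hA x hx).bounds.lam_le
    have := (hA x hx).bounds.hw
    omega
  have hw : ∀ x, A x → x.w < 2 ^ x.w := fun x _ => Nat.lt_two_pow_self
  have h1 : Comp A (fun _ => 1) := Comp.num hA (by norm_num)
  have h8 := (Comp.psi hA).smul hA (n := 8) (by norm_num) hpsi
  have h20 := (Comp.psi hA).smul hA (n := 20) (by norm_num) hpsi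
  have h2 := (Comp.lam hA).smul hA (n := 2) (by norm_num) hlam
  rcases t with _ | _ | _ | _ | _ | _ | _ | _ | _ | _ | _ | _ | _ | t
  · exact Comp.theta hA
  · exact h8
  · exact h8
  · exact h8
  · exact h20
  · exact h20
  · exact h20
  · exact h20
  · exact h20
  · exact h2
  · exact Comp.header hA (k := 4) (by norm_num)
  · exact (Comp.zet hA).add h1 fun x hx => by
      have := (hA x hx).bounds.zet_lt
      have := hw x hx
      omega
  · exact h2.add h1 fun x hx => by
      have := (hA x hx).bounds.lam_le
      have := (hA x hx).bounds.hw
      have := hw x hx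
      omega
  · exact Comp.num hA (n := 0) (by norm_num)

/-- All data lie within (m + 1) · 1300ψ bits, and 1300ψ < w, so word addresses stay below 2^w. -/
theorem Comp.entries (hA : ∀ x, A x → Valid x) {t : ℕ} (ht : t < 13) {h n : Query → ℕ}
    (hh : Comp A h) (hn : Comp A n)
    (hle : ∀ x, A x → h x * WordRAM.width x.σ x.m t ≤ slotLen x.σ x.m)
    (hlt : ∀ x, A x → h x < 2 ^ x.w) (hnw : ∀ x, A x → WordRAM.width x.σ x.m t * n x ≤ x.w) :
    Comp A (fun x => entries x.σ x.m x.D t (h x) (n x)) := by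
  have hpsi : ∀ x, A x → 1300 * WordRAM.psi x.σ < x.w := fun x hx => (hA x hx).bounds.psi_lt
  have hw : ∀ x, A x → x.w < 2 ^ x.w := fun x _ => Nat.lt_two_pow_self
  have hG : ∀ x, A x → 100 * t * WordRAM.psi x.σ ≤ 1200 * WordRAM.psi x.σ := fun x _ =>
    Nat.mul_le_mul_right _ (by omega)
  have h := Comp.slot_field
    ((Comp.psi hA).smul hA (n := 100 * t) (by omega) fun x hx => by have := hpsi x hx; omega)
    hh (Comp.width hA t)
    ((Comp.width hA t).mul hn fun x hx => (hnw x hx).trans_lt (hw x hx))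
    (fun x hx => two_mul_sq_lt (by have := (hA x hx).bounds.hw; omega))
    (fun x hx => (hA x hx).bounds.hm)
    (fun x hx => by have := hpsi x hx; have := hG x hx; omega)
    (fun x hx => width_le (hA x hx).bounds t) hnw
    (fun x hx => by
      have h1 := Nat.mul_le_mul_left (x.m + 1) (hG x hx)
      have h2 := hle x hx
      unfold slotLen at h2
      have h3 : (x.m + 1) * (1300 * WordRAM.psi x.σ) =
          (x.m + 1) * (1200 * WordRAM.psi x.σ) + (x.m + 1) * (100 * WordRAM.psi x.σ) := by ring
      have h4 := (hA x hx).bounds.hm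
      have h5 : (x.m + 1) * (1300 * WordRAM.psi x.σ) ≤
          (2 ^ x.w - 1) * (1300 * WordRAM.psi x.σ) := Nat.mul_le_mul_right _ (by omega)
      have h6 : (2 ^ x.w - 1) * (1300 * WordRAM.psi x.σ) < (2 ^ x.w - 1) * x.w :=
        Nat.mul_lt_mul_of_pos_left (hpsi x hx) (by omega)
      rw [mul_comm x.w]
      omega) hlt
  refine h.congr fun x _ => ?_
  unfold WordRAM.entries
  congr 2
  unfold slotLen
  ring

theorem Comp.entry (hA : ∀ x, A x → Valid x) {t : ℕ} (ht : t < 13) {h : Query → ℕ}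
    (hh : Comp A h) (hle : ∀ x, A x → h x * WordRAM.width x.σ x.m t ≤ slotLen x.σ x.m)
    (hlt : ∀ x, A x → h x < 2 ^ x.w) : Comp A (fun x => entry x.σ x.m x.D t (h x)) :=
  (Comp.entries hA ht hh (Comp.num hA (n := 1) (by norm_num)) hle hlt fun x hx => by
    rw [mul_one]; exact width_le (hA x hx).bounds t).congr fun x _ => by
      unfold WordRAM.entries
      rw [mul_one]
      rfl

/-- Entries that are indexed by positions. -/
theorem Comp.entry_pos (hA : ∀ x, A x → Valid x) {t : ℕ} (ht : t ∈ Finset.Icc 1 8) {h : Query → ℕ}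
    (hh : Comp A h) (hle : ∀ x, A x → h x ≤ x.m) :
    Comp A (fun x => WordRAM.entry x.σ x.m x.D t (h x)) := by
  rw [Finset.mem_Icc] at ht
  refine Comp.entry hA (by omega) hh (fun x hx => ?_) fun x hx => ?_
  · refine Nat.mul_le_mul ((hle x hx).trans (Nat.le_succ _)) ?_
    obtain ⟨h1, h2⟩ := ht
    interval_cases t <;> simp [WordRAM.width] <;> omega
  · have := hle x hx
    have := (hA x hx).bounds.hm
    omega

end params

/-! ### Searching the sorted keys of a block -/

section arithmetic

variable {g F N r B : ℕ}

theorem add_mul_lt_iff (hg : 0 < g) (t : ℕ) : B + g * t < r ↔ t < (r - B + g - 1) / g := by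
  rw [Nat.lt_iff_add_one_le (m := t), Nat.le_div_iff_mul_le hg, add_mul, one_mul, mul_comm g t]
  omega

theorem digit_le_base (hg : 0 < g) (hF : 0 < F) (hB : B = (r - 1) / (g * F) * (g * F)) :
    (r - B + g - 1) / g ≤ F := by
  have h1 := Nat.div_add_mod' (r - 1) (g * F)
  have h2 := Nat.mod_lt (r - 1) (Nat.mul_pos hg hF)
  rw [← hB] at h1
  rw [← Nat.lt_succ_iff, Nat.div_lt_iff_lt_mul hg, Nat.succ_mul, mul_comm F g]
  omega

theorem digit_le_count (hr : r ≤ N) : (r - B + g - 1) / g ≤ (N - B + g - 1) / g :=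
  Nat.div_le_div_right (by omega)

/-- Here B is r - 1 rounded down to a multiple of gF, and the ceiling of (r - B)/g, diminished by
one, is the next base-F digit of r - 1. One level of the search thus refines the rounding from gF to
g; r = 0 is covered by truncated subtraction. -/
theorem add_mul_digit_pred (hg : 0 < g) (hB : B = (r - 1) / (g * F) * (g * F)) :
    B + g * ((r - B + g - 1) / g - 1) = (r - 1) / g * g := by
  rcases Nat.eq_zero_or_pos r with rfl | hr
  · have : (g - 1) / g = 0 := Nat.div_eq_of_lt (by omega)
    simp [hB, this]
  · have h1 := Nat.div_add_mod' (r - 1) (g * F)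
    rw [← hB] at h1
    have h2 : r - B + g - 1 = (r - 1) % (g * F) + g := by omega
    rw [h2, Nat.add_div_right _ hg, Nat.succ_sub_one]
    have h3 : r - 1 = g * ((r - 1) / (g * F) * F) + (r - 1) % (g * F) := by
      rw [show g * ((r - 1) / (g * F) * F) = B by rw [hB]; ring]
      exact h1.symm
    conv_rhs => rw [h3, Nat.mul_add_div hg]
    rw [hB]
    ring

theorem card_filter_range_le (v c : ℕ) : ((Finset.range v).filter (fun t => c ≤ t)).card = v - c := by
  rw [show (Finset.range v).filter (fun t => c ≤ t) = Finset.Ico c v by ext; simp; omega,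
    Nat.card_Ico]

end arithmetic

theorem Comp.count_ge {A : Query → Prop} (hA : ∀ x, A x → Valid x) {B v y : Query → ℕ}
    {d : Query → ℕ → ℕ} (hP : Comp A (fun x => pack (B x + 1) (v x) (d x))) (hB : Comp A B)
    (hv : Comp A v) (hy : Comp A y) (hd : ∀ x, A x → ∀ i < v x, d x i < 2 ^ B x)
    (hyB : ∀ x, A x → y x < 2 ^ B x) (hBw : ∀ x, A x → B x + 1 < x.w)
    (hvw : ∀ x, A x → (B x + 1) * v x < x.w) (hvB : ∀ x, A x → v x < 2 ^ (B x + 1) - 1) :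
    Comp A (fun x => ((Finset.range (v x)).filter (fun i => y x ≤ d x i)).card) := by
  have h1 : Comp A (fun _ => 1) := Comp.num hA (by norm_num)
  have hw : ∀ x, A x → x.w < 2 ^ x.w := fun x _ => Nat.lt_two_pow_self
  have hB1 : Comp A (fun x => B x + 1) := hB.add h1 fun x hx => (hBw x hx).trans (hw x hx)
  have hpow : ∀ x, A x → 2 ^ ((B x + 1) * v x) < 2 ^ x.w := fun x hx =>
    Nat.pow_lt_pow_right (by omega) (hvw x hx)
  have hones : Comp A (fun x => pack (B x + 1) (v x) (fun _ => 1)) := by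
    refine ((((hB1.mul hv fun x hx => (hvw x hx).trans (hw x hx)).two_pow hvw).sub h1 hpow
      fun x _ => Nat.one_le_two_pow).div ((hB1.two_pow hBw).sub h1 (fun x hx =>
        Nat.pow_lt_pow_right (by omega) (hBw x hx)) fun x _ => Nat.one_le_two_pow)).congr
      fun x _ => ?_
    rw [pack_one _ _ (by omega)]
  have hB0 : Comp A (fun x => 2 ^ B x) := hB.two_pow fun x hx => by have := hBw x hx; omega
  have e1 : ∀ x, A x → pack (B x + 1) (v x) (d x) + pack (B x + 1) (v x) (fun _ => 1) * 2 ^ B x <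
      2 ^ x.w := fun x hx => by
    rw [pack_mul_const, pack_add]
    refine (pack_lt fun i hi => ?_).trans (hpow x hx)
    have := hd x hx i hi
    rw [pow_succ]
    omega
  have e2 : ∀ x, A x → pack (B x + 1) (v x) (fun _ => 1) * y x ≤
      pack (B x + 1) (v x) (fun _ => 1) * 2 ^ B x := fun x hx =>
    Nat.mul_le_mul_left _ (hyB x hx).le
  have hmask := hones.mul hB0 fun x hx => (Nat.le_add_left _ _).trans_lt (e1 x hx)
  have hsub := (hP.add hmask e1).sub
    (hones.mul hy fun x hx => ((e2 x hx).trans (Nat.le_add_left _ _)).trans_lt (e1 x hx)) e1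
    fun x hx => (e2 x hx).trans (Nat.le_add_left _ _)
  refine (((hsub.land hmask).div_two_pow hB).mod ((hB1.two_pow hBw).sub h1 (fun x hx =>
      Nat.pow_lt_pow_right (by omega) (hBw x hx)) fun x _ => Nat.one_le_two_pow)
      fun x hx => ?_).congr fun x hx => ?_
  · exact ((Nat.div_le_self _ _).trans Nat.and_le_left).trans_lt
      ((Nat.sub_le _ _).trans_lt (e1 x hx))
  · exact pack_count_ge (hd x hx) (hyB x hx) (hvB x hx)

/-- The moduli of the blocks. -/
noncomputable def Query.modulus (x : Query) : ℕ → ℕ :=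
  Classical.epsilon fun q => Stored x.σ x.m (symbolAt x.C) q x.D

theorem Valid.stored_modulus {x : Query} (h : Valid x) :
    Stored x.σ x.m (symbolAt x.C) x.modulus x.D :=
  Classical.epsilon_spec h.stored

/-- The number of keys of block `k` below `y`. -/
noncomputable def Query.rank (x : Query) (k y : ℕ) : ℕ :=
  keyRank (symbolAt x.C) x.modulus (2 ^ (4 * psi x.σ)) x.m k y

/-- The `r`-th key, blocks of `2 ^ (4 * psi x.σ)` ranks being sorted separately. -/
noncomputable def Query.key (x : Query) (r : ℕ) : ℕ :=
  sortedKey (symbolAt x.C) x.modulus (2 ^ (4 * psi x.σ)) x.m r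

theorem Query.key_lt {x : Query} (hx : Valid x) {r : ℕ} (hr : r ≤ x.m) :
    x.key r < 2 ^ (20 * psi x.σ - 1) := by
  have hS := hx.stored_modulus
  have h1 := Nat.div_add_mod' r (2 ^ (4 * psi x.σ))
  have h2 := Nat.mod_lt r (Nat.two_pow_pos (4 * psi x.σ))
  have := sortedKey_lt (c := symbolAt x.C) (q := x.modulus) (b := 2 ^ (4 * psi x.σ)) (m := x.m)
    (k := r / 2 ^ (4 * psi x.σ)) (r := r % 2 ^ (4 * psi x.σ)) hS.q_pos le_rfl (by omega)
  rw [h1] at this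
  exact this.trans (hS.q_le _)

theorem Comp.two_pow_psi {A : Query → Prop} (hA : ∀ x, A x → Valid x) {n : ℕ} (hn : n ≤ 20) :
    Comp A (fun x => 2 ^ (n * WordRAM.psi x.σ)) := by
  have h : ∀ x, A x → n * WordRAM.psi x.σ < x.w := fun x hx => by
    have h1 := (hA x hx).bounds.psi_lt
    have h2 := Nat.mul_le_mul_right (WordRAM.psi x.σ) hn
    omega
  exact ((Comp.psi hA).smul hA (by omega) fun x hx => by
    have h1 := (hA x hx).bounds.psi_lt
    omega).two_pow h

/-- The number of positions of block `k`. -/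
def Query.blockLen (x : Query) (k : ℕ) : ℕ :=
  min (2 ^ (4 * psi x.σ)) (x.m + 1 - k * 2 ^ (4 * psi x.σ))

/-- One level of the search: `F` of the keys are compared at once. -/
theorem comp_digit {A : Query → Prop} (hA : ∀ x, A x → Valid x) {k y : Query → ℕ}
    (hk : Comp A k) (hy : Comp A y) (hkm : ∀ x, A x → k x * 2 ^ (4 * psi x.σ) ≤ x.m)
    (hylt : ∀ x, A x → y x < 2 ^ (20 * psi x.σ - 1)) {l : ℕ} (hl : l < 4)
    {B : Query → ℕ} (hB : Comp A B)
    (hBe : ∀ x, A x → B x = (x.rank (k x) (y x) - 1) / (2 ^ (l * psi x.σ) *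
      2 ^ (1 * psi x.σ)) * (2 ^ (l * psi x.σ) * 2 ^ (1 * psi x.σ))) :
    Comp A (fun x => (x.rank (k x) (y x) - B x + 2 ^ (l * psi x.σ) - 1) / 2 ^ (l * psi x.σ)) := by
  have h1 : Comp A (fun _ => 1) := Comp.num hA (by norm_num)
  have hm : ∀ x, A x → x.m + 1 < 2 ^ x.w := fun x hx => (hA x hx).bounds.hm
  have hpsi : ∀ x, A x → 1300 * psi x.σ < x.w := fun x hx => (hA x hx).bounds.psi_lt
  have hg := Comp.two_pow_psi hA (n := l) (by omega)
  have hF := Comp.two_pow_psi hA (n := 1) (by omega)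
  have hb := Comp.two_pow_psi hA (n := 4) (by omega)
  have hkb := hk.mul hb fun x hx => (hkm x hx).trans_lt (by have := hm x hx; omega)
  have hN : Comp A (fun x => x.blockLen (k x)) :=
    hb.min (((Comp.input_m A).add h1 hm).sub hkb hm fun x hx => by have := hkm x hx; omega)
  have hrank : ∀ x, A x → x.rank (k x) (y x) ≤ x.blockLen (k x) :=
    fun x _ => keyRank_le (by positivity) _
  have hNpos : ∀ x, A x → 0 < x.blockLen (k x) := fun x hx => by
    have := hkm x hx
    have := Nat.one_le_two_pow (n := 4 * psi x.σ)
    unfold Query.blockLen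
    omega
  have hBr : ∀ x, A x → B x ≤ x.rank (k x) (y x) - 1 := fun x hx => by
    rw [hBe x hx]; exact Nat.div_mul_le_self _ _
  have hBN : ∀ x, A x → B x < x.blockLen (k x) := fun x hx => by
    have := hBr x hx
    have := hrank x hx
    have := hNpos x hx
    omega
  have hgpos : ∀ x : Query, 0 < 2 ^ (l * psi x.σ) := fun x => by positivity
  have hlpsi : ∀ x : Query, l * psi x.σ ≤ 4 * psi x.σ := fun x => Nat.mul_le_mul_right _ hl.le
  have hw2 : ∀ x, A x → 2 ^ (4 * psi x.σ) + 2 ^ (4 * psi x.σ) < 2 ^ x.w := fun x hx => by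
    rw [← mul_two, ← pow_succ]
    exact Nat.pow_lt_pow_right (by omega) (by
      have := hpsi x hx
      have := one_le_psi x.σ
      omega)
  have hgb : ∀ x : Query, 2 ^ (l * psi x.σ) ≤ 2 ^ (4 * psi x.σ) := fun x =>
    Nat.pow_le_pow_right (by omega) (hlpsi x)
  have hNb : ∀ x : Query, x.blockLen (k x) ≤ 2 ^ (4 * psi x.σ) := fun x => min_le_left _ _
  -- The number of samples to compare: F, or fewer where the block ends.
  let v : Query → ℕ := fun x =>
    min (2 ^ (1 * psi x.σ)) ((x.blockLen (k x) - B x + 2 ^ (l * psi x.σ) - 1) / 2 ^ (l * psi x.σ))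
  have hv : Comp A v := by
    have hsum : ∀ x, A x → x.blockLen (k x) - B x + 2 ^ (l * psi x.σ) < 2 ^ x.w := fun x hx => by
      have := hw2 x hx
      have := hgb x
      have := hNb x
      omega
    refine hF.min ((((hN.sub hB (fun x hx => ?_) fun x hx => (hBN x hx).le).add hg hsum).sub h1
      hsum fun x _ => ?_).div hg)
    · have := hw2 x hx
      have := hNb x
      omega
    · have := hgpos x
      omega
  have hvlt : ∀ x, A x → ∀ t < v x, B x + 2 ^ (l * psi x.σ) * t < x.blockLen (k x) :=
    fun x hx t ht => (add_mul_lt_iff (hgpos x) t).2 (ht.trans_le (min_le_right _ _))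
  -- The index of the first sample in the array of level l. The division is exact because the block
  -- start and B are multiples of 2^(lψ).
  let h : Query → ℕ := fun x => (k x * 2 ^ (4 * psi x.σ) + B x) / 2 ^ (l * psi x.σ)
  have hkB : ∀ x, A x → k x * 2 ^ (4 * psi x.σ) + B x ≤ x.m := fun x hx => by
    have h2 := hkm x hx
    have h3 := hBN x hx
    unfold Query.blockLen at h3
    omega
  have hcomp_h : Comp A h := (hkb.add hB fun x hx => by
    have := hkB x hx
    have := hm x hx
    omega).div hg
  have hdvd : ∀ x, A x → h x * 2 ^ (l * psi x.σ) = k x * 2 ^ (4 * psi x.σ) + B x := fun x hx => by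
    refine Nat.div_mul_cancel ((Dvd.dvd.mul_left ?_ _).add ?_)
    · exact pow_dvd_pow _ (hlpsi x)
    · rw [hBe x hx, ← mul_assoc, mul_right_comm]
      exact Dvd.intro_left _ rfl
  have hindex : ∀ x, A x → ∀ t, (h x + t) * 2 ^ (l * psi x.σ) =
      k x * 2 ^ (4 * psi x.σ) + (B x + 2 ^ (l * psi x.σ) * t) := fun x hx t => by
    rw [add_mul, hdvd x hx]
    ring
  have hindex_le : ∀ x, A x → ∀ t < v x, (h x + t) * 2 ^ (l * psi x.σ) ≤ x.m :=
    fun x hx t ht => by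
      rw [hindex x hx]
      have h1 := hvlt x hx t ht
      unfold Query.blockLen at h1
      omega
  have hhm : ∀ x, A x → h x ≤ x.m := fun x hx => (Nat.div_le_self _ _).trans (hkB x hx)
  have hwidth : ∀ x : Query, width x.σ x.m (5 + l) = 20 * psi x.σ := fun x => by
    interval_cases l <;> rfl
  have hv20 : ∀ x, A x → 20 * psi x.σ * v x < x.w := fun x hx => by
    refine (Nat.mul_le_mul_left _ (min_le_left _ _)).trans_lt ?_
    rw [one_mul]
    exact (hA x hx).bounds.psi_pow_lt
  have hent : Comp A (fun x => pack (20 * psi x.σ - 1 + 1) (v x)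
      (fun t => x.key ((h x + t) * 2 ^ (l * psi x.σ)))) := by
    refine (Comp.entries hA (t := 5 + l) (by omega) hcomp_h hv (fun x hx => ?_) (fun x hx => ?_)
      fun x hx => ?_).congr fun x hx => ?_
    · rw [hwidth]
      exact Nat.mul_le_mul ((hhm x hx).trans (Nat.le_succ _)) (by omega)
    · have := hhm x hx
      have := hm x hx
      omega
    · rw [hwidth]
      exact (hv20 x hx).le
    · have e : (2 ^ psi x.σ) ^ l = 2 ^ (l * psi x.σ) := by rw [← pow_mul, mul_comm]
      rw [(hA x hx).stored_modulus.keys l hl _ _ (by rw [e]; exact hindex_le x hx), e,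
        Nat.sub_add_cancel (by have := one_le_psi x.σ; omega)]
      rfl
  have h20 : Comp A (fun x => 20 * psi x.σ - 1) :=
    ((Comp.psi hA).smul hA (n := 20) (by norm_num) fun x hx => by
      have := hpsi x hx; omega).sub h1 (fun x hx => by
        have := hpsi x hx
        have := Nat.lt_two_pow_self (n := x.w)
        omega) fun x _ => by have := one_le_psi x.σ; omega
  have hcount := Comp.count_ge hA hent h20 hv hy
    (fun x hx i hi => (x.key_lt (hA x hx) (hindex_le x hx i hi))) hylt
    (fun x hx => by
      have := hpsi x hx
      have := one_le_psi x.σ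
      omega)
    (fun x hx => by
      rw [Nat.sub_add_cancel (by have := one_le_psi x.σ; omega)]
      exact hv20 x hx)
    (fun x hx => by
      have e1 : v x ≤ 2 ^ (1 * psi x.σ) := min_le_left _ _
      have e2 := one_le_psi x.σ
      have e3 : 2 ^ (1 * psi x.σ + 1) ≤ 2 ^ (20 * psi x.σ - 1 + 1) :=
        Nat.pow_le_pow_right (by omega) (by omega)
      rw [pow_succ] at e3
      have e4 : 1 < 2 ^ (1 * psi x.σ) := Nat.one_lt_two_pow (by omega)
      omega)
  -- Sample t lies below y exactly if its index is below the rank, that is, if t is below the wanted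
  -- digit; the count of the other samples gives the digit.
  have hcard : ∀ x, A x → ((Finset.range (v x)).filter
      (fun t => y x ≤ x.key ((h x + t) * 2 ^ (l * psi x.σ)))).card =
      v x - (x.rank (k x) (y x) - B x + 2 ^ (l * psi x.σ) - 1) / 2 ^ (l * psi x.σ) := by
    intro x hx
    rw [← card_filter_range_le]
    congr 1
    refine Finset.filter_congr fun t ht => ?_
    have e1 := hvlt x hx t (Finset.mem_range.1 ht)
    have e2 := (sortedKey_lt_iff (c := symbolAt x.C) (q := x.modulus) (y := y x) e1).trans
      (add_mul_lt_iff (hgpos x) t)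
    rw [← hindex x hx t] at e2
    have e3 := not_congr e2
    rw [not_lt, not_lt] at e3
    exact e3
  have hcv : ∀ x, A x → (x.rank (k x) (y x) - B x + 2 ^ (l * psi x.σ) - 1) / 2 ^ (l * psi x.σ) ≤
      v x := fun x hx =>
    le_min (digit_le_base (hgpos x) (by positivity) (hBe x hx)) (digit_le_count (hrank x hx))
  refine (hv.sub hcount (fun x hx => ?_) fun x hx => ?_).congr fun x hx => ?_
  · refine (min_le_left _ _).trans_lt (Nat.pow_lt_pow_right (by omega) ?_)
    have := hpsi x hx
    omega
  · rw [hcard x hx]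
    exact Nat.sub_le _ _
  · rw [hcard x hx]
    exact Nat.sub_sub_self (hcv x hx)

/-- The rank is at most 2^(4ψ), so its predecessor has four digits in base 2^ψ. They are found from
the top, one application of `comp_digit` each. -/
theorem comp_rank {A : Query → Prop} (hA : ∀ x, A x → Valid x) {k y : Query → ℕ}
    (hk : Comp A k) (hy : Comp A y) (hkm : ∀ x, A x → k x * 2 ^ (4 * psi x.σ) ≤ x.m)
    (hylt : ∀ x, A x → y x < 2 ^ (20 * psi x.σ - 1)) :
    Comp A (fun x => x.rank (k x) (y x)) := by
  have h1 : Comp A (fun _ => 1) := Comp.num hA (by norm_num)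
  have hm : ∀ x, A x → x.m + 1 < 2 ^ x.w := fun x hx => (hA x hx).bounds.hm
  have hrank : ∀ x, A x → x.rank (k x) (y x) ≤ 2 ^ (4 * psi x.σ) :=
    fun x _ => (keyRank_le (by positivity) _).trans (min_le_left _ _)
  have hsmall : ∀ x, A x → 2 ^ (4 * psi x.σ) < 2 ^ x.w := fun x hx =>
    Nat.pow_lt_pow_right (by omega) (by have := (hA x hx).bounds.psi_lt; omega)
  have hpow : ∀ (l : ℕ) (x : Query), 2 ^ (l * psi x.σ) * 2 ^ (1 * psi x.σ) =
      2 ^ ((l + 1) * psi x.σ) := fun l x => by rw [← pow_add, add_mul]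
  have hstep : ∀ l < 4, Comp A (fun x => (x.rank (k x) (y x) - 1) / 2 ^ ((l + 1) * psi x.σ) *
      2 ^ ((l + 1) * psi x.σ)) → Comp A (fun x => (x.rank (k x) (y x) - 1) / 2 ^ (l * psi x.σ) *
      2 ^ (l * psi x.σ)) := by
    intro l hl hB
    have hd := comp_digit hA hk hy hkm hylt hl hB fun x _ => by rw [hpow]
    have he : ∀ x : Query, _ := fun x => add_mul_digit_pred
      (r := x.rank (k x) (y x)) (g := 2 ^ (l * psi x.σ)) (F := 2 ^ (1 * psi x.σ)) (by positivity) rfl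
    simp only [hpow] at he
    have hlt : ∀ x, A x → (x.rank (k x) (y x) - 1) / 2 ^ (l * psi x.σ) * 2 ^ (l * psi x.σ) <
        2 ^ x.w := fun x hx => by
      refine (Nat.div_mul_le_self _ _).trans_lt ?_
      have := hrank x hx
      have := hsmall x hx
      omega
    -- Word subtraction wraps around at 0, so the truncated predecessor needs a case distinction.
    have hd1 : Comp A (fun x => (x.rank (k x) (y x) - (x.rank (k x) (y x) - 1) /
        2 ^ ((l + 1) * psi x.σ) * 2 ^ ((l + 1) * psi x.σ) + 2 ^ (l * psi x.σ) - 1) /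
        2 ^ (l * psi x.σ) - 1) := by
      refine (hd.ite_lt h1 (Comp.num (n := 0) (fun x hx => hA x hx.1) (by norm_num))
        ((hd.mono fun x hx => hx.1).sub (h1.mono fun x hx => hx.1) (fun x hx => ?_)
          fun x hx => by have := hx.2; omega)).congr fun x _ => ?_
      · refine (Nat.div_le_self _ _).trans_lt ?_
        have := hrank x hx.1
        have e1 : 2 ^ (l * psi x.σ) ≤ 2 ^ (4 * psi x.σ) :=
          Nat.pow_le_pow_right (by omega) (Nat.mul_le_mul_right _ hl.le)
        have e2 : 2 ^ (4 * psi x.σ) + 2 ^ (4 * psi x.σ) < 2 ^ x.w := by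
          rw [← mul_two, ← pow_succ]
          exact Nat.pow_lt_pow_right (by omega) (by
            have := (hA x hx.1).bounds.psi_lt
            have := one_le_psi x.σ
            omega)
        omega
      · split_ifs <;> omega
    exact (hB.add ((Comp.two_pow_psi hA (n := l) (by omega)).mul hd1 fun x hx =>
      ((Nat.le_add_left _ _).trans (he x).le).trans_lt (hlt x hx)) fun x hx =>
      (he x).le.trans_lt (hlt x hx)).congr fun x _ => he x
  have h4 : Comp A (fun x => (x.rank (k x) (y x) - 1) / 2 ^ ((3 + 1) * psi x.σ) *
      2 ^ ((3 + 1) * psi x.σ)) :=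
    (Comp.num hA (n := 0) (by norm_num)).congr fun x hx => by
      have := hrank x hx
      have := Nat.one_le_two_pow (n := 4 * psi x.σ)
      rw [Nat.div_eq_of_lt (by norm_num; omega), zero_mul]
  have hB := hstep 1 (by norm_num) (hstep 2 (by norm_num) (hstep 3 (by norm_num) h4))
  have hd := comp_digit hA hk hy hkm hylt (l := 0) (by norm_num) hB fun x _ => by simp
  have hle : ∀ x : Query, (x.rank (k x) (y x) - 1) / 2 ^ (1 * psi x.σ) * 2 ^ (1 * psi x.σ) ≤
      x.rank (k x) (y x) - 1 := fun x => Nat.div_mul_le_self _ _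
  have he : ∀ x : Query, (x.rank (k x) (y x) - 1) / 2 ^ (1 * psi x.σ) * 2 ^ (1 * psi x.σ) +
      (x.rank (k x) (y x) - (x.rank (k x) (y x) - 1) / 2 ^ (1 * psi x.σ) * 2 ^ (1 * psi x.σ) +
      2 ^ (0 * psi x.σ) - 1) / 2 ^ (0 * psi x.σ) = x.rank (k x) (y x) := fun x => by
    have := hle x
    rw [zero_mul, pow_zero, Nat.div_one]
    omega
  exact (hB.add hd fun x hx => by
    rw [he]
    exact (hrank x hx).trans_lt (hsmall x hx)).congr fun x _ => he x

/-! ### The first and the last occurrence -/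

/-- `p` is an occurrence of the symbol in the interval of the query. -/
def Query.Occurs (x : Query) (p : ℕ) : Prop := x.i ≤ p ∧ p ≤ x.j ∧ symbolAt x.C p = x.a

/-- `p` if it is an occurrence in the interval, and `m + 1` otherwise. -/
def Query.accept (x : Query) (p : ℕ) : ℕ :=
  if x.i ≤ p then if p ≤ x.j then if symbolAt x.C p = x.a then p else x.m + 1 else x.m + 1
  else x.m + 1

/-- The position with the key of rank `r` in block `k`. -/
noncomputable def Query.probe (x : Query) (k r : ℕ) : ℕ :=
  k * 2 ^ (4 * psi x.σ) + x.key (min (k * 2 ^ (4 * psi x.σ) + r) x.m) % 2 ^ (4 * psi x.σ)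

/-- The number of keys of block `k` below the key that the query symbol has at offset `o`. -/
noncomputable def Query.symbolRank (x : Query) (k o : ℕ) : ℕ :=
  x.rank k (x.a % x.modulus k * 2 ^ (4 * psi x.σ) + o)

noncomputable def Query.leftProbe (x : Query) (k o : ℕ) : ℕ :=
  x.accept (x.probe k (x.symbolRank k o))

noncomputable def Query.rightProbe (x : Query) (k o : ℕ) : ℕ :=
  x.accept (x.probe k (x.symbolRank k o - 1))

/-- The first occurrence, or `m + 1`. -/
noncomputable def Query.leftmost (x : Query) : ℕ :=
  if x.leftProbe (x.i / 2 ^ (4 * psi x.σ)) (x.i % 2 ^ (4 * psi x.σ)) ≤ x.m then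
    x.leftProbe (x.i / 2 ^ (4 * psi x.σ)) (x.i % 2 ^ (4 * psi x.σ))
  else x.leftProbe (x.j / 2 ^ (4 * psi x.σ)) 0

/-- The last occurrence, or `m + 1`. -/
noncomputable def Query.rightmost (x : Query) : ℕ :=
  if x.rightProbe (x.j / 2 ^ (4 * psi x.σ)) (x.j % 2 ^ (4 * psi x.σ) + 1) ≤ x.m then
    x.rightProbe (x.j / 2 ^ (4 * psi x.σ)) (x.j % 2 ^ (4 * psi x.σ) + 1)
  else x.rightProbe (x.i / 2 ^ (4 * psi x.σ)) (2 ^ (4 * psi x.σ))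

/-! ### Correctness of the probes -/

section spec

variable {x : Query}

theorem Query.accept_of_occurs {p : ℕ} (h : x.Occurs p) : x.accept p = p := by
  simp [Query.accept, h.1, h.2.1, h.2.2]

theorem Query.accept_of_not_occurs {p : ℕ} (h : ¬ x.Occurs p) : x.accept p = x.m + 1 := by
  unfold Query.accept
  split_ifs with h1 h2 h3
  · exact absurd ⟨h1, h2, h3⟩ h
  all_goals rfl

theorem Query.accept_le_iff (hx : Valid x) {p : ℕ} : x.accept p ≤ x.m ↔ x.Occurs p := by
  by_cases h : x.Occurs p
  · simp only [accept_of_occurs h, h, iff_true]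
    exact h.2.1.trans hx.j_le
  · simp only [accept_of_not_occurs h, h, iff_false]
    omega

/-- Even a meaningless probe stays in its block, so an accepted probe is an occurrence in that
block. -/
theorem Query.probe_div (k r : ℕ) : x.probe k r / 2 ^ (4 * psi x.σ) = k := by
  have hb := Nat.two_pow_pos (4 * psi x.σ)
  unfold Query.probe
  rw [mul_comm, Nat.mul_add_div hb, Nat.div_eq_of_lt (Nat.mod_lt _ hb), add_zero]

theorem Query.probe_eq {k r p : ℕ} (hk : p / 2 ^ (4 * psi x.σ) = k) (hr : r < x.blockLen k)
    (h : sortedKey (symbolAt x.C) x.modulus (2 ^ (4 * psi x.σ)) x.m (k * 2 ^ (4 * psi x.σ) + r) %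
      2 ^ (4 * psi x.σ) = p % 2 ^ (4 * psi x.σ)) : x.probe k r = p := by
  have h1 : min (k * 2 ^ (4 * psi x.σ) + r) x.m = k * 2 ^ (4 * psi x.σ) + r := by
    unfold Query.blockLen at hr
    omega
  unfold Query.probe
  rw [h1, Query.key, h, ← hk]
  exact Nat.div_add_mod' _ _

/-- A small interval is shorter than a block, so the blocks of i and j are equal or adjacent, and
two probes cover the interval. -/
theorem Query.div_le (hx : Valid x) :
    x.j / 2 ^ (4 * psi x.σ) ≤ x.i / 2 ^ (4 * psi x.σ) + 1 := by
  have h1 := two_mul_lam_sq_lt x.σ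
  have h2 := hx.gap
  rw [← Nat.add_div_right _ (Nat.two_pow_pos _)]
  exact Nat.div_le_div_right (by omega)

theorem Query.leftProbe_eq (hx : Valid x) {k o p : ℕ} (hp : x.Occurs p)
    (hk : p / 2 ^ (4 * psi x.σ) = k) (ho : o ≤ p % 2 ^ (4 * psi x.σ))
    (hmin : ∀ p' < p, p' / 2 ^ (4 * psi x.σ) = k → symbolAt x.C p' = x.a →
      p' % 2 ^ (4 * psi x.σ) < o) : x.leftProbe k o = p := by
  have h := sortedKey_succ (c := symbolAt x.C) (q := x.modulus) (Nat.two_pow_pos _)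
    (hx.stored_modulus.q_inj k) (hp.2.1.trans hx.j_le) hk ho (by rw [hp.2.2]; exact hmin)
  rw [hp.2.2] at h
  have e : x.probe k (x.symbolRank k o) = p := Query.probe_eq hk h.1 h.2
  unfold Query.leftProbe
  rw [e, Query.accept_of_occurs hp]

theorem Query.rightProbe_eq (hx : Valid x) {k o p : ℕ} (hp : x.Occurs p)
    (hk : p / 2 ^ (4 * psi x.σ) = k) (ho : p % 2 ^ (4 * psi x.σ) < o) (hob : o ≤ 2 ^ (4 * psi x.σ))
    (hmax : ∀ p', p < p' → p' ≤ x.m → p' / 2 ^ (4 * psi x.σ) = k → symbolAt x.C p' = x.a →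
      o ≤ p' % 2 ^ (4 * psi x.σ)) : x.rightProbe k o = p := by
  have h := sortedKey_pred (c := symbolAt x.C) (q := x.modulus) (Nat.two_pow_pos _)
    (hx.stored_modulus.q_inj k) (hp.2.1.trans hx.j_le) hk ho hob (by rw [hp.2.2]; exact hmax)
  rw [hp.2.2] at h
  have h2 : x.symbolRank k o ≤ x.blockLen k := keyRank_le (Nat.two_pow_pos _) _
  have h3 : 1 ≤ x.symbolRank k o := h.1
  have e : x.probe k (x.symbolRank k o - 1) = p := Query.probe_eq hk (by omega) h.2
  unfold Query.rightProbe
  rw [e, Query.accept_of_occurs hp]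

theorem Query.leftmost_eq (hx : Valid x) {p : ℕ} (hp : x.Occurs p)
    (hmin : ∀ p', x.Occurs p' → p ≤ p') : x.leftmost = p := by
  have hpm := hp.2.1.trans hx.j_le
  have hb := Nat.two_pow_pos (4 * psi x.σ)
  by_cases hblk : p / 2 ^ (4 * psi x.σ) = x.i / 2 ^ (4 * psi x.σ)
  · have e : x.leftProbe (x.i / 2 ^ (4 * psi x.σ)) (x.i % 2 ^ (4 * psi x.σ)) = p := by
      refine Query.leftProbe_eq hx hp hblk ?_ fun p' h1 h2 h3 => ?_
      · have e1 := Nat.div_add_mod p (2 ^ (4 * psi x.σ))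
        have e2 := Nat.div_add_mod x.i (2 ^ (4 * psi x.σ))
        have e3 := hp.1
        rw [hblk] at e1
        omega
      · have h4 : p' < x.i := by
          by_contra h
          have := hmin p' ⟨by omega, by have := hp.2.1; omega, h3⟩
          omega
        have e1 := Nat.div_add_mod p' (2 ^ (4 * psi x.σ))
        have e2 := Nat.div_add_mod x.i (2 ^ (4 * psi x.σ))
        rw [h2] at e1
        omega
    unfold Query.leftmost
    rw [e, if_pos hpm]
  · have hle := Nat.div_le_div_right (c := 2 ^ (4 * psi x.σ)) hp.1
    have hle2 := Nat.div_le_div_right (c := 2 ^ (4 * psi x.σ)) hp.2.1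
    have hd := Query.div_le hx
    have hj : p / 2 ^ (4 * psi x.σ) = x.j / 2 ^ (4 * psi x.σ) := by omega
    unfold Query.leftmost
    rw [if_neg]
    · refine Query.leftProbe_eq hx hp hj (Nat.zero_le _) fun p' h1 h2 h3 => ?_
      exfalso
      have h4 : x.i < p' := by
        by_contra h
        have := Nat.div_le_div_right (c := 2 ^ (4 * psi x.σ)) (not_lt.1 h)
        omega
      have := hmin p' ⟨h4.le, by have := hp.2.1; omega, h3⟩
      omega
    -- An accepted first probe would be an occurrence in the block of i, and minimality would force
    -- p into that block too.
    · intro h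
      have h1 := hmin _ ((Query.accept_le_iff hx).1 h)
      have h2 := Nat.div_le_div_right (c := 2 ^ (4 * psi x.σ)) h1
      rw [Query.probe_div] at h2
      omega

theorem Query.rightmost_eq (hx : Valid x) {p : ℕ} (hp : x.Occurs p)
    (hmax : ∀ p', x.Occurs p' → p' ≤ p) : x.rightmost = p := by
  have hpm := hp.2.1.trans hx.j_le
  have hb := Nat.two_pow_pos (4 * psi x.σ)
  by_cases hblk : p / 2 ^ (4 * psi x.σ) = x.j / 2 ^ (4 * psi x.σ)
  · have e : x.rightProbe (x.j / 2 ^ (4 * psi x.σ)) (x.j % 2 ^ (4 * psi x.σ) + 1) = p := by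
      refine Query.rightProbe_eq hx hp hblk ?_ (Nat.mod_lt _ hb) fun p' h1 h2 h3 h4 => ?_
      · have e1 := Nat.div_add_mod p (2 ^ (4 * psi x.σ))
        have e2 := Nat.div_add_mod x.j (2 ^ (4 * psi x.σ))
        have e3 := hp.2.1
        rw [hblk] at e1
        omega
      · have h5 : x.j < p' := by
          by_contra h
          have := hmax p' ⟨by have := hp.1; omega, by omega, h4⟩
          omega
        have e1 := Nat.div_add_mod p' (2 ^ (4 * psi x.σ))
        have e2 := Nat.div_add_mod x.j (2 ^ (4 * psi x.σ))
        rw [h3] at e1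
        omega
    unfold Query.rightmost
    rw [e, if_pos hpm]
  · have hle := Nat.div_le_div_right (c := 2 ^ (4 * psi x.σ)) hp.1
    have hle2 := Nat.div_le_div_right (c := 2 ^ (4 * psi x.σ)) hp.2.1
    have hd := Query.div_le hx
    have hi : p / 2 ^ (4 * psi x.σ) = x.i / 2 ^ (4 * psi x.σ) := by omega
    unfold Query.rightmost
    rw [if_neg]
    · refine Query.rightProbe_eq hx hp hi (Nat.mod_lt _ hb) le_rfl fun p' h1 h2 h3 h4 => ?_
      exfalso
      have h5 : p' < x.j := by
        by_contra h
        have := Nat.div_le_div_right (c := 2 ^ (4 * psi x.σ)) (not_lt.1 h)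
        omega
      have := hmax p' ⟨by have := hp.1; omega, h5.le, h4⟩
      omega
    · intro h
      have h1 := hmax _ ((Query.accept_le_iff hx).1 h)
      have h2 := Nat.div_le_div_right (c := 2 ^ (4 * psi x.σ)) h1
      rw [Query.probe_div] at h2
      omega

theorem Query.leftmost_of_not_occurs (h : ∀ p, ¬ x.Occurs p) : x.leftmost = x.m + 1 := by
  unfold Query.leftmost Query.leftProbe
  simp only [Query.accept_of_not_occurs (h _), ite_self]

end spec

/-! ### The probes as expressions -/

section computable

variable {A : Query → Prop}

theorem comp_accept (hA : ∀ x, A x → Valid x) {p : Query → ℕ} (hp : Comp A p) :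
    Comp A (fun x => x.accept (p x)) := by
  have hs : Comp A (fun x => x.m + 1) := (Comp.input_m A).add (Comp.num hA (by norm_num))
    fun x hx => (hA x hx).bounds.hm
  exact ((Comp.input_i A).ite_le hp (((hp.mono fun x hx => hx.1).ite_le
    ((Comp.input_j A).mono fun x hx => hx.1) (((hp.mono fun x hx => hx.1.1).access).ite_eq
      ((Comp.input_a A).mono fun x hx => hx.1.1) (hp.mono fun x hx => hx.1.1.1)
      (hs.mono fun x hx => hx.1.1.1)) (hs.mono fun x hx => hx.1.1))) (hs.mono fun x hx => hx.1))

theorem comp_probe (hA : ∀ x, A x → Valid x) {k r : Query → ℕ} (hk : Comp A k) (hr : Comp A r)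
    (hkm : ∀ x, A x → k x * 2 ^ (4 * psi x.σ) ≤ x.m) :
    Comp A (fun x => x.probe (k x) (r x)) := by
  have hb := Comp.two_pow_psi hA (n := 4) (by omega)
  have hm : ∀ x, A x → x.m + 1 < 2 ^ x.w := fun x hx => (hA x hx).bounds.hm
  have h4 : ∀ x, A x → 4 * psi x.σ ≤ x.w := fun x hx => by
    have := (hA x hx).bounds.psi_lt
    omega
  have hkb := hk.mul hb fun x hx => (hkm x hx).trans_lt (by have := hm x hx; omega)
  have hnext : ∀ x, A x → k x * 2 ^ (4 * psi x.σ) + 2 ^ (4 * psi x.σ) ≤ 2 ^ x.w := fun x hx => by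
    have h1 := (hkm x hx).trans_lt (by have := hm x hx; omega : x.m < 2 ^ x.w)
    have h2 : 2 ^ x.w = 2 ^ (x.w - 4 * psi x.σ) * 2 ^ (4 * psi x.σ) := by
      rw [← pow_add, Nat.sub_add_cancel (h4 x hx)]
    rw [h2] at h1 ⊢
    have h3 := Nat.lt_of_mul_lt_mul_right h1
    have := Nat.mul_le_mul_right (2 ^ (4 * psi x.σ)) (Nat.succ_le_of_lt h3)
    rwa [Nat.succ_mul] at this
  have hread : Comp A (fun x => x.key (min (k x * 2 ^ (4 * psi x.σ) + r x) x.m)) := by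
    -- The rank is clamped before the addition, so the sum is a word for arbitrary r.
    have hmin : Comp A (fun x => min (k x * 2 ^ (4 * psi x.σ) + r x) x.m) := by
      refine (((hkb.add (hr.min ((Comp.input_m A).sub hkb (fun x hx => ?_) hkm))
        fun x hx => ?_))).congr fun x hx => ?_
      · have := hm x hx; omega
      · have := hm x hx
        have := hkm x hx
        omega
      · have := hkm x hx
        omega
    refine (Comp.entry_pos hA (t := 5) (by simp) hmin fun x _ => min_le_right _ _).congr
      fun x hx => ?_
    have := (hA x hx).stored_modulus.keys 0 (by omega) (min (k x * 2 ^ (4 * psi x.σ) + r x) x.m) 1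
      (by intro i hi; rw [pow_zero]; omega)
    unfold entries at this
    rw [mul_one] at this
    unfold entry Query.key
    rw [this]
    simp [pack]
  have hkey_lt : ∀ x, A x → x.key (min (k x * 2 ^ (4 * psi x.σ) + r x) x.m) < 2 ^ x.w :=
    fun x hx => (x.key_lt (hA x hx) (min_le_right _ _)).trans_le
      (Nat.pow_le_pow_right (by omega) (by have := (hA x hx).bounds.psi_lt; omega))
  exact hkb.add (hread.mod hb hkey_lt) fun x hx => by
    have h1 := hnext x hx
    have h2 := Nat.mod_lt (x.key (min (k x * 2 ^ (4 * psi x.σ) + r x) x.m))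
      (Nat.two_pow_pos (4 * psi x.σ))
    omega

theorem comp_symbolRank (hA : ∀ x, A x → Valid x) {k o : Query → ℕ} (hk : Comp A k)
    (ho : Comp A o) (hkm : ∀ x, A x → k x * 2 ^ (4 * psi x.σ) ≤ x.m)
    (hob : ∀ x, A x → o x ≤ 2 ^ (4 * psi x.σ)) :
    Comp A (fun x => x.symbolRank (k x) (o x)) := by
  have hb := Comp.two_pow_psi hA (n := 4) (by omega)
  have hmod : Comp A (fun x => x.modulus (k x)) := by
    have h : ∀ x, A x → k x ≤ x.m := fun x hx =>
      (Nat.le_mul_of_pos_right _ (Nat.two_pow_pos _)).trans (hkm x hx)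
    exact (Comp.entry_pos hA (t := 4) (by simp) hk h).congr fun x hx =>
      (hA x hx).stored_modulus.sig _ (h x hx)
  have hlt : ∀ x, A x → x.a % x.modulus (k x) * 2 ^ (4 * psi x.σ) + o x <
      2 ^ (20 * psi x.σ - 1) := fun x hx => by
    refine lt_of_le_of_lt ?_ ((hA x hx).stored_modulus.q_le (k x))
    have h1 := Nat.mod_lt x.a ((hA x hx).stored_modulus.q_pos (k x))
    have h2 := Nat.mul_le_mul_right (2 ^ (4 * psi x.σ)) (Nat.succ_le_of_lt h1)
    rw [Nat.succ_mul] at h2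
    have := hob x hx
    omega
  have hle : ∀ x, A x → 2 ^ (20 * psi x.σ - 1) ≤ 2 ^ x.w := fun x hx =>
    Nat.pow_le_pow_right (by omega) (by have := (hA x hx).bounds.psi_lt; omega)
  have ha : ∀ x, A x → x.a < 2 ^ x.w := fun x hx => by
    have h1 := (hA x hx).a_lt
    have h2 := le_two_pow_lam x.σ
    have h3 : 2 ^ lam x.σ ≤ 2 ^ x.w := Nat.pow_le_pow_right (by omega) (by
      have := (hA x hx).bounds.lam_le
      have := (hA x hx).bounds.hw
      omega)
    omega
  exact comp_rank hA hk (((((Comp.input_a A).mod hmod ha).mul hb fun x hx =>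
    ((Nat.le_add_right _ _).trans_lt (hlt x hx)).trans_le (hle x hx)).add ho fun x hx =>
      (hlt x hx).trans_le (hle x hx))) hkm hlt

theorem Query.symbolRank_le (x : Query) (k o : ℕ) : x.symbolRank k o ≤ 2 ^ (4 * psi x.σ) :=
  (keyRank_le (Nat.two_pow_pos _) _).trans (min_le_left _ _)

theorem comp_leftProbe (hA : ∀ x, A x → Valid x) {k o : Query → ℕ} (hk : Comp A k)
    (ho : Comp A o) (hkm : ∀ x, A x → k x * 2 ^ (4 * psi x.σ) ≤ x.m)
    (hob : ∀ x, A x → o x ≤ 2 ^ (4 * psi x.σ)) :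
    Comp A (fun x => x.leftProbe (k x) (o x)) :=
  comp_accept hA (comp_probe hA hk (comp_symbolRank hA hk ho hkm hob) hkm)

theorem comp_rightProbe (hA : ∀ x, A x → Valid x) {k o : Query → ℕ} (hk : Comp A k)
    (ho : Comp A o) (hkm : ∀ x, A x → k x * 2 ^ (4 * psi x.σ) ≤ x.m)
    (hob : ∀ x, A x → o x ≤ 2 ^ (4 * psi x.σ)) :
    Comp A (fun x => x.rightProbe (k x) (o x)) := by
  have hr := comp_symbolRank hA hk ho hkm hob
  have h1 : Comp A (fun _ => 1) := Comp.num hA (by norm_num)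
  refine comp_accept hA (comp_probe hA hk ?_ hkm)
  refine (hr.ite_lt h1 (Comp.num (n := 0) (fun x hx => hA x hx.1) (by norm_num))
    ((hr.mono fun x hx => hx.1).sub (h1.mono fun x hx => hx.1) (fun x hx => ?_)
      fun x hx => not_lt.1 hx.2)).congr fun x _ => ?_
  · exact (x.symbolRank_le _ _).trans_lt
      (Nat.pow_lt_pow_right (by omega) (by have := (hA x hx.1).bounds.psi_lt; omega))
  · split_ifs <;> omega

theorem comp_leftmost (hA : ∀ x, A x → Valid x) : Comp A (fun x => x.leftmost) := by
  have hb := Comp.two_pow_psi hA (n := 4) (by omega)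
  have hm : ∀ x, A x → x.m < 2 ^ x.w := fun x hx => by
    have := (hA x hx).bounds.hm
    omega
  have h1 := comp_leftProbe hA ((Comp.input_i A).div hb) ((Comp.input_i A).mod hb fun x hx =>
      ((hA x hx).i_le.trans (hA x hx).j_le).trans_lt (hm x hx))
    (fun x hx => (Nat.div_mul_le_self _ _).trans ((hA x hx).i_le.trans (hA x hx).j_le))
    fun x _ => (Nat.mod_lt _ (Nat.two_pow_pos _)).le
  have h2 := comp_leftProbe hA ((Comp.input_j A).div hb) (Comp.num hA (n := 0) (by norm_num))
    (fun x hx => (Nat.div_mul_le_self _ _).trans (hA x hx).j_le) fun x _ => Nat.zero_le _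
  exact h1.ite_le (Comp.input_m A) (h1.mono fun x hx => hx.1) (h2.mono fun x hx => hx.1)

theorem comp_rightmost (hA : ∀ x, A x → Valid x) : Comp A (fun x => x.rightmost) := by
  have hb := Comp.two_pow_psi hA (n := 4) (by omega)
  have hm : ∀ x, A x → x.m < 2 ^ x.w := fun x hx => by
    have := (hA x hx).bounds.hm
    omega
  have hmod : ∀ x : Query, x.j % 2 ^ (4 * psi x.σ) + 1 ≤ 2 ^ (4 * psi x.σ) := fun x =>
    Nat.mod_lt _ (Nat.two_pow_pos _)
  have h1 := comp_rightProbe hA ((Comp.input_j A).div hb)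
    (((Comp.input_j A).mod hb fun x hx => (hA x hx).j_le.trans_lt (hm x hx)).add
      (Comp.num hA (n := 1) (by norm_num)) fun x hx => (hmod x).trans_lt
        (Nat.pow_lt_pow_right (by omega) (by have := (hA x hx).bounds.psi_lt; omega)))
    (fun x hx => (Nat.div_mul_le_self _ _).trans (hA x hx).j_le) fun x _ => hmod x
  have h2 := comp_rightProbe hA ((Comp.input_i A).div hb) hb
    (fun x hx => (Nat.div_mul_le_self _ _).trans ((hA x hx).i_le.trans (hA x hx).j_le))
    fun x _ => le_rfl
  exact h1.ite_le (Comp.input_m A) (h1.mono fun x hx => hx.1) (h2.mono fun x hx => hx.1)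

end computable

/-! ### The rank of an occurrence -/

/-- Width 0 is treated separately, since the quotient in `pack_one` would divide by zero. It does
occur: the replicator in `comp_spread_sum` has width B v, and v may be 0. -/
theorem comp_pack_one {A : Query → Prop} (hA : ∀ x, A x → Valid x) {B v : Query → ℕ}
    (hB : Comp A B) (hv : Comp A v) (hBw : ∀ x, A x → B x < x.w)
    (hw : ∀ x, A x → B x * v x < x.w) :
    Comp A (fun x => pack (B x) (v x) (fun _ => 1)) := by
  have h1 : Comp A (fun _ => 1) := Comp.num hA (by norm_num)
  have hlt : ∀ x, A x → x.w < 2 ^ x.w := fun x _ => Nat.lt_two_pow_self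
  have hones : ∀ {e : Query → ℕ}, Comp A e → (∀ x, A x → e x < x.w) →
      Comp A (fun x => 2 ^ e x - 1) := fun he h =>
    (he.two_pow h).sub h1 (fun x hx => Nat.pow_lt_pow_right (by omega) (h x hx))
      fun x _ => Nat.one_le_two_pow
  refine (hB.ite_lt h1 (hv.mono fun x hx => hx.1) (((hones (hB.mul hv fun x hx =>
    (hw x hx).trans (hlt x hx)) hw).div (hones hB hBw)).mono fun x hx => hx.1)).congr fun x _ => ?_
  split_ifs with h
  · simp [pack, show B x = 0 by omega]
  · rw [pack_one _ _ (by omega)]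

theorem comp_spread_sum {A : Query → Prop} (hA : ∀ x, A x → Valid x) {B v : Query → ℕ}
    {d : Query → ℕ → ℕ} (hP : Comp A (fun x => pack (B x) (v x) (d x))) (hB : Comp A B)
    (hv : Comp A v) (hd : ∀ x, A x → ∀ i < v x, d x i < 2 ^ B x) (hpos : ∀ x, A x → 0 < B x)
    (hs : ∀ x, A x → ∑ i ∈ Finset.range (v x), d x i < 2 ^ (B x * v x + B x) - 1)
    (h₁ : ∀ x, A x → B x * v x + B x < x.w) (h₂ : ∀ x, A x → (B x * v x + B x) * v x < x.w) :
    Comp A (fun x => ∑ i ∈ Finset.range (v x), d x i) := by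
  have h1 : Comp A (fun _ => 1) := Comp.num hA (by norm_num)
  have hlt : ∀ x, A x → x.w < 2 ^ x.w := fun x _ => Nat.lt_two_pow_self
  have hones : ∀ {e : Query → ℕ}, Comp A e → (∀ x, A x → e x < x.w) →
      Comp A (fun x => 2 ^ e x - 1) := fun he h =>
    (he.two_pow h).sub h1 (fun x hx => Nat.pow_lt_pow_right (by omega) (h x hx))
      fun x _ => Nat.one_le_two_pow
  have hBv := hB.mul hv fun x hx => ((Nat.le_add_right _ _).trans_lt (h₁ x hx)).trans (hlt x hx)
  have hBvB := hBv.add hB fun x hx => (h₁ x hx).trans (hlt x hx)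
  have h₃ : ∀ x, A x → B x * v x * v x < x.w := fun x hx =>
    (Nat.mul_le_mul_right _ (Nat.le_add_right _ _)).trans_lt (h₂ x hx)
  have e1 : ∀ x, A x → pack (B x) (v x) (d x) * pack (B x * v x) (v x) (fun _ => 1) <
      2 ^ x.w := fun x hx => by
    rw [mul_comm, pack_mul_const]
    refine (pack_lt fun i _ => ?_).trans (Nat.pow_lt_pow_right (by omega) (h₃ x hx))
    rw [one_mul]
    exact pack_lt (hd x hx)
  have e2 : ∀ x, A x → pack (B x * v x + B x) (v x) (fun _ => 1) * (2 ^ B x - 1) <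
      2 ^ x.w := fun x hx => by
    rw [pack_mul_const]
    refine (pack_lt fun i _ => ?_).trans (Nat.pow_lt_pow_right (by omega) (h₂ x hx))
    rw [one_mul]
    have h5 := Nat.one_le_two_pow (n := B x)
    have h6 : 2 ^ B x ≤ 2 ^ (B x * v x + B x) := Nat.pow_le_pow_right (by omega) (by omega)
    omega
  refine ((((hP.mul (comp_pack_one hA hBv hv (fun x hx => (Nat.le_add_right _ _).trans_lt
    (h₁ x hx)) h₃) e1).land ((comp_pack_one hA hBvB hv h₁ h₂).mul (hones hB fun x hx =>
      (Nat.le_add_left _ _).trans_lt (h₁ x hx)) e2))).mod (hones hBvB h₁) fun x hx => ?_).congr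
      fun x hx => ?_
  · exact Nat.and_le_left.trans_lt (e1 x hx)
  · exact pack_spread_sum (hd x hx) (hpos x hx) (hs x hx)

theorem sum_cnt_sub (c : ℕ → ℕ) (a k X v : ℕ) :
    ∑ i ∈ Finset.range v, (cnt c a ((k + i + 1) * X) - cnt c a ((k + i) * X)) =
      cnt c a ((k + v) * X) - cnt c a (k * X) := by
  have h := Finset.sum_range_tsub (f := fun i => cnt c a ((k + i) * X))
    (fun i j hij => cnt_mono c a (Nat.mul_le_mul_right _ (by omega))) v
  simpa only [add_assoc, add_zero] using h

/-! ### Evaluating counters, buckets and ranks -/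

section

variable {A : Query → Prop}

theorem symbolAt_lt {σ m : ℕ} (C : Fin (m + 1) → Fin σ) {p : ℕ} (hp : p ≤ m) :
    symbolAt C p < σ := by
  simp [symbolAt, hp]

theorem comp_counters (hA : ∀ x, A x → Valid x) {t : ℕ} (ht : t < 13) {e s k n : Query → ℕ}
    (he : Comp A e) (hs : Comp A s) (hk : Comp A k) (hn : Comp A n)
    (hspace : ∀ x, A x → x.σ * (x.m / 2 ^ e x) * width x.σ x.m t ≤ slotLen x.σ x.m)
    (hnum : ∀ x, A x → x.σ * (x.m / 2 ^ e x) ≤ x.m) (hsσ : ∀ x, A x → s x < x.σ)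
    (hkn : ∀ x, A x → k x ≤ x.m / 2 ^ e x) (hw : ∀ x, A x → width x.σ x.m t * n x ≤ x.w) :
    Comp A (fun x => entries x.σ x.m x.D t (s x * (x.m / 2 ^ e x) + k x) (n x)) := by
  have hle : ∀ x, A x → s x * (x.m / 2 ^ e x) + k x ≤ x.σ * (x.m / 2 ^ e x) := fun x hx => by
    have h1 := Nat.mul_le_mul_right (x.m / 2 ^ e x) (Nat.succ_le_of_lt (hsσ x hx))
    rw [Nat.succ_mul] at h1
    exact (Nat.add_le_add_left (hkn x hx) _).trans h1
  have hlt : ∀ x, A x → s x * (x.m / 2 ^ e x) + k x < 2 ^ x.w := fun x hx => by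
    have h1 := hle x hx
    have h2 := hnum x hx
    have h3 := (hA x hx).bounds.hm
    omega
  exact Comp.entries hA ht (((hs.mul ((Comp.input_m A).div_two_pow he) fun x hx =>
    (Nat.le_add_right _ _).trans_lt (hlt x hx)).add hk hlt)) hn
    (fun x hx => (Nat.mul_le_mul_right _ (hle x hx)).trans (hspace x hx)) hlt hw

theorem comp_counter (hA : ∀ x, A x → Valid x) {t : ℕ} (ht : t < 13) {e s k : Query → ℕ}
    (he : Comp A e) (hs : Comp A s) (hk : Comp A k)
    (hspace : ∀ x, A x → x.σ * (x.m / 2 ^ e x) * width x.σ x.m t ≤ slotLen x.σ x.m)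
    (hnum : ∀ x, A x → x.σ * (x.m / 2 ^ e x) ≤ x.m) (hsσ : ∀ x, A x → s x < x.σ)
    (hkn : ∀ x, A x → k x ≤ x.m / 2 ^ e x) :
    Comp A (fun x => entry x.σ x.m x.D t (s x * (x.m / 2 ^ e x) + k x)) :=
  (comp_counters hA ht he hs hk (Comp.num hA (n := 1) (by norm_num)) hspace hnum hsσ hkn
    fun x hx => by rw [mul_one]; exact width_le (hA x hx).bounds t).congr fun x _ => by
      unfold entries
      rw [mul_one]
      rfl

variable {p : Query → ℕ}

theorem pos_lt (hA : ∀ x, A x → Valid x) (hpm : ∀ x, A x → p x ≤ x.m) :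
    ∀ x, A x → p x < 2 ^ x.w := fun x hx => by
  have h1 := hpm x hx
  have h3 := (hA x hx).bounds.hm
  omega

theorem comp_absolute (hA : ∀ x, A x → Valid x) (hp : Comp A p) (hpm : ∀ x, A x → p x ≤ x.m) :
    Comp A (fun x => cnt (symbolAt x.C) (symbolAt x.C (p x))
      (p x / 2 ^ zet x.σ x.m * 2 ^ zet x.σ x.m)) := by
  have hk := hp.div_two_pow (Comp.zet hA)
  have h1 : Comp A (fun _ => 1) := Comp.num hA (by norm_num)
  have hdiv : ∀ x, A x → p x / 2 ^ zet x.σ x.m ≤ x.m / 2 ^ zet x.σ x.m :=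
    fun x hx => Nat.div_le_div_right (hpm x hx)
  have hentry := comp_counter (A := fun x => A x ∧ ¬ p x / 2 ^ zet x.σ x.m < 1)
    (fun x hx => hA x hx.1) (t := 10) (by norm_num) ((Comp.zet hA).mono fun x hx => hx.1)
    (hp.access.mono fun x hx => hx.1)
    ((hk.mono fun x hx => hx.1).sub (h1.mono fun x hx => hx.1)
      (fun x hx => (Nat.div_le_self _ _).trans_lt (pos_lt hA hpm x hx.1)) fun x hx => not_lt.1 hx.2)
    (fun x _ => absoluteCounter_space _ _)
    (fun x _ => by
      have := counter_entries_le x.σ x.m (kap x.σ x.m + x.m.size.size)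
      rw [← add_assoc] at this
      exact this)
    (fun x hx => symbolAt_lt x.C (hpm x hx.1)) (fun x hx => (Nat.sub_le _ _).trans (hdiv x hx.1))
  -- Before the first stored boundary the count is 0 and no entry exists; from there on, entry k - 1
  -- describes boundary k.
  refine (hk.ite_lt h1 (Comp.num (n := 0) (fun x hx => hA x hx.1) (by norm_num)) hentry).congr
    fun x hx => ?_
  have hlow := hdiv x hx
  split_ifs with h
  · rw [Nat.lt_one_iff.1 h, zero_mul]
    simp [cnt]
  · obtain ⟨q, hq⟩ := (hA x hx).stored
    rw [hq.absolute _ (symbolAt_lt x.C (hpm x hx)) _ (by omega), Nat.sub_add_cancel (not_lt.1 h)]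

theorem two_mul_lam_add_kap_lt {x : Query} (h : Bounds x.w x.σ x.m) :
    2 * lam x.σ + kap x.σ x.m < x.w := by
  have := h.zet_lt
  unfold zet at this
  omega

theorem comp_chunkBits (hA : ∀ x, A x → Valid x) : Comp A (fun x => 2 * lam x.σ) :=
  (Comp.lam hA).smul hA (n := 2) (by norm_num) fun x hx => by
    have := (hA x hx).bounds.lam_le
    have := (hA x hx).bounds.hw
    omega

theorem comp_blockBits (hA : ∀ x, A x → Valid x) :
    Comp A (fun x => 2 * lam x.σ + kap x.σ x.m) :=
  (comp_chunkBits hA).add (Comp.kap hA) fun x hx =>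
    (two_mul_lam_add_kap_lt (hA x hx).bounds).trans Nat.lt_two_pow_self

theorem div_mul_two_pow_div (p e f : ℕ) : p / 2 ^ e * 2 ^ e / 2 ^ (e + f) = p / 2 ^ (e + f) := by
  rw [pow_add, ← Nat.div_div_eq_div_mul, Nat.mul_div_cancel _ (Nat.two_pow_pos e),
    Nat.div_div_eq_div_mul]

theorem comp_block (hA : ∀ x, A x → Valid x) (hp : Comp A p) (hpm : ∀ x, A x → p x ≤ x.m) :
    Comp A (fun x => cnt (symbolAt x.C) (symbolAt x.C (p x))
      (p x / 2 ^ (2 * lam x.σ + kap x.σ x.m) * 2 ^ (2 * lam x.σ + kap x.σ x.m)) -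
      cnt (symbolAt x.C) (symbolAt x.C (p x)) (p x / 2 ^ zet x.σ x.m * 2 ^ zet x.σ x.m)) := by
  have hk := hp.div_two_pow (comp_blockBits hA)
  have h1 : Comp A (fun _ => 1) := Comp.num hA (by norm_num)
  have hdiv : ∀ x, A x → p x / 2 ^ (2 * lam x.σ + kap x.σ x.m) ≤
      x.m / 2 ^ (2 * lam x.σ + kap x.σ x.m) :=
    fun x hx => Nat.div_le_div_right (hpm x hx)
  have hentry := comp_counter (A := fun x => A x ∧ ¬ p x / 2 ^ (2 * lam x.σ + kap x.σ x.m) < 1)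
    (fun x hx => hA x hx.1) (t := 11) (by norm_num) ((comp_blockBits hA).mono fun x hx => hx.1)
    (hp.access.mono fun x hx => hx.1)
    ((hk.mono fun x hx => hx.1).sub (h1.mono fun x hx => hx.1)
      (fun x hx => (Nat.div_le_self _ _).trans_lt (pos_lt hA hpm x hx.1)) fun x hx => not_lt.1 hx.2)
    (fun x _ => blockCounter_space _ _) (fun x _ => counter_entries_le x.σ x.m (kap x.σ x.m))
    (fun x hx => symbolAt_lt x.C (hpm x hx.1)) (fun x hx => (Nat.sub_le _ _).trans (hdiv x hx.1))
  refine (hk.ite_lt h1 (Comp.num (n := 0) (fun x hx => hA x hx.1) (by norm_num)) hentry).congr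
    fun x hx => ?_
  have hlow := hdiv x hx
  split_ifs with h
  · rw [Nat.lt_one_iff.1 h, zero_mul]
    simp [cnt]
  · obtain ⟨q, hq⟩ := (hA x hx).stored
    have e := div_mul_two_pow_div (p x) (2 * lam x.σ + kap x.σ x.m) x.m.size.size
    rw [hq.block _ (symbolAt_lt x.C (hpm x hx)) _ (by omega), Nat.sub_add_cancel (not_lt.1 h)]
    rw [show zet x.σ x.m = 2 * lam x.σ + kap x.σ x.m + x.m.size.size from rfl, e]

/-- The v < 2^κ chunks between the start of the superblock and the chunk of p have consecutive
counters. These are read as one field and added, and the sum of their differences telescopes. -/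
theorem comp_chunk (hA : ∀ x, A x → Valid x) (hp : Comp A p) (hpm : ∀ x, A x → p x ≤ x.m) :
    Comp A (fun x => cnt (symbolAt x.C) (symbolAt x.C (p x))
      (p x / 2 ^ (2 * lam x.σ) * 2 ^ (2 * lam x.σ)) -
      cnt (symbolAt x.C) (symbolAt x.C (p x))
      (p x / 2 ^ (2 * lam x.σ + kap x.σ x.m) * 2 ^ (2 * lam x.σ + kap x.σ x.m))) := by
  have h1 : Comp A (fun _ => 1) := Comp.num hA (by norm_num)
  have hkap : ∀ x, A x → kap x.σ x.m < x.w := fun x hx => by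
    have := two_mul_lam_add_kap_lt (hA x hx).bounds
    omega
  have hL := comp_chunkBits hA
  let k : Query → ℕ := fun x => p x / 2 ^ (2 * lam x.σ + kap x.σ x.m) * 2 ^ kap x.σ x.m
  let v : Query → ℕ := fun x => p x / 2 ^ (2 * lam x.σ) % 2 ^ kap x.σ x.m
  have hkv : ∀ x : Query, k x + v x = p x / 2 ^ (2 * lam x.σ) := fun x => by
    have := Nat.div_add_mod' (p x / 2 ^ (2 * lam x.σ)) (2 ^ kap x.σ x.m)
    rw [Nat.div_div_eq_div_mul, ← pow_add] at this
    exact this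
  have hle : ∀ x, A x → k x + v x ≤ x.m / 2 ^ (2 * lam x.σ) := fun x hx => by
    rw [hkv]
    exact Nat.div_le_div_right (hpm x hx)
  have hk : Comp A k := (hp.div_two_pow (comp_blockBits hA)).mul_two_pow (Comp.kap hA)
    fun x hx => by
      have h1 := hkv x
      have h2 := Nat.div_le_self (p x) (2 ^ (2 * lam x.σ))
      have h3 := pos_lt hA hpm x hx
      exact ((Nat.le_add_right (k x) (v x)).trans (h1.le.trans h2)).trans_lt h3
  have hv : Comp A v := (hp.div_two_pow hL).mod_two_pow (Comp.kap hA)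
    (fun x hx => (Nat.div_le_self _ _).trans_lt (pos_lt hA hpm x hx)) hkap
  have hvlt : ∀ x : Query, v x < 2 ^ kap x.σ x.m := fun x => Nat.mod_lt _ (Nat.two_pow_pos _)
  have hL1 : ∀ x, A x → 2 * lam x.σ + 1 < 2 ^ x.w := fun x hx => by
    have := (hA x hx).bounds.lam_le
    have := (hA x hx).bounds.hw
    have := Nat.lt_two_pow_self (n := x.w)
    omega
  have hw₁ : ∀ x, A x → (2 * lam x.σ + 1) * v x + (2 * lam x.σ + 1) < x.w := fun x hx => by
    rw [← Nat.mul_succ]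
    exact (Nat.mul_le_mul_left _ (hvlt x)).trans_lt (hA x hx).bounds.spread₁
  have hw₂ : ∀ x, A x → ((2 * lam x.σ + 1) * v x + (2 * lam x.σ + 1)) * v x < x.w := fun x hx => by
    rw [← Nat.mul_succ]
    exact (Nat.mul_le_mul (Nat.mul_le_mul_left _ (hvlt x)) (Nat.le_sub_one_of_lt (hvlt x))).trans_lt
      (hA x hx).bounds.spread₂
  have hdigit : ∀ (x : Query) (i : ℕ), cnt (symbolAt x.C) (symbolAt x.C (p x))
      ((k x + i + 1) * 2 ^ (2 * lam x.σ)) - cnt (symbolAt x.C) (symbolAt x.C (p x))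
      ((k x + i) * 2 ^ (2 * lam x.σ)) ≤ 2 ^ (2 * lam x.σ) := fun x i => by
    refine (cnt_sub_le _ _ (Nat.mul_le_mul_right _ (Nat.le_succ _))).trans ?_
    rw [Nat.succ_mul, Nat.add_sub_cancel_left]
  have hent := comp_counters hA (t := 12) (by norm_num) hL hp.access hk hv
    (fun x _ => chunkCounter_space _ _) (fun x _ => counter_entries_le x.σ x.m 0)
    (fun x hx => symbolAt_lt x.C (hpm x hx)) (fun x hx => (Nat.le_add_right _ _).trans (hle x hx))
    (fun x hx => ((Nat.le_add_right _ _).trans_lt (hw₁ x hx)).le)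
  have hpack := hent.congr fun x hx => by
    obtain ⟨q, hq⟩ := (hA x hx).stored
    exact hq.chunk _ (symbolAt_lt x.C (hpm x hx)) _ _ (hle x hx)
  refine (comp_spread_sum hA hpack (hL.add h1 hL1) hv (fun x _ i _ => (hdigit x i).trans_lt
    (Nat.pow_lt_pow_right (by omega) (by omega))) (fun x _ => by omega) (fun x _ => ?_) hw₁
    hw₂).congr fun x _ => ?_
  · refine (Finset.sum_le_card_nsmul _ _ _ fun i _ => hdigit x i).trans_lt ?_
    rw [Finset.card_range, smul_eq_mul]
    have h2 : v x < 2 ^ ((2 * lam x.σ + 1) * v x) := Nat.lt_two_pow_self.trans_le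
      (Nat.pow_le_pow_right (by omega) (Nat.le_mul_of_pos_left _ (by omega)))
    have h3 := Nat.mul_lt_mul_of_pos_right h2 (Nat.two_pow_pos (2 * lam x.σ))
    have h4 : 2 ^ ((2 * lam x.σ + 1) * v x + (2 * lam x.σ + 1)) =
        2 * (2 ^ ((2 * lam x.σ + 1) * v x) * 2 ^ (2 * lam x.σ)) := by
      rw [← pow_add, ← pow_succ']
      rfl
    omega
  · rw [sum_cnt_sub, hkv]
    have h2 : k x * 2 ^ (2 * lam x.σ) = p x / 2 ^ (2 * lam x.σ + kap x.σ x.m) *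
        2 ^ (2 * lam x.σ + kap x.σ x.m) := by
      rw [pow_add _ (2 * lam x.σ)]
      change p x / 2 ^ (2 * lam x.σ + kap x.σ x.m) * 2 ^ kap x.σ x.m * _ = _
      rw [pow_add]
      ring
    rw [h2]

theorem comp_tableLen (hA : ∀ x, A x → Valid x) : Comp A (fun x => tableLen x.σ x.m) := by
  have h8 := Comp.two_pow_psi hA (n := 8) (by norm_num)
  have hlam : ∀ x, A x → 4 * lam x.σ ≤ x.w + 3 := fun x hx => (hA x hx).bounds.lam_le
  have hcap : Comp A (fun x => keyCap x.σ x.m) :=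
    (((comp_chunkBits hA).two_pow fun x hx => by
      have := hlam x hx
      have := (hA x hx).bounds.hw
      omega).min ((Comp.input_m A).add (Comp.num hA (by norm_num))
        fun x hx => (hA x hx).bounds.hm)).div h8
  refine ((Comp.lam hA).smul hA (n := 16) (by norm_num) fun x hx => ?_).mul hcap fun x hx => ?_
  · have := hlam x hx
    have := (hA x hx).bounds.hw
    omega
  · have h1 := table_entries_le (hA x hx).bounds.hσ x.m
    have h2 := Nat.le_mul_of_pos_left (tableLen x.σ x.m)
      (n := (x.m / 2 ^ (2 * lam x.σ) + 1) * (2 * lam x.σ + 1)) (by positivity)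
    exact (h2.trans h1).trans_lt (hA x hx).bounds.hm

theorem comp_bucketKey (hA : ∀ x, A x → Valid x) (hp : Comp A p) (hpm : ∀ x, A x → p x ≤ x.m) :
    Comp A (fun x => bucketKey (symbolAt x.C) (2 * lam x.σ) (2 ^ (8 * psi x.σ)) (p x)) ∧
    ∀ x, A x → bucketKey (symbolAt x.C) (2 * lam x.σ) (2 ^ (8 * psi x.σ)) (p x) < 2 ^ x.w := by
  have h1 : Comp A (fun _ => 1) := Comp.num hA (by norm_num)
  have hL := comp_chunkBits hA
  have hlam : ∀ x, A x → 3 * lam x.σ + 1 < x.w := fun x hx => by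
    have := (hA x hx).bounds.lam_le
    have := (hA x hx).bounds.hw
    omega
  have hlt : ∀ x, A x →
      bucketKey (symbolAt x.C) (2 * lam x.σ) (2 ^ (8 * psi x.σ)) (p x) < 2 ^ x.w := fun x hx =>
    (bucketKey_lt ((symbolAt_lt x.C (hpm x hx)).trans_le (le_two_pow_lam x.σ))).trans_le
      (Nat.pow_le_pow_right (by omega) (by have := hlam x hx; omega))
  have hlev : Comp A (fun x => level (symbolAt x.C) (2 * lam x.σ) (2 ^ (8 * psi x.σ)) (p x)) :=
    (Comp.entry_pos hA (t := 1) (by simp) hp hpm).congr fun x hx => by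
      obtain ⟨q, hq⟩ := (hA x hx).stored
      exact hq.lev _ (hpm x hx)
  have hnode : ∀ x, A x → 2 ^ (2 * lam x.σ) + p x % 2 ^ (2 * lam x.σ) < 2 ^ x.w := fun x hx => by
    have h2 := Nat.mod_lt (p x) (Nat.two_pow_pos (2 * lam x.σ))
    have h3 : 2 ^ (2 * lam x.σ) + 2 ^ (2 * lam x.σ) ≤ 2 ^ x.w := by
      rw [← mul_two, ← pow_succ]
      exact Nat.pow_le_pow_right (by omega) (by have := hlam x hx; omega)
    omega
  refine ⟨(hp.access.mul_two_pow (hL.add h1 fun x hx => ?_) fun x hx => ?_).add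
    (((hL.two_pow fun x hx => ?_).add (hp.mod_two_pow hL (pos_lt hA hpm) fun x hx => ?_)
      hnode).div_two_pow hlev) hlt, hlt⟩
  · have := hlam x hx
    have := Nat.lt_two_pow_self (n := x.w)
    omega
  · exact (Nat.le_add_right _ _).trans_lt (hlt x hx)
  · have := hlam x hx; omega
  · have := hlam x hx; omega

/-- One table lookup yields the modulus and a second one the bucket. The addresses are legitimate
only for a nonzero hint, so they are treated under the restricted predicate `A'`. -/
theorem comp_bucket (hA : ∀ x, A x → Valid x) (hp : Comp A p) (hpm : ∀ x, A x → p x ≤ x.m) :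
    Comp A (fun x => bucket (symbolAt x.C) (2 * lam x.σ) (2 ^ (8 * psi x.σ)) (p x)) := by
  have h1 : Comp A (fun _ => 1) := Comp.num hA (by norm_num)
  have hhint := Comp.entry_pos hA (t := 2) (by simp) hp hpm
  let A' : Query → Prop := fun x => A x ∧ ¬ entry x.σ x.m x.D 2 (p x) < 1
  have hA' : ∀ x, A' x → Valid x := fun x hx => hA x hx.1
  have hsub : ∀ x, A' x → A x := fun x hx => hx.1
  let g : Query → ℕ := fun x =>
    (p x / 2 ^ (2 * lam x.σ) * (2 * lam x.σ + 1) + (entry x.σ x.m x.D 2 (p x) - 1)) *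
      tableLen x.σ x.m
  let key : Query → ℕ := fun x =>
    bucketKey (symbolAt x.C) (2 * lam x.σ) (2 ^ (8 * psi x.σ)) (p x)
  let q : Query → ℕ := fun x => entry x.σ x.m x.D 9 (g x)
  have hdict : ∀ x, A' x → 1 ≤ q x ∧ 1 + key x % q x < tableLen x.σ x.m ∧
      entry x.σ x.m x.D 2 (p x) - 1 < 2 * lam x.σ + 1 ∧
      entry x.σ x.m x.D 9 (g x + (1 + key x % q x)) =
        bucket (symbolAt x.C) (2 * lam x.σ) (2 ^ (8 * psi x.σ)) (p x) := by
    intro x hx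
    obtain ⟨_, hS⟩ := (hA' x hx).stored
    rcases hS.dict (p x) (hpm x hx.1) with h | ⟨j, q', hj, h2, h3, h4, h5, h6⟩
    · exact absurd hx.2 (by rw [h.2]; simp)
    · have e : j = entry x.σ x.m x.D 2 (p x) - 1 := by omega
      subst e
      have e2 : q x = q' := h3
      rw [← e2] at h4 h5 h6
      exact ⟨h4, h5, hj, h6⟩
  have hindex : ∀ x, A' x → ∀ r < tableLen x.σ x.m, g x + r + 1 ≤
      (x.m / 2 ^ (2 * lam x.σ) + 1) * (2 * lam x.σ + 1) * tableLen x.σ x.m := by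
    intro x hx r hr
    have h2 := Nat.div_le_div_right (c := 2 ^ (2 * lam x.σ)) (hpm x hx.1)
    have h3 := (hdict x hx).2.2.1
    have h4 := Nat.mul_le_mul_right (2 * lam x.σ + 1) (Nat.succ_le_succ h2)
    rw [Nat.succ_mul] at h4
    have h5 : p x / 2 ^ (2 * lam x.σ) * (2 * lam x.σ + 1) +
        (entry x.σ x.m x.D 2 (p x) - 1) + 1 ≤
        (x.m / 2 ^ (2 * lam x.σ) + 1) * (2 * lam x.σ + 1) := le_trans (by omega) h4
    have h6 := Nat.mul_le_mul_right (tableLen x.σ x.m) h5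
    rw [Nat.succ_mul] at h6
    exact le_trans (by change g x + r + 1 ≤ g x + _; omega) h6
  have hread : ∀ {h : Query → ℕ}, Comp A' h → (∀ x, A' x → h x + 1 ≤
      (x.m / 2 ^ (2 * lam x.σ) + 1) * (2 * lam x.σ + 1) * tableLen x.σ x.m) →
      Comp A' (fun x => entry x.σ x.m x.D 9 (h x)) := fun hh hle =>
    Comp.entry hA' (by norm_num) hh
      (fun x hx => (Nat.mul_le_mul_right _ (by have := hle x hx; omega)).trans
        (table_space (hA' x hx).bounds.hσ x.m))
      fun x hx => by
        have := hle x hx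
        have := table_entries_le (hA' x hx).bounds.hσ x.m
        have := (hA' x hx).bounds.hm
        omega
  have hglt : ∀ x, A' x → ∀ r < tableLen x.σ x.m, g x + r < 2 ^ x.w := fun x hx r hr => by
    have := hindex x hx r hr
    have := table_entries_le (hA' x hx).bounds.hσ x.m
    have := (hA' x hx).bounds.hm
    omega
  have hg0 : ∀ x, A' x → g x < 2 ^ x.w := fun x hx =>
    hglt x hx 0 (by have := (hdict x hx).2.1; omega)
  have hL := comp_chunkBits hA'
  have hp' := hp.mono hsub
  have htpos : ∀ x, A' x → 0 < tableLen x.σ x.m := fun x hx => by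
    have := (hdict x hx).2.1
    omega
  have hrow : ∀ x, A' x → p x / 2 ^ (2 * lam x.σ) * (2 * lam x.σ + 1) +
      (entry x.σ x.m x.D 2 (p x) - 1) < 2 ^ x.w := fun x hx =>
    (Nat.le_mul_of_pos_right _ (htpos x hx)).trans_lt (hg0 x hx)
  have hg : Comp A' g := by
    refine ((((hp'.div_two_pow hL).mul (hL.add (h1.mono hsub) fun x hx => ?_) fun x hx => ?_).add
      ((hhint.mono hsub).sub (h1.mono hsub) (fun x hx => ?_) fun x hx => not_lt.1 hx.2)
      hrow)).mul (comp_tableLen hA') hg0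
    · have := (hA' x hx).bounds.lam_le
      have := (hA' x hx).bounds.hw
      have := Nat.lt_two_pow_self (n := x.w)
      omega
    · exact (Nat.le_add_right _ _).trans_lt (hrow x hx)
    · refine (field_lt _ _ _).trans_le (Nat.pow_le_pow_right (by omega) ?_)
      exact width_le (hA' x hx).bounds 2
  have hq : Comp A' q := hread hg fun x hx => hindex x hx 0 (htpos x hx)
  have hkey := comp_bucketKey hA hp hpm
  have hslot : Comp A' (fun x => 1 + key x % q x) :=
    (h1.mono hsub).add ((hkey.1.mono hsub).mod hq fun x hx => hkey.2 x hx.1) fun x hx =>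
      (Nat.le_add_left _ _).trans_lt (hglt x hx _ (hdict x hx).2.1)
  have hres := (hread (hg.add hslot fun x hx => hglt x hx _ (hdict x hx).2.1)
    fun x hx => hindex x hx _ (hdict x hx).2.1).congr fun x hx => (hdict x hx).2.2.2
  refine (hhint.ite_lt h1 (Comp.num (n := 0) (fun x hx => hA x hx.1) (by norm_num)) hres).congr
    fun x hx => ?_
  split_ifs with h
  · obtain ⟨_, hS⟩ := (hA x hx).stored
    rcases hS.dict (p x) (hpm x hx) with h' | ⟨j, q', _, h2, _⟩
    · exact h'.1.symm
    · omega
  · rfl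

/-- The boundaries of regions, superblocks and chunks below p are nested, so the truncated
differences of counts telescope to the count at the chunk start. Adding the local rank and p itself
completes the rank. -/
theorem comp_cnt (hA : ∀ x, A x → Valid x) (hp : Comp A p) (hpm : ∀ x, A x → p x ≤ x.m) :
    Comp A (fun x => cnt (symbolAt x.C) (symbolAt x.C (p x)) (p x + 1)) := by
  have h1 : Comp A (fun _ => 1) := Comp.num hA (by norm_num)
  have hinb : Comp A (fun x => localRank (symbolAt x.C) (2 * lam x.σ) (p x) %
      2 ^ (8 * psi x.σ)) :=
    (Comp.entry_pos hA (t := 3) (by simp) hp hpm).congr fun x hx => by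
      obtain ⟨q, hq⟩ := (hA x hx).stored
      exact hq.inb _ (hpm x hx)
  have h8 := Comp.two_pow_psi hA (n := 8) (by norm_num)
  have hbucket := comp_bucket hA hp hpm
  have hcnt_le : ∀ x, A x → cnt (symbolAt x.C) (symbolAt x.C (p x)) (p x) ≤ x.m := fun x hx => by
    have := cnt_add_le (symbolAt x.C) (symbolAt x.C (p x)) 0 (p x)
    rw [zero_add] at this
    have h0 : cnt (symbolAt x.C) (symbolAt x.C (p x)) 0 = 0 := by simp [cnt]
    have := hpm x hx
    omega
  have hrec : ∀ x : Query, bucket (symbolAt x.C) (2 * lam x.σ) (2 ^ (8 * psi x.σ)) (p x) *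
      2 ^ (8 * psi x.σ) + localRank (symbolAt x.C) (2 * lam x.σ) (p x) % 2 ^ (8 * psi x.σ) =
      localRank (symbolAt x.C) (2 * lam x.σ) (p x) := fun x => Nat.div_add_mod' _ _
  have hlocal : ∀ x, A x → localRank (symbolAt x.C) (2 * lam x.σ) (p x) < 2 ^ x.w := fun x hx => by
    have := cnt_eq_localRank (symbolAt x.C) (2 * lam x.σ) (p x)
    have := hcnt_le x hx
    have := (hA x hx).bounds.hm
    omega
  have hloc : Comp A (fun x => localRank (symbolAt x.C) (2 * lam x.σ) (p x)) :=
    ((hbucket.mul h8 fun x hx => ((Nat.le_add_right _ _).trans (hrec x).le).trans_lt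
      (hlocal x hx)).add hinb fun x hx => (hrec x).le.trans_lt (hlocal x hx)).congr
      fun x _ => hrec x
  have e₁ : ∀ x : Query, p x / 2 ^ zet x.σ x.m * 2 ^ zet x.σ x.m ≤
      p x / 2 ^ (2 * lam x.σ + kap x.σ x.m) * 2 ^ (2 * lam x.σ + kap x.σ x.m) := fun x => by
    have e := div_mul_two_pow_div (p x) (2 * lam x.σ + kap x.σ x.m) x.m.size.size
    have := Nat.div_mul_le_self
      (p x / 2 ^ (2 * lam x.σ + kap x.σ x.m) * 2 ^ (2 * lam x.σ + kap x.σ x.m)) (2 ^ zet x.σ x.m)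
    rwa [show zet x.σ x.m = 2 * lam x.σ + kap x.σ x.m + x.m.size.size from rfl, e] at this
  have e₂ : ∀ x : Query, p x / 2 ^ (2 * lam x.σ + kap x.σ x.m) *
      2 ^ (2 * lam x.σ + kap x.σ x.m) ≤ p x / 2 ^ (2 * lam x.σ) * 2 ^ (2 * lam x.σ) := fun x => by
    have e := div_mul_two_pow_div (p x) (2 * lam x.σ) (kap x.σ x.m)
    have := Nat.div_mul_le_self (p x / 2 ^ (2 * lam x.σ) * 2 ^ (2 * lam x.σ))
      (2 ^ (2 * lam x.σ + kap x.σ x.m))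
    rwa [e] at this
  have key : ∀ x : Query, cnt (symbolAt x.C) (symbolAt x.C (p x)) (p x) + 1 = _ := fun x =>
    (cnt_succ_self (symbolAt x.C) (p x)).symm
  have c₁ := fun x : Query => cnt_mono (symbolAt x.C) (symbolAt x.C (p x)) (e₁ x)
  have c₂ := fun x : Query => cnt_mono (symbolAt x.C) (symbolAt x.C (p x)) (e₂ x)
  have c₃ := fun x : Query => cnt_eq_localRank (symbolAt x.C) (2 * lam x.σ) (p x)
  have hm : ∀ x, A x → x.m + 1 < 2 ^ x.w := fun x hx => (hA x hx).bounds.hm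
  refine (((((comp_absolute hA hp hpm).add (comp_block hA hp hpm) fun x hx => ?_).add
    (comp_chunk hA hp hpm) fun x hx => ?_).add hloc fun x hx => ?_).add h1 fun x hx => ?_).congr
    fun x hx => ?_
  all_goals
    have := c₁ x
    have := c₂ x
    have := c₃ x
    have := hcnt_le x hx
    have := hm x hx
    have := key x
    omega

end

/-! ### The query program -/

open Classical in
/-- The first occurrence of the symbol in the interval, or `m + 1`. -/
noncomputable def Query.first (x : Query) : ℕ :=
  if h : ∃ p, x.Occurs p then Nat.find h else x.m + 1

open Classical in
/-- The last occurrence of the symbol in the interval, or `0`. -/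
noncomputable def Query.last (x : Query) : ℕ := Nat.findGreatest x.Occurs x.j

/-! ### Characterising the first and last occurrence -/

section spec

variable {x : Query}

theorem Query.first_eq {p : ℕ} (hp : x.Occurs p) (hmin : ∀ p', x.Occurs p' → p ≤ p') :
    x.first = p := by
  classical
  have h : ∃ p, x.Occurs p := ⟨p, hp⟩
  unfold Query.first
  rw [dif_pos h]
  exact le_antisymm (Nat.find_le hp) (hmin _ (Nat.find_spec h))

theorem Query.first_of_not_occurs (h : ∀ p, ¬ x.Occurs p) : x.first = x.m + 1 := by
  unfold Query.first
  rw [dif_neg (by simpa using h)]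

theorem Query.occurs_first (h : ∃ p, x.Occurs p) : x.Occurs x.first := by
  classical
  unfold Query.first
  rw [dif_pos h]
  exact Nat.find_spec h

theorem Query.first_le {p : ℕ} (hp : x.Occurs p) : x.first ≤ p := by
  classical
  have h : ∃ p, x.Occurs p := ⟨p, hp⟩
  unfold Query.first
  rw [dif_pos h]
  exact Nat.find_le hp

theorem Query.occurs_last (h : ∃ p, x.Occurs p) : x.Occurs x.last := by
  classical
  obtain ⟨p, hp⟩ := h
  exact Nat.findGreatest_spec hp.2.1 hp

theorem Query.le_last {p : ℕ} (hp : x.Occurs p) : p ≤ x.last := by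
  classical
  exact Nat.le_findGreatest hp.2.1 hp

theorem Query.last_eq {p : ℕ} (hp : x.Occurs p) (hmax : ∀ p', x.Occurs p' → p' ≤ p) :
    x.last = p :=
  le_antisymm (hmax _ (Query.occurs_last ⟨p, hp⟩)) (Query.le_last hp)

theorem Query.first_le_iff (hj : x.j ≤ x.m) : x.first ≤ x.m ↔ ∃ p, x.Occurs p := by
  constructor
  · intro h
    by_contra hn
    push Not at hn
    rw [Query.first_of_not_occurs hn] at h
    omega
  · intro h
    exact (Query.occurs_first h).2.1.trans hj

end spec

/-- An interval query. -/
structure Proper (x : Query) : Prop where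
  hw : 7 ≤ x.w
  hm : x.m + 1 < 2 ^ x.w
  i_le : x.i ≤ x.j
  j_le : x.j ≤ x.m

theorem Proper.lt {x : Query} (h : Proper x) {n : ℕ} (hn : n ≤ 7) : n < 2 ^ x.w := by
  have := h.hw
  have := Nat.lt_two_pow_self (n := x.w)
  omega

/-! ### Short sequences: unrolled scans -/

section scan

/-- Recursion on the fixed bound n unrolls the loop into an expression. Its size may be enormous,
but it depends on n only and is therefore a constant. -/
theorem comp_scan_cnt (n : ℕ) : ∀ {A : Query → Prop} (_ : ∀ x, A x → Proper x) {s p : Query → ℕ},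
    Comp A s → Comp A p → (∀ x, A x → p x ≤ x.m + 1) → (∀ x, A x → p x ≤ n) →
    Comp A (fun x => cnt (symbolAt x.C) (s x) (p x)) := by
  induction n with
  | zero =>
    intro A hA s p _ _ _ hn
    refine (Comp.const 0 fun x hx => (hA x hx).lt (by omega)).congr fun x hx => ?_
    have := hn x hx
    rw [show p x = 0 by omega]
    simp [cnt]
  | succ n ih =>
    intro A hA s p hs hp hpm hn
    have h1 : Comp A (fun _ => 1) := Comp.const 1 fun x hx => (hA x hx).lt (by omega)
    have h0 : Comp A (fun _ => 0) := Comp.const 0 fun x hx => (hA x hx).lt (by omega)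
    let A' : Query → Prop := fun x => A x ∧ ¬ p x < 1
    have hm : ∀ x, A x → p x < 2 ^ x.w := fun x hx => by
      have := hpm x hx
      have := (hA x hx).hm
      omega
    have hr : Comp A' (fun x => p x - 1) := (hp.mono fun x hx => hx.1).sub
      (h1.mono fun x hx => hx.1) (fun x hx => hm x hx.1) fun x hx => not_lt.1 hx.2
    have hrec := ih (fun x hx => hA x hx.1) (hs.mono fun x (hx : A' x) => hx.1) hr
      (fun x hx => by have := hpm x hx.1; omega) fun x hx => by have := hn x hx.1; omega
    have hbound : ∀ x, A' x → cnt (symbolAt x.C) (s x) (p x - 1) + 1 < 2 ^ x.w := fun x hx => by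
      have e1 := cnt_add_le (symbolAt x.C) (s x) 0 (p x - 1)
      have e2 : cnt (symbolAt x.C) (s x) 0 = 0 := by simp [cnt]
      have e3 := hm x hx.1
      have e4 := hx.2
      rw [zero_add] at e1
      omega
    refine (hp.ite_lt h1 (h0.mono fun x hx => hx.1) ((hr.access).ite_eq
      (hs.mono fun x hx => hx.1) ((hrec.add (h1.mono fun x hx => hx.1) hbound).mono
      fun x hx => hx.1) (hrec.mono fun x hx => hx.1))).congr fun x _ => ?_
    by_cases h : p x < 1
    · rw [if_pos h, show p x = 0 by omega]
      simp [cnt]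
    · have e : cnt (symbolAt x.C) (s x) (p x) = cnt (symbolAt x.C) (s x) (p x - 1) +
          if symbolAt x.C (p x - 1) = s x then 1 else 0 := by
        conv_lhs => rw [show p x = p x - 1 + 1 by omega]
        exact Nat.count_succ _ _
      rw [if_neg h, e]
      split_ifs <;> rfl

theorem comp_scan_first (n : ℕ) : ∀ {A : Query → Prop} (_ : ∀ x, A x → Proper x) {p : Query → ℕ},
    Comp A p → (∀ x, A x → x.i ≤ p x ∧ p x ≤ x.j + 1 ∧ x.j + 1 ≤ p x + n) →
    (∀ x, A x → ∀ p', x.Occurs p' → p x ≤ p') → Comp A (fun x => x.first) := by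
  induction n with
  | zero =>
    intro A hA p _ hp hmin
    have h1 : Comp A (fun _ => 1) := Comp.const 1 fun x hx => (hA x hx).lt (by omega)
    refine ((Comp.input_m A).add h1 fun x hx => (hA x hx).hm).congr fun x hx => ?_
    refine (Query.first_of_not_occurs fun p' hp' => ?_).symm
    have := hmin x hx p' hp'
    have := hp x hx
    have := hp'.2.1
    omega
  | succ n ih =>
    intro A hA p hp hp2 hmin
    have h1 : Comp A (fun _ => 1) := Comp.const 1 fun x hx => (hA x hx).lt (by omega)
    have hs := (Comp.input_m A).add h1 fun x hx => (hA x hx).hm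
    have hrec := ih (A := fun x => (A x ∧ p x ≤ x.j) ∧ ¬ symbolAt x.C (p x) = x.a)
      (fun x hx => hA x hx.1.1) ((hp.mono fun x hx => hx.1.1).add (h1.mono fun x hx => hx.1.1)
        fun x hx => by
          have := (hA x hx.1.1).hm
          have := (hA x hx.1.1).j_le
          have := hx.1.2
          omega) (fun x hx => by
            have := hp2 x hx.1.1
            have := hx.1.2
            omega) fun x hx p' hp' => by
              refine Nat.lt_of_le_of_ne (hmin x hx.1.1 p' hp') fun h => hx.2 ?_
              rw [h]
              exact hp'.2.2
    refine (hp.ite_le (Comp.input_j A) (((hp.access).mono fun x hx => hx.1).ite_eq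
      ((Comp.input_a A).mono fun x hx => hx.1) (hp.mono fun x hx => hx.1.1) hrec)
      (hs.mono fun x hx => hx.1)).congr fun x hx => ?_
    split_ifs with h h'
    · exact (Query.first_eq ⟨(hp2 x hx).1, h, h'⟩ (hmin x hx)).symm
    · rfl
    · refine (Query.first_of_not_occurs fun p' hp' => h ?_).symm
      exact (hmin x hx p' hp').trans hp'.2.1

theorem comp_scan_last (n : ℕ) : ∀ {A : Query → Prop} (_ : ∀ x, A x → Proper x)
    (_ : ∀ x, A x → ∃ p, x.Occurs p) {p : Query → ℕ},
    Comp A p → (∀ x, A x → p x ≤ x.j + 1 ∧ p x ≤ x.i + n) →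
    (∀ x, A x → ∀ p', x.Occurs p' → p' < p x) → Comp A (fun x => x.last) := by
  induction n with
  | zero =>
    intro A hA hex p _ hp hmax
    refine (Comp.const 0 fun x hx => (hA x hx).lt (by omega)).congr fun x hx => ?_
    obtain ⟨p', hp'⟩ := hex x hx
    have := hmax x hx p' hp'
    have := hp x hx
    have := hp'.1
    omega
  | succ n ih =>
    intro A hA hex p hp hp2 hmax
    have h1 : Comp A (fun _ => 1) := Comp.const 1 fun x hx => (hA x hx).lt (by omega)
    have hip : ∀ x, A x → x.i + 1 ≤ p x := fun x hx => by
      obtain ⟨p', hp'⟩ := hex x hx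
      have := hmax x hx p' hp'
      have := hp'.1
      omega
    have hr : Comp A (fun x => p x - 1) := hp.sub h1 (fun x hx => by
      have := (hA x hx).hm
      have := (hA x hx).j_le
      have := hp2 x hx
      omega) fun x hx => by have := hip x hx; omega
    have hrec := ih (A := fun x => A x ∧ ¬ symbolAt x.C (p x - 1) = x.a)
      (fun x hx => hA x hx.1) (fun x hx => hex x hx.1) (hr.mono fun x hx => hx.1)
      (fun x hx => by have := hp2 x hx.1; omega) fun x hx p' hp' => by
        have e := hmax x hx.1 p' hp'
        refine Nat.lt_of_le_of_ne (by omega) fun h => hx.2 ?_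
        rw [← h]
        exact hp'.2.2
    refine ((hr.access).ite_eq (Comp.input_a A) (hr.mono fun x hx => hx.1) hrec).congr
      fun x hx => ?_
    split_ifs with h
    · have := hip x hx
      have := hp2 x hx
      refine (Query.last_eq ⟨by omega, by omega, h⟩ fun p' hp' => ?_).symm
      have := hmax x hx p' hp'
      omega
    · rfl

end scan

/-- The rank of the first occurrence. -/
noncomputable def Query.firstRank (x : Query) : ℕ := cnt (symbolAt x.C) x.a (x.first + 1)

/-- The rank of the last occurrence. -/
noncomputable def Query.lastRank (x : Query) : ℕ := cnt (symbolAt x.C) x.a (x.last + 1)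

theorem comp_small (N : ℕ) {A : Query → Prop} (hA : ∀ x, A x → Proper x)
    (hN : ∀ x, A x → x.m < N) : Comp A (fun x => x.first) ∧
    Comp (fun x => A x ∧ x.first ≤ x.m) (fun x => x.firstRank) ∧
    Comp (fun x => A x ∧ x.first ≤ x.m) (fun x => x.lastRank) := by
  have hone : ∀ {B : Query → Prop}, (∀ x, B x → Proper x) → Comp B (fun _ => 1) :=
    fun hB => Comp.const 1 fun x hx => (hB x hx).lt (by omega)
  have hfirst := comp_scan_first N hA (Comp.input_i A) (fun x hx => by
    have := (hA x hx).i_le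
    have := (hA x hx).j_le
    have := hN x hx
    omega) fun x _ p' hp' => hp'.1
  let A' : Query → Prop := fun x => A x ∧ x.first ≤ x.m
  have hA' : ∀ x, A' x → Proper x := fun x hx => hA x hx.1
  have hex : ∀ x, A' x → ∃ p, x.Occurs p := fun x hx =>
    (Query.first_le_iff (hA' x hx).j_le).1 hx.2
  have hjlt : ∀ x, A' x → x.j + 1 < 2 ^ x.w := fun x hx => by
    have := (hA' x hx).hm
    have := (hA' x hx).j_le
    omega
  have hlast := comp_scan_last N hA' hex ((Comp.input_j A').add (hone hA') hjlt) (fun x hx => by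
    have := (hA' x hx).j_le
    have := hN x hx.1
    omega) fun x _ p' hp' => Nat.lt_succ_of_le hp'.2.1
  have hcnt : ∀ {f : Query → ℕ}, Comp A' f → (∀ x, A' x → f x ≤ x.m) →
      Comp A' (fun x => cnt (symbolAt x.C) x.a (f x + 1)) := fun hf hfm =>
    comp_scan_cnt N hA' (Comp.input_a A') (hf.add (hone hA') fun x hx => by
      have := hfm x hx
      have := (hA' x hx).hm
      omega) (fun x hx => Nat.succ_le_succ (hfm x hx)) fun x hx =>
        (Nat.succ_le_succ (hfm x hx)).trans (hN x hx.1)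
  exact ⟨hfirst, hcnt (hfirst.mono fun x hx => hx.1) fun x hx => hx.2,
    hcnt hlast fun x hx => (Query.occurs_last (hex x hx)).2.1.trans (hA' x hx).j_le⟩

theorem comp_large {A : Query → Prop} (hA : ∀ x, A x → Valid x) : Comp A (fun x => x.first) ∧
    Comp (fun x => A x ∧ x.first ≤ x.m) (fun x => x.firstRank) ∧
    Comp (fun x => A x ∧ x.first ≤ x.m) (fun x => x.lastRank) := by
  have hfirst : Comp A (fun x => x.first) := (comp_leftmost hA).congr fun x hx => by
    by_cases h : ∃ p, x.Occurs p
    · exact Query.leftmost_eq (hA x hx) (Query.occurs_first h) fun p' hp' => Query.first_le hp'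
    · push Not at h
      rw [Query.leftmost_of_not_occurs h, Query.first_of_not_occurs h]
  let A' : Query → Prop := fun x => A x ∧ x.first ≤ x.m
  have hA' : ∀ x, A' x → Valid x := fun x hx => hA x hx.1
  have hex : ∀ x, A' x → ∃ p, x.Occurs p := fun x hx =>
    (Query.first_le_iff (hA' x hx).j_le).1 hx.2
  have hlast : Comp A' (fun x => x.last) := (comp_rightmost hA').congr fun x hx =>
    Query.rightmost_eq (hA' x hx) (Query.occurs_last (hex x hx)) fun p' hp' => Query.le_last hp'
  have hcnt : ∀ {f : Query → ℕ}, Comp A' f → (∀ x, A' x → x.Occurs (f x)) →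
      Comp A' (fun x => cnt (symbolAt x.C) x.a (f x + 1)) := fun hf hocc =>
    (comp_cnt hA' hf fun x hx => (hocc x hx).2.1.trans (hA' x hx).j_le).congr fun x hx => by
      rw [(hocc x hx).2.2]
  exact ⟨hfirst, hcnt (hfirst.mono fun x hx => hx.1) fun x hx => Query.occurs_first (hex x hx),
    hcnt hlast fun x hx => Query.occurs_last (hex x hx)⟩

/-- The number 2^N need not be a word on a given machine. Repeated halving still allows m to be
compared with it for every w. -/
theorem comp_div_two_pow {A : Query → Prop} (hA : ∀ x, A x → Proper x) (N : ℕ) :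
    Comp A (fun x => x.m / 2 ^ N) := by
  induction N with
  | zero => exact (Comp.input_m A).congr fun x _ => by rw [pow_zero, Nat.div_one]
  | succ N ih =>
    refine (ih.div (Comp.const 2 fun x hx => (hA x hx).lt (by omega))).congr fun x _ => ?_
    rw [pow_succ, Nat.div_div_eq_div_mul]

/-- The program tests m against the threshold itself, so one program contains both the scan and the
data structure algorithm. The contents of the bit string matter only above the threshold. -/
theorem exists_query_program (N : ℕ) : ∃ P K, ∀ x, Proper x → (2 ^ N ≤ x.m → Valid x) →
    ∀ t, 1 ≤ t → ∃ s c, Exec x.w x.C x.D t P (initConfig x.w x.m x.σ x.a x.i x.j) s c ∧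
      c ≤ K * t ∧ s.output = if x.first ≤ x.m then some (x.firstRank, x.lastRank) else none := by
  let A : Query → Prop := fun x => Proper x ∧ (2 ^ N ≤ x.m → Valid x)
  have hA : ∀ x, A x → Proper x := fun x hx => hx.1
  have hpos : 0 < 2 ^ N := Nat.two_pow_pos N
  have hone : ∀ {B : Query → Prop}, (∀ x, B x → Proper x) → Comp B (fun _ => 1) :=
    fun hB => Comp.const 1 fun x hx => (hB x hx).lt (by omega)
  have hzero : ∀ {B : Query → Prop}, (∀ x, B x → Proper x) → Comp B (fun _ => 0) :=
    fun hB => Comp.const 0 fun x hx => (hB x hx).lt (by omega)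
  obtain ⟨s₀, s₁, s₂⟩ := comp_small (A := fun x => A x ∧ x.m / 2 ^ N < 1) (2 ^ N)
    (fun x hx => hA x hx.1) fun x hx => by
      have := (Nat.div_lt_iff_lt_mul hpos).1 hx.2
      rwa [one_mul] at this
  obtain ⟨l₀, l₁, l₂⟩ := comp_large (A := fun x => A x ∧ ¬ x.m / 2 ^ N < 1) fun x hx =>
    hx.1.2 (by
      have h := hx.2
      rwa [Nat.div_lt_iff_lt_mul hpos, one_mul, not_lt] at h)
  have hcase : ∀ {B : Query → Prop} {f : Query → ℕ}, (∀ x, B x → A x) →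
      Comp (fun x => B x ∧ x.m / 2 ^ N < 1) f → Comp (fun x => B x ∧ ¬ x.m / 2 ^ N < 1) f →
      Comp B f := fun hB hs hl =>
    ((comp_div_two_pow (fun x hx => hA x (hB x hx)) N).ite_lt
      (hone fun x hx => hA x (hB x hx)) hs hl).congr fun x _ => ite_self _
  have hfirst : Comp A (fun x => x.first) := hcase (fun x hx => hx) s₀ l₀
  have hrank : ∀ {f : Query → ℕ}, Comp (fun x => A x ∧ x.first ≤ x.m) f →
      Comp A (fun x => if x.first ≤ x.m then f x else 0) := fun hf =>
    hfirst.ite_le (Comp.input_m A) hf (hzero fun x hx => hA x hx.1)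
  obtain ⟨P, K, h⟩ := Comp.exists_program (hrank (hone fun x hx => hA x hx.1))
    (hrank (hcase (fun x hx => hx.1) (s₁.mono fun x hx => ⟨⟨hx.1.1, hx.2⟩, hx.1.2⟩)
      (l₁.mono fun x hx => ⟨⟨hx.1.1, hx.2⟩, hx.1.2⟩)))
    (hrank (hcase (fun x hx => hx.1) (s₂.mono fun x hx => ⟨⟨hx.1.1, hx.2⟩, hx.1.2⟩)
      (l₂.mono fun x hx => ⟨⟨hx.1.1, hx.2⟩, hx.1.2⟩)))
  refine ⟨P, K, fun x hx hv t ht => ?_⟩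
  obtain ⟨s, c, hs, hc, ho⟩ := h x ⟨hx, hv⟩ (by have := hx.hw; omega) t ht
  refine ⟨s, c, hs, hc, ho.trans ?_⟩
  by_cases hf : x.first ≤ x.m <;> simp [hf]

/-! ### Translation to the statement over `Fin` -/

theorem seqRank_eq_cnt {m σ : ℕ} (C : Fin (m + 1) → Fin σ) (a : Fin σ) (p : Fin (m + 1)) :
    seqRank C a p = cnt (symbolAt C) a (p + 1) := by
  unfold seqRank cnt
  rw [Nat.count_eq_card_filter_range]
  refine Finset.card_bij (fun k _ => (k : ℕ)) (fun k hk => ?_) (fun k _ l _ h => Fin.ext h)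
    fun k hk => ?_
  · simp only [Finset.mem_filter, Finset.mem_Iic, Fin.le_def] at hk
    refine Finset.mem_filter.2 ⟨Finset.mem_range.2 (Nat.lt_succ_of_le hk.1), ?_⟩
    have hkm := k.isLt
    simp [symbolAt, hk.2]
    omega
  · obtain ⟨h1, h2⟩ := Finset.mem_filter.1 hk
    rw [Finset.mem_range] at h1
    have hkm : k < m + 1 := by omega
    refine ⟨⟨k, hkm⟩, ?_, rfl⟩
    simp only [symbolAt, hkm, dite_true] at h2
    simp only [Finset.mem_filter, Finset.mem_Iic, Fin.le_def]
    exact ⟨by omega, Fin.ext h2⟩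

theorem mem_occurrences {w m σ : ℕ} (C : Fin (m + 1) → Fin σ) (D : List Bool) (a : Fin σ)
    (i j p : Fin (m + 1)) :
    p ∈ occurrences C a i j ↔ (⟨w, σ, m, C, D, a, i, j⟩ : Query).Occurs p := by
  simp only [occurrences, Finset.mem_filter, Finset.mem_Icc, Query.Occurs, symbolAt, p.isLt,
    dite_true, Fin.le_def, Fin.ext_iff, and_assoc]

theorem intervalRank_eq {w m σ : ℕ} (C : Fin (m + 1) → Fin σ) (D : List Bool) (a : Fin σ)
    (i j : Fin (m + 1)) {x : Query} (hx : x = ⟨w, σ, m, C, D, a, i, j⟩) :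
    (if x.first ≤ x.m then some (x.firstRank, x.lastRank) else none) = intervalRank C a i j := by
  have hmem : ∀ p : Fin (m + 1), p ∈ occurrences C a i j ↔ x.Occurs p := fun p => by
    rw [hx]
    exact mem_occurrences C D a i j p
  have hxm : x.m = m := by rw [hx]
  have hj : x.j ≤ x.m := by
    rw [hx]
    exact Nat.lt_succ_iff.1 j.isLt
  have hlt : ∀ {p}, x.Occurs p → p < m + 1 := fun hp => by
    have := hp.2.1
    omega
  have hiff := Query.first_le_iff hj
  unfold intervalRank
  by_cases h : (occurrences C a i j).Nonempty
  · obtain ⟨p, hp⟩ := h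
    have hne : (occurrences C a i j).Nonempty := ⟨p, hp⟩
    rw [if_pos (hiff.2 ⟨p, (hmem p).1 hp⟩), dif_pos hne, seqRank_eq_cnt, seqRank_eq_cnt]
    have h1 : x.first = ((occurrences C a i j).min' hne : Fin (m + 1)) :=
      Query.first_eq ((hmem _).1 (Finset.min'_mem _ _)) fun p' hp' =>
        Fin.le_def.1 (Finset.min'_le _ (⟨p', hlt hp'⟩ : Fin (m + 1)) ((hmem _).2 hp'))
    have h2 : x.last = ((occurrences C a i j).max' hne : Fin (m + 1)) :=
      Query.last_eq ((hmem _).1 (Finset.max'_mem _ _)) fun p' hp' =>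
        Fin.le_def.1 (Finset.le_max' _ (⟨p', hlt hp'⟩ : Fin (m + 1)) ((hmem _).2 hp'))
    unfold Query.firstRank Query.lastRank
    rw [h1, h2, hx]
  · rw [dif_neg h, if_neg]
    intro h'
    obtain ⟨p, hp⟩ := hiff.1 h'
    exact h ⟨⟨p, hlt hp⟩, (hmem _).2 hp⟩

theorem gap_le {σ i j : ℕ} (hσ : 3 ≤ σ)
    (h : (j : ℝ) - (i : ℝ) ≤ 2 * (Real.logb 2 (σ : ℝ)) ^ 2) : j - i ≤ 2 * (lam σ * lam σ) := by
  have hσ' : (1 : ℝ) ≤ (σ : ℝ) := by exact_mod_cast (by omega : 1 ≤ σ)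
  have h0 : 0 ≤ Real.logb 2 (σ : ℝ) := Real.logb_nonneg (by norm_num) hσ'
  have h1 : Real.logb 2 (σ : ℝ) ≤ lam σ := by
    rw [Real.logb_le_iff_le_rpow (by norm_num) (by linarith), Real.rpow_natCast]
    exact_mod_cast le_two_pow_lam σ
  have h2 : (j : ℝ) ≤ ((i + 2 * (lam σ * lam σ) : ℕ) : ℝ) := by
    push_cast
    nlinarith
  have h3 : j ≤ i + 2 * (lam σ * lam σ) := by exact_mod_cast h2
  omega

/-- Above the threshold 2^N ≤ m < 2^w gives the large word length. The constant is 13 · 100 · 10 ·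
2: the slots, the bits per position in units of ψ, the bound on ψ, and m + 1 ≤ 2m. Below the
threshold the string is empty, as it must be for m = 0, where the bound allows no bits. -/
theorem exists_structure (N : ℕ) (hN : 1000000 ≤ N) {w σ m : ℕ} (C : Fin (m + 1) → Fin σ)
    (hσ : 3 ≤ σ) (hσw : σ ^ 4 ≤ 2 ^ w) (hm : m + 1 < 2 ^ w) :
    ∃ D : List Bool,
      (D.length : ℝ) ≤ 26000 * ((m : ℝ) * Real.logb 2 (Real.logb 2 (σ : ℝ))) ∧
      (2 ^ N ≤ m → Bounds w σ m ∧ ∃ q, Stored σ m (symbolAt C) q D) := by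
  have hpsi := psi_le_logb hσ
  have h1 : (1 : ℝ) ≤ (psi σ : ℝ) := by exact_mod_cast one_le_psi σ
  by_cases h : 2 ^ N ≤ m
  · have hwN : N < w := (Nat.pow_lt_pow_iff_right (a := 2) (by norm_num)).1 (by omega)
    have hB : Bounds w σ m := Bounds.mk' hσ hσw hm (by omega)
    obtain ⟨q, D, hD, hS⟩ := exists_stored hB (c := symbolAt C) fun p => by
      refine lt_of_lt_of_le ?_ (le_two_pow_lam σ)
      unfold symbolAt
      split_ifs
      · exact (C _).isLt
      · omega
    refine ⟨D, ?_, fun _ => ⟨hB, q, hS⟩⟩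
    have hm1 : (1 : ℝ) ≤ (m : ℝ) := by
      have := Nat.one_le_two_pow (n := N)
      exact_mod_cast this.trans h
    rw [hD]
    unfold slotLen
    push_cast
    have e1 : (m : ℝ) * psi σ ≤ m * (10 * Real.logb 2 (Real.logb 2 (σ : ℝ))) :=
      mul_le_mul_of_nonneg_left hpsi (by linarith)
    have e2 : 1 * (psi σ : ℝ) ≤ m * psi σ := mul_le_mul_of_nonneg_right hm1 (by linarith)
    nlinarith
  · refine ⟨[], ?_, fun h' => absurd h' h⟩
    have h2 : 0 ≤ Real.logb 2 (Real.logb 2 (σ : ℝ)) := by linarith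
    simp only [List.length_nil, Nat.cast_zero]
    positivity

end WordRAM

/-- One query program and one constant serve all sequences `C[0..m]` over all alphabets
`{0, …, σ - 1}`, all word lengths `w` and all access times `t`. -/
theorem mainTheorem12 :
    ∃ (P : WordRAM.Program) (K : ℕ),
      ∀ (w σ m : ℕ) (C : Fin (m + 1) → Fin σ),
        3 ≤ σ → σ ^ 4 ≤ 2 ^ w → m + 1 < 2 ^ w →
        ∃ D : List Bool,
          (D.length : ℝ) ≤ (K : ℝ) * ((m : ℝ) * Real.logb 2 (Real.logb 2 (σ : ℝ))) ∧
          ∀ (t : ℕ), 1 ≤ t →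
          ∀ (a : Fin σ) (i j : Fin (m + 1)), i ≤ j →
            ((j : ℕ) : ℝ) - ((i : ℕ) : ℝ) ≤ 2 * (Real.logb 2 (σ : ℝ)) ^ 2 →
            ∃ (s : WordRAM.Config) (c : ℕ),
              WordRAM.Exec w C D t P (WordRAM.initConfig w m σ a i j) s c ∧
              c ≤ K * t ∧
              s.output = intervalRank C a i j := by
  obtain ⟨P, K, hP⟩ := WordRAM.exists_query_program 1000000
  refine ⟨P, max K 26000, fun w σ m C hσ hσw hm => ?_⟩
  obtain ⟨D, hD, hS⟩ := WordRAM.exists_structure 1000000 le_rfl C hσ hσw hm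
  -- Since σ ≥ 3, the word size is forced by 3^4 = 81 > 2^6.
  have hw : 7 ≤ w := by
    by_contra h
    have h1 : 2 ^ w ≤ 2 ^ 6 := Nat.pow_le_pow_right (by omega) (by omega)
    have h2 : 3 ^ 4 ≤ σ ^ 4 := Nat.pow_le_pow_left hσ 4
    omega
  have hpsi := WordRAM.psi_le_logb hσ
  refine ⟨D, hD.trans ?_, fun t ht a i j hij hgap => ?_⟩
  · have h1 : (26000 : ℝ) ≤ ((max K 26000 : ℕ) : ℝ) := by exact_mod_cast le_max_right K 26000
    refine mul_le_mul_of_nonneg_right h1 (mul_nonneg (Nat.cast_nonneg _) ?_)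
    have h2 : (0 : ℝ) ≤ (WordRAM.psi σ : ℝ) := Nat.cast_nonneg _
    linarith
  · have hij' : (i : ℕ) ≤ j := hij
    have hj : (j : ℕ) ≤ m := Nat.lt_succ_iff.1 j.isLt
    obtain ⟨s, c, hs, hc, ho⟩ := hP ⟨w, σ, m, C, D, a, i, j⟩ ⟨hw, hm, hij', hj⟩
      (fun h => ⟨(hS h).1, (hS h).2, a.isLt, hij', hj, WordRAM.gap_le hσ hgap⟩) t ht
    exact ⟨s, c, hs, hc.trans (Nat.mul_le_mul_right _ (le_max_left _ _)),
      ho.trans (WordRAM.intervalRank_eq C D a i j rfl)⟩
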